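/- **Setting.** Let $n\ge 3$, $\gamma_n=\frac{n-2}{2}$, $\tau=\frac{n}{n-2}$. Let $B^n$ be the unit ball of $\mathbb R^n$ centred at the origin, $S^{n-1}=\partial B^n$, let $O\in S^{n-1}$ be a point (the "south pole"), and let $r=r(z)$ be the geodesic distance on $S^{n-1}$ from $z$ to $O$. Let $H^1(B^n)$ be the completion of the functions smooth up to the boundary, and for $u\in H^1(B^n)$ put $$E(u)=\int_{B^n}|\nabla u|^2\,dv+\int_{S^{n-1}}\gamma_n u^2\,d\sigma,\qquad \|u\|=\sqrt{E(u)},\qquad S=\{u\in H^1(B^n): u\ge 0,\ E(u)=E(1)=\gamma_n|S^{n-1}|\}.$$ For $\tilde q\in S^{n-1}$ and $0<\lambda\le 1$ let $$u_{\tilde q,\lambda}(z)=\left(\frac{4\lambda}{|(1-\lambda)z-(1+\lambda)\tilde q|^2}\right)^{\frac{n-2}{2}},$$ and let $q(u)=\int_{B^n}z\,u^{2\tau}dv\big/\int_{B^n}u^{2\tau}dv$. For $\rho_0>0$ put $$\Sigma=\Sigma_{\rho_0}=\Big\{u\in S:\ |q(u)-O|\le\rho_0,\ \inf_{t\in\mathbb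 R,\ \tilde q\in S^{n-1},\ 0<\lambda\le1}\|u-t\,u_{\tilde q,\lambda}\|\le\rho_0\Big\},$$ and let $\partial\Sigma$ be the topological boundary of $\Sigma$ in $S$ with respect to $\|\cdot\|$. Let $h:S^{n-1}\to\mathbb R$ be a continuous function that depends only on $r$, with $h(O)>0$, such that near $O$ $$h=h(O)-a\,r^\alpha+k(r),\qquad a>0,\quad n-3<\alpha<n-1,$$ where $k$ is differentiable on an interval $(0,\varepsilon)$ and $k'(s)=o(s^{\alpha-1})$ as $s\to0^+$. For $1<p\le\tau$ put $J_p(u)=\int_{S^{n-1}}h\,u^{p+1}d\sigma$. **Proposition 3.5.** There is $\rho_1>0$ such that for every $\rho_0\in(0,\rho_1]$ there are $p_0\in(1,\tau)$ and $\delta_0>0$ such that for all $p\in[p_0,\tau]$ and all $u\in\partial\Sigma_{\rho_0}$ the integral $J_p(u)$ converges and $$J_p(u)\le h(O)\,|S^{n-1}|-\delta_0 .$$ -/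

import Mathlib

open MeasureTheory Filter Topology Asymptotics Metric Set
open scoped ContDiff

noncomputable section

namespace BallBubble

/-- The Euclidean space of dimension `n`. -/
abbrev Eu (n : ℕ) := EuclideanSpace ℝ (Fin n)

/-- The unit sphere, boundary of the unit ball (the centre of the ball is the origin of `Eu n`). -/
abbrev Sph (n : ℕ) := Metric.sphere (0 : Eu n) 1

/-- Lebesgue measure on the open unit ball. -/
abbrev ballMeasure (n : ℕ) : Measure (Eu n) := volume.restrict (Metric.ball (0 : Eu n) 1)

/-- The surface measure of the unit sphere. -/
abbrev sphMeasure (n : ℕ) : Measure (Sph n) := (volume : Measure (Eu n)).toSphere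

/-- The area of the unit sphere. -/
def sphArea (n : ℕ) : ℝ := (sphMeasure n).real Set.univ

/-- The constant `(n - 2) / 2`. -/
def gam (n : ℕ) : ℝ := ((n : ℝ) - 2) / 2

/-- The critical exponent `n / (n - 2)`. -/
def tau (n : ℕ) : ℝ := (n : ℝ) / ((n : ℝ) - 2)

/-- `φ` is of class `C^∞` in a neighbourhood of the closed unit ball. -/
def SmoothOnBall {n : ℕ} (φ : Eu n → ℝ) : Prop :=
  ∃ U : Set (Eu n), IsOpen U ∧ Metric.closedBall (0 : Eu n) 1 ⊆ U ∧ ContDiffOn ℝ ∞ φ U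

/-- Triples (function on the ball, vector field on the ball, function on the sphere), all of
them square integrable. -/
abbrev Triple (n : ℕ) :=
  Lp ℝ 2 (ballMeasure n) × Lp (Eu n) 2 (ballMeasure n) × Lp ℝ 2 (sphMeasure n)

lemma SmoothOnBall.add {n : ℕ} {φ ψ : Eu n → ℝ} (hφ : SmoothOnBall φ) (hψ : SmoothOnBall ψ) :
    SmoothOnBall (φ + ψ) := by
  obtain ⟨U, hU, hBU, hφU⟩ := hφ
  obtain ⟨V, hV, hBV, hψV⟩ := hψ
  exact ⟨U ∩ V, hU.inter hV, subset_inter hBU hBV,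
    (hφU.mono inter_subset_left).add (hψV.mono inter_subset_right)⟩

lemma SmoothOnBall.smul {n : ℕ} {φ : Eu n → ℝ} (c : ℝ) (hφ : SmoothOnBall φ) :
    SmoothOnBall (c • φ) := by
  obtain ⟨U, hU, hBU, hφU⟩ := hφ
  exact ⟨U, hU, hBU, hφU.const_smul c⟩

lemma SmoothOnBall.differentiableAt {n : ℕ} {φ : Eu n → ℝ} (hφ : SmoothOnBall φ) {z : Eu n}
    (hz : z ∈ Metric.closedBall (0 : Eu n) 1) : DifferentiableAt ℝ φ z := by
  obtain ⟨U, hU, hBU, hφU⟩ := hφ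
  exact (hφU.contDiffAt (hU.mem_nhds (hBU hz))).differentiableAt (by simp)

/-- The triples `(φ|_B, ∇φ|_B, φ|_{∂B})` with `φ` smooth up to the boundary. -/
def smoothTriples (n : ℕ) : Submodule ℝ (Triple n) where
  carrier := {T | ∃ φ : Eu n → ℝ, SmoothOnBall φ ∧
    (T.1 =ᵐ[ballMeasure n] φ) ∧ (T.2.1 =ᵐ[ballMeasure n] gradient φ) ∧
    (T.2.2 =ᵐ[sphMeasure n] fun z => φ z)}
  zero_mem' := by
    refine ⟨0, ⟨univ, isOpen_univ, subset_univ _, contDiffOn_const⟩, Lp.coeFn_zero _ _ _, ?_,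
      Lp.coeFn_zero _ _ _⟩
    refine (Lp.coeFn_zero _ _ _).trans (Eventually.of_forall fun z => ?_)
    simp [gradient]
  add_mem' := by
    rintro T T' ⟨φ, hφ, h1, h2, h3⟩ ⟨ψ, hψ, k1, k2, k3⟩
    refine ⟨φ + ψ, hφ.add hψ, (Lp.coeFn_add _ _).trans (h1.add k1), ?_,
      (Lp.coeFn_add _ _).trans (h3.add k3)⟩
    refine (Lp.coeFn_add _ _).trans ((h2.add k2).trans ?_)
    filter_upwards [ae_restrict_mem measurableSet_ball] with z hz
    have hz' := ball_subset_closedBall hz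
    simp [gradient, fderiv_add (hφ.differentiableAt hz') (hψ.differentiableAt hz')]
  smul_mem' := by
    rintro c T ⟨φ, hφ, h1, h2, h3⟩
    refine ⟨c • φ, hφ.smul c, (Lp.coeFn_smul _ _).trans (h1.const_smul c), ?_,
      (Lp.coeFn_smul _ _).trans (h3.const_smul c)⟩
    refine (Lp.coeFn_smul _ _).trans ((h2.const_smul c).trans ?_)
    filter_upwards [ae_restrict_mem measurableSet_ball] with z hz
    have hz' := ball_subset_closedBall hz
    simp [gradient, fderiv_const_smul (hφ.differentiableAt hz')]

/-- The Sobolev space `H¹` of the unit ball as the completion of the functions that are smooth up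
to the boundary: an element is recorded as the triple (function, weak gradient, boundary trace),
and the space is the closure of the triples that come from smooth functions. -/
def H1 (n : ℕ) : Submodule ℝ (Triple n) := (smoothTriples n).topologicalClosure

/-- The function on the ball. -/
def funVal {n : ℕ} (u : H1 n) : Eu n → ℝ := (u : Triple n).1

/-- The weak gradient. -/
def weakGrad {n : ℕ} (u : H1 n) : Eu n → Eu n := (u : Triple n).2.1

/-- The boundary trace. -/
def trace {n : ℕ} (u : H1 n) : Sph n → ℝ := (u : Triple n).2.2

instance ballMeasure_finite (n : ℕ) : IsFiniteMeasure (ballMeasure n) :=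
  ⟨by simpa using (measure_ball_lt_top (μ := (volume : Measure (Eu n))))⟩

lemma SmoothOnBall.continuousOn {n : ℕ} {φ : Eu n → ℝ} (hφ : SmoothOnBall φ) :
    ContinuousOn φ (Metric.closedBall (0 : Eu n) 1) := fun _ hz =>
  (hφ.differentiableAt hz).continuousAt.continuousWithinAt

lemma SmoothOnBall.continuousOn_gradient {n : ℕ} {φ : Eu n → ℝ} (hφ : SmoothOnBall φ) :
    ContinuousOn (gradient φ) (Metric.closedBall (0 : Eu n) 1) := by
  obtain ⟨U, hU, hBU, hφU⟩ := hφ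
  have h := (hφU.continuousOn_fderiv_of_isOpen hU (by simp)).mono hBU
  exact (InnerProductSpace.toDual ℝ (Eu n)).symm.continuous.comp_continuousOn h

lemma memLp_of_continuousOn {n : ℕ} {F : Type*} [NormedAddCommGroup F]
    [SecondCountableTopology F] {f : Eu n → F}
    (hf : ContinuousOn f (Metric.closedBall (0 : Eu n) 1)) : MemLp f 2 (ballMeasure n) := by
  obtain ⟨C, hC⟩ := (isCompact_closedBall (0 : Eu n) 1).exists_bound_of_continuousOn hf
  refine MemLp.of_bound ((hf.mono ball_subset_closedBall).aestronglyMeasurable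
    measurableSet_ball) C ?_
  filter_upwards [ae_restrict_mem measurableSet_ball] with z hz
  exact hC z (ball_subset_closedBall hz)

lemma SmoothOnBall.memLp_trace {n : ℕ} {φ : Eu n → ℝ} (hφ : SmoothOnBall φ) :
    MemLp (fun z : Sph n => φ z) 2 (sphMeasure n) := by
  have hc : Continuous (fun z : Sph n => φ z) :=
    hφ.continuousOn.comp_continuous continuous_subtype_val
      fun z => sphere_subset_closedBall z.2
  obtain ⟨C, hC⟩ := (isCompact_closedBall (0 : Eu n) 1).exists_bound_of_continuousOn
    hφ.continuousOn
  exact MemLp.of_bound hc.aestronglyMeasurable C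
    (Eventually.of_forall fun z => hC z (sphere_subset_closedBall z.2))

/-- A function that is smooth up to the boundary, as an element of `H¹`. -/
def ofSmooth {n : ℕ} (φ : Eu n → ℝ) (hφ : SmoothOnBall φ) : H1 n :=
  ⟨((memLp_of_continuousOn hφ.continuousOn).toLp φ,
    (memLp_of_continuousOn hφ.continuousOn_gradient).toLp (gradient φ),
    hφ.memLp_trace.toLp fun z : Sph n => φ z),
    (smoothTriples n).le_topologicalClosure ⟨φ, hφ,
      (memLp_of_continuousOn hφ.continuousOn).coeFn_toLp,
      (memLp_of_continuousOn hφ.continuousOn_gradient).coeFn_toLp,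
      hφ.memLp_trace.coeFn_toLp⟩⟩

/-- The energy `E(u) = ∫_B |∇u|² dv + γ_n ∫_{∂B} u² dσ`. -/
def energy {n : ℕ} (u : H1 n) : ℝ :=
  (∫ z, ‖weakGrad u z‖ ^ 2 ∂(ballMeasure n)) + ∫ z, gam n * trace u z ^ 2 ∂(sphMeasure n)

/-- The norm `√E(u)`. -/
def normE {n : ℕ} (u : H1 n) : ℝ := √(energy u)

/-- The non-negative functions with `E(u) = E(1) = γ_n |S^{n-1}|`. -/
def constraintSet (n : ℕ) : Set (H1 n) :=
  {u | energy u = gam n * sphArea n ∧ (∀ᵐ z ∂(ballMeasure n), 0 ≤ funVal u z) ∧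
    ∀ᵐ z ∂(sphMeasure n), 0 ≤ trace u z}

/-- The functional `J_p(u) = ∫_{∂B} h u^{p+1} dσ`. -/
def J {n : ℕ} (h : Sph n → ℝ) (p : ℝ) (u : H1 n) : ℝ :=
  ∫ z, h z * trace u z ^ (p + 1) ∂(sphMeasure n)

/-- The standard bubble with concentration point `e` and parameter `lam`. On the sphere it is
`(lam / (lam² cos²(r/2) + sin²(r/2)))^((n-2)/2)`, where `r` is the angle between `z` and `e`; it is
harmonic in the ball. -/
def bubbleFun {n : ℕ} (e : Sph n) (lam : ℝ) (z : Eu n) : ℝ :=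
  (4 * lam / ‖(1 - lam) • z - (1 + lam) • (e : Eu n)‖ ^ 2) ^ (((n : ℝ) - 2) / 2)

lemma smoothOnBall_bubbleFun {n : ℕ} (e : Sph n) {lam : ℝ} (hlam : lam ∈ Set.Ioc (0 : ℝ) 1) :
    SmoothOnBall (bubbleFun e lam) := by
  obtain ⟨h0, h1⟩ := hlam
  have hc : Continuous fun z : Eu n => (1 - lam) • z - (1 + lam) • (e : Eu n) := by fun_prop
  refine ⟨{z | (1 - lam) • z - (1 + lam) • (e : Eu n) ≠ 0},
    isOpen_ne_fun hc continuous_const, ?_, ?_⟩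
  · intro z hz hz0
    have hz1 : ‖z‖ ≤ 1 := by simpa using hz
    have he : ‖(e : Eu n)‖ = 1 := by simp
    have hn := congrArg norm (sub_eq_zero.1 hz0)
    rw [norm_smul, norm_smul, he, Real.norm_of_nonneg (by linarith),
      Real.norm_of_nonneg (by linarith)] at hn
    nlinarith
  · have hd : ContDiff ℝ ∞ fun z : Eu n => (1 - lam) • z - (1 + lam) • (e : Eu n) :=
      (contDiff_id.const_smul _).sub contDiff_const
    refine ContDiffOn.rpow_const_of_ne ?_ ?_
    · exact contDiffOn_const.div (hd.norm_sq ℝ).contDiffOn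
        fun _ hz => pow_ne_zero _ (norm_ne_zero_iff.2 hz)
    · intro z hz
      have := norm_pos_iff.2 hz
      positivity

/-- The standard bubble as an element of `H¹`. -/
def bubble {n : ℕ} (e : Sph n) (lam : Set.Ioc (0 : ℝ) 1) : H1 n :=
  ofSmooth (bubbleFun e lam) (smoothOnBall_bubbleFun e lam.2)

/-- The centre of mass `∫_B z u^{2τ} dv / ∫_B u^{2τ} dv`. -/
def massCenter {n : ℕ} (u : H1 n) : Eu n :=
  (∫ z, funVal u z ^ (2 * tau n) ∂(ballMeasure n))⁻¹ •
    ∫ z, funVal u z ^ (2 * tau n) • z ∂(ballMeasure n)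

/-- The distance `inf ‖u - t u_q‖` from `u` to the real multiples of the bubbles. -/
def bubbleDist {n : ℕ} (u : H1 n) : ℝ :=
  ⨅ x : ℝ × Sph n × Set.Ioc (0 : ℝ) 1, normE (u - x.1 • bubble x.2.1 x.2.2)

/-- The neighbourhood `Σ` of the bubbles that concentrate near `O`. (Positions are measured from
`O`, so the norm of the centre of mass is its distance to `O`.) -/
def bubbleNhd {n : ℕ} (O : Sph n) (ρ : ℝ) : Set (H1 n) :=
  {u | u ∈ constraintSet n ∧ ‖massCenter u - (O : Eu n)‖ ≤ ρ ∧ bubbleDist u ≤ ρ}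

/-- The topological boundary of a set `A` relative to the constraint set, for the norm `√E`. -/
def boundaryIn {n : ℕ} (A : Set (H1 n)) : Set (H1 n) :=
  {u | u ∈ constraintSet n ∧ ∀ ε > 0,
    (∃ w ∈ A ∩ constraintSet n, normE (u - w) < ε) ∧
    ∃ w ∈ constraintSet n \ A, normE (u - w) < ε}

/-- The geodesic distance `r` from `O` on the unit sphere. -/
def geo {n : ℕ} (O z : Sph n) : ℝ := InnerProductGeometry.angle (O : Eu n) (z : Eu n)

/-- `h` is a function `h(r)` of the distance to `O`, has a positive value at `O`, and near `O` it
has the form `h(O) - a r^α + k(r)` with `a > 0` and `k'(s) = o(s^(α-1))` as `s → 0`. -/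
structure FlatMaximum {n : ℕ} (h : Sph n → ℝ) (O : Sph n) (α : ℝ) : Prop where
  continuous : Continuous h
  radial : ∀ z w, geo O z = geo O w → h z = h w
  pos : 0 < h O
  flat : ∃ (a ε : ℝ) (k : ℝ → ℝ), 0 < a ∧ 0 < ε ∧
    (∀ z, geo O z < ε → h z = h O - a * geo O z ^ α + k (geo O z)) ∧
    DifferentiableOn ℝ k (Set.Ioo 0 ε) ∧
    deriv k =o[𝓝[>] (0 : ℝ)] fun s => s ^ (α - 1)

end BallBubble

end

/-!
The boundary integral is compared with its values at the bubbles, and everything rests on the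
conformal invariance of the problem. The Möbius involution `mob x` of the ball exchanges `0` and
`x`; the bubbles are the powers `bub x` of its conformal factor, indexed by the points `x` of the
open ball instead of by `e` and `lam`, and `f ↦ bub x * (f ∘ mob x)` preserves the energy
(`energyOf_bub_mul_comp_mob`) and the critical integrals in the ball and on the sphere
(`integral_ball_bub_rpow`, `integral_sphere_bub_rpow`). So estimates at the constant function
hold at all bubbles, uniformly in `x`.

At the constant function the second variation is governed by the Steklov eigenvalues of the ball:
on functions orthogonal to the affine functions the Dirichlet integral is at least twice the
boundary integral of the square (`steklov_gap`), which is proved by expanding boundary values in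
harmonic polynomials. Transported to `bub x` this is `exists_gap_bub`. Write
`u = coef • bub x + remainder` with orthogonal remainder. If `u` has almost no component along the
derivatives of the bubbles (its `drift` is small), then the gap and the Sobolev trace inequality
bound the critical boundary integral of `u` by `|S^{n-1}| - c E(remainder)`
(`exists_integral_rpow_le`). The weight, at most `h(O) - c r^α` near `O`, costs a further multiple
of `|x - O| ^ α`, by the change of variables `mob x`; here `α < n - 1` makes the region where the
weight may exceed `h(O)` negligible, since the bubble has mass at most of order
`|x - O| ^ (n - 1)` there (`exists_weighted_integral_le`).

A minimizer of the distance to the bubbles need not be discussed: a bubble that almost maximizes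
the pairing with `u` almost realizes the distance and makes the drift as small as desired
(`exists_almost_optimal_bubble`). The centre of mass of `u` is close to that of this bubble, which
is near `O` exactly if `x` is (`exists_norm_massCenter_sub_le`, `norm_sub_sq_le_bubCenter`,
`exists_norm_bubCenter_sub_le`). On the boundary of the neighbourhood, either the remainder has
energy bounded below or `x` is bounded away from `O`, and the critical integral drops by a definite
amount (`exists_weighted_integral_le_on_boundary`). The exponents `p` slightly below `τ` are
reached by Young's inequality (`exists_J_le_of_critical`).
-/

open scoped InnerProductSpace

noncomputable section

namespace BallBubble

/-! ### Möbius involutions of the ball -/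

/-- The denominator `1 - 2 x·z + |x|²|z|²`; on the unit sphere it is `|z - x|²`. -/
def den {n : ℕ} (x z : Eu n) : ℝ := 1 - 2 * ⟪x, z⟫_ℝ + ‖x‖ ^ 2 * ‖z‖ ^ 2

/-- The conformal factor of the involution `mob x`. -/
def conf {n : ℕ} (x z : Eu n) : ℝ := (1 - ‖x‖ ^ 2) / den x z

/-- The Möbius involution of the unit ball that exchanges `0` and `x`. -/
def mob {n : ℕ} (x z : Eu n) : Eu n :=
  (den x z)⁻¹ • ((1 - 2 * ⟪x, z⟫_ℝ + ‖z‖ ^ 2) • x - (1 - ‖x‖ ^ 2) • z)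

/-- The bubbles, indexed by the points of the open ball instead of by a concentration point and a
parameter: the power `(n - 2) / 2` of the conformal factor. -/
def bub {n : ℕ} (x z : Eu n) : ℝ := conf x z ^ gam n

section Mob

variable {n : ℕ} {x y z w : Eu n}

lemma den_comm : den x z = den z x := by
  simp only [den, real_inner_comm x z]; ring

lemma den_ge : (1 - ‖x‖ * ‖z‖) ^ 2 ≤ den x z := by
  have := real_inner_le_norm x z
  unfold den; nlinarith

lemma den_le : den x z ≤ (1 + ‖x‖ * ‖z‖) ^ 2 := by
  have := neg_le_of_abs_le (abs_real_inner_le_norm x z)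
  unfold den; nlinarith

lemma den_pos (hx : ‖x‖ < 1) (hz : ‖z‖ ≤ 1) : 0 < den x z := by
  refine lt_of_lt_of_le ?_ den_ge
  have : ‖x‖ * ‖z‖ < 1 := by nlinarith [norm_nonneg x, norm_nonneg z]
  have : 0 < 1 - ‖x‖ * ‖z‖ := by linarith
  positivity

lemma one_sub_norm_sq_pos (hx : ‖x‖ < 1) : 0 < 1 - ‖x‖ ^ 2 := by
  nlinarith [norm_nonneg x]

lemma conf_pos (hx : ‖x‖ < 1) (hz : ‖z‖ ≤ 1) : 0 < conf x z :=
  div_pos (one_sub_norm_sq_pos hx) (den_pos hx hz)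

lemma bub_pos (hx : ‖x‖ < 1) (hz : ‖z‖ ≤ 1) : 0 < bub x z :=
  Real.rpow_pos_of_pos (conf_pos hx hz) _

lemma den_sphere (hz : ‖z‖ = 1) : den x z = ‖z - x‖ ^ 2 := by
  rw [norm_sub_sq_real, den, real_inner_comm, hz]; ring

lemma mob_inner (hd : den x z ≠ 0) (y : Eu n) : ⟪y, mob x z⟫_ℝ * den x z =
    (1 - 2 * ⟪x, z⟫_ℝ + ‖z‖ ^ 2) * ⟪y, x⟫_ℝ - (1 - ‖x‖ ^ 2) * ⟪y, z⟫_ℝ := by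
  simp only [mob, inner_smul_right, inner_sub_right]
  field_simp

lemma mob_norm_sq (hd : den x z ≠ 0) :
    ‖mob x z‖ ^ 2 * den x z = ‖x‖ ^ 2 - 2 * ⟪x, z⟫_ℝ + ‖z‖ ^ 2 := by
  have h1 := mob_inner hd x
  have h2 := mob_inner hd z
  have h3 := mob_inner hd (mob x z)
  rw [real_inner_self_eq_norm_sq, real_inner_comm x (mob x z), real_inner_comm z (mob x z)] at h3
  rw [real_inner_self_eq_norm_sq] at h1 h2
  rw [real_inner_comm x z] at h2
  have : (‖mob x z‖ ^ 2 * den x z - (‖x‖ ^ 2 - 2 * ⟪x, z⟫_ℝ + ‖z‖ ^ 2)) * den x z = 0 := by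
    rw [sub_mul, h3, sub_mul, mul_assoc, h1, mul_assoc, h2, den]
    ring
  rcases mul_eq_zero.1 this with h | h
  · linarith
  · exact absurd h hd

lemma one_sub_norm_mob_sq (hd : den x z ≠ 0) :
    1 - ‖mob x z‖ ^ 2 = conf x z * (1 - ‖z‖ ^ 2) := by
  have h := mob_norm_sq hd
  rw [conf]
  field_simp
  rw [sub_mul, h, den]; ring

lemma norm_mob_lt (hx : ‖x‖ < 1) (hz : ‖z‖ < 1) : ‖mob x z‖ < 1 := by
  have h := one_sub_norm_mob_sq (den_pos hx hz.le).ne'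
  have : 0 < conf x z * (1 - ‖z‖ ^ 2) :=
    mul_pos (conf_pos hx hz.le) (one_sub_norm_sq_pos hz)
  nlinarith [norm_nonneg (mob x z)]

lemma norm_mob_le (hx : ‖x‖ < 1) (hz : ‖z‖ ≤ 1) : ‖mob x z‖ ≤ 1 := by
  have h := one_sub_norm_mob_sq (den_pos hx hz).ne'
  have : 0 ≤ conf x z * (1 - ‖z‖ ^ 2) :=
    mul_nonneg (conf_pos hx hz).le (by nlinarith [norm_nonneg z])
  nlinarith [norm_nonneg (mob x z)]

lemma norm_mob_eq (hx : ‖x‖ < 1) (hz : ‖z‖ = 1) : ‖mob x z‖ = 1 := by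
  have h := one_sub_norm_mob_sq (den_pos hx hz.le).ne'
  rw [hz] at h
  have : ‖mob x z‖ ^ 2 = 1 := by linarith
  nlinarith [norm_nonneg (mob x z)]

lemma den_mob (hd : den x z ≠ 0) (y : Eu n) :
    den y (mob x z) * den x z = den x z - 2 * ((1 - 2 * ⟪x, z⟫_ℝ + ‖z‖ ^ 2) * ⟪y, x⟫_ℝ
      - (1 - ‖x‖ ^ 2) * ⟪y, z⟫_ℝ) + ‖y‖ ^ 2 * (‖x‖ ^ 2 - 2 * ⟪x, z⟫_ℝ + ‖z‖ ^ 2) := by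
  rw [← mob_norm_sq hd, ← mob_inner hd]
  nth_rewrite 1 [den]
  ring

/-- The cocycle rule for the denominators. -/
lemma den_mob_cocycle (hz : den x z ≠ 0) (hy : den x y ≠ 0) :
    den y (mob x z) * den x z = den (mob x y) z * den x y := by
  rw [den_comm (x := mob x y), den_mob hz, den_mob hy, real_inner_comm z y, real_inner_comm x y]
  simp only [den]
  rw [real_inner_comm x z]
  ring

lemma den_mob_self (hd : den x z ≠ 0) : den x (mob x z) * den x z = (1 - ‖x‖ ^ 2) ^ 2 := by
  rw [den_mob hd, real_inner_self_eq_norm_sq, den]; ring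

lemma conf_mob_self (hx : ‖x‖ < 1) (hz : ‖z‖ ≤ 1) : conf x (mob x z) = (conf x z)⁻¹ := by
  have h := den_mob_self (den_pos hx hz).ne'
  have h1 := (den_pos hx hz).ne'
  have h2 := (den_pos hx (norm_mob_le hx hz)).ne'
  have h3 := (one_sub_norm_sq_pos hx).ne'
  rw [conf, conf, inv_div, div_eq_div_iff h2 h3]
  linarith

lemma mob_mob (hx : ‖x‖ < 1) (hz : ‖z‖ ≤ 1) : mob x (mob x z) = z := by
  have hd := (den_pos hx hz).ne'
  have h3 := (one_sub_norm_sq_pos hx).ne'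
  have h0 : den x (mob x z) = (1 - ‖x‖ ^ 2) ^ 2 / den x z := by
    rw [eq_div_iff hd, den_mob_self hd]
  have h1 : ⟪x, mob x z⟫_ℝ = ((1 - 2 * ⟪x, z⟫_ℝ + ‖z‖ ^ 2) * ‖x‖ ^ 2
      - (1 - ‖x‖ ^ 2) * ⟪x, z⟫_ℝ) / den x z := by
    rw [eq_div_iff hd, mob_inner hd, real_inner_self_eq_norm_sq]
  have h2 : ‖mob x z‖ ^ 2 = (‖x‖ ^ 2 - 2 * ⟪x, z⟫_ℝ + ‖z‖ ^ 2) / den x z := by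
    rw [eq_div_iff hd, mob_norm_sq hd]
  rw [mob, h0, h1, h2, mob]
  simp only [smul_sub, smul_smul]
  have e1 : ((1 - ‖x‖ ^ 2) ^ 2 / den x z)⁻¹ * (1 - 2 * (((1 - 2 * ⟪x, z⟫_ℝ + ‖z‖ ^ 2) * ‖x‖ ^ 2
      - (1 - ‖x‖ ^ 2) * ⟪x, z⟫_ℝ) / den x z) + (‖x‖ ^ 2 - 2 * ⟪x, z⟫_ℝ + ‖z‖ ^ 2) / den x z)
      = ((1 - ‖x‖ ^ 2) ^ 2 / den x z)⁻¹ * ((1 - ‖x‖ ^ 2) * ((den x z)⁻¹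
        * (1 - 2 * ⟪x, z⟫_ℝ + ‖z‖ ^ 2))) := by
    congr 1
    field_simp
    rw [den]; ring
  have e2 : ((1 - ‖x‖ ^ 2) ^ 2 / den x z)⁻¹ * ((1 - ‖x‖ ^ 2) * ((den x z)⁻¹
      * (1 - ‖x‖ ^ 2))) = 1 := by
    field_simp
  rw [e1, e2, sub_sub_cancel, one_smul]

/-- The involution is conformal: it scales distances by the geometric mean of the factors. -/
lemma norm_mob_sub_mob_sq (hz : den x z ≠ 0) (hw : den x w ≠ 0) :
    ‖mob x z - mob x w‖ ^ 2 = conf x z * conf x w * ‖z - w‖ ^ 2 := by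
  have a1 := mob_norm_sq hz
  have a2 := mob_norm_sq hw
  have a3 := mob_inner hw (mob x z)
  have a4 := mob_inner hz x
  have a5 := mob_inner hz w
  rw [real_inner_comm x (mob x z), real_inner_comm w (mob x z)] at a3
  rw [real_inner_self_eq_norm_sq] at a4
  rw [real_inner_comm x w, real_inner_comm z w] at a5
  have key : ‖mob x z - mob x w‖ ^ 2 * (den x z * den x w)
      = (1 - ‖x‖ ^ 2) ^ 2 * ‖z - w‖ ^ 2 := by
    rw [norm_sub_sq_real, norm_sub_sq_real]
    have : (‖mob x z‖ ^ 2 - 2 * ⟪mob x z, mob x w⟫_ℝ + ‖mob x w‖ ^ 2) * (den x z * den x w)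
        = (‖mob x z‖ ^ 2 * den x z) * den x w
          - 2 * ((⟪mob x z, mob x w⟫_ℝ * den x w) * den x z)
          + (‖mob x w‖ ^ 2 * den x w) * den x z := by ring
    rw [this, a1, a2, a3, sub_mul, mul_assoc, a4, mul_assoc, a5]
    simp only [den]; ring
  rw [conf, conf, div_mul_div_comm, div_mul_eq_mul_div, eq_div_iff (mul_ne_zero hz hw), key]
  ring

/-- Bubbles are permuted by the conformal action of the involutions. -/
lemma bub_mul_bub_mob (hx : ‖x‖ < 1) (hy : ‖y‖ < 1) (hz : ‖z‖ ≤ 1) :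
    bub x z * bub y (mob x z) = bub (mob x y) z := by
  have h1 := den_pos hx hz
  have h2 := den_pos hx hy.le
  have h3 := den_pos hy (norm_mob_le hx hz)
  have h4 := den_pos (norm_mob_lt hx hy) hz
  have hc := den_mob_cocycle h1.ne' h2.ne'
  rw [bub, bub, bub, ← Real.mul_rpow (conf_pos hx hz).le (conf_pos hy (norm_mob_le hx hz)).le]
  congr 1
  rw [conf, conf, conf, one_sub_norm_mob_sq h2.ne', conf, div_mul_div_comm, ← mul_div_right_comm,
    div_div, mul_comm (den x z), hc, mul_comm (den (mob x y) z)]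

lemma bub_mob_self (hx : ‖x‖ < 1) (hz : ‖z‖ ≤ 1) : bub x (mob x z) = (bub x z)⁻¹ := by
  rw [bub, conf_mob_self hx hz, Real.inv_rpow (conf_pos hx hz).le, bub]

end Mob

lemma bubbleFun_eq_bub {n : ℕ} (e : Sph n) {lam : ℝ} (hlam : lam ∈ Ioc (0 : ℝ) 1) (z : Eu n) :
    bubbleFun e lam z = bub (((1 - lam) / (1 + lam)) • (e : Eu n)) z := by
  obtain ⟨h0, h1⟩ := hlam
  have he : ‖(e : Eu n)‖ = 1 := by simp
  have hp : 0 < 1 + lam := by linarith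
  have hd : ‖(1 - lam) • z - (1 + lam) • (e : Eu n)‖ ^ 2
      = (1 + lam) ^ 2 * den (((1 - lam) / (1 + lam)) • (e : Eu n)) z := by
    rw [norm_sub_sq_real, den, norm_smul, norm_smul, norm_smul, he, inner_smul_left,
      inner_smul_right, inner_smul_left, Real.norm_of_nonneg (by linarith : 0 ≤ 1 - lam),
      Real.norm_of_nonneg hp.le,
      Real.norm_of_nonneg (div_nonneg (by linarith) hp.le : 0 ≤ (1 - lam) / (1 + lam)),
      real_inner_comm]
    simp only [conj_trivial]
    field_simp
    ring
  rw [bubbleFun, bub, conf, hd, gam]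
  congr 1
  rw [norm_smul, he, Real.norm_of_nonneg (div_nonneg (by linarith) hp.le)]
  rw [← div_div]
  congr 1
  field_simp
  ring

/-- Every point of the open ball is the index of some bubble. -/
lemma exists_bubble_index {n : ℕ} (O : Sph n) {x : Eu n} (hx : ‖x‖ < 1) :
    ∃ (e : Sph n) (lam : Ioc (0 : ℝ) 1), ((1 - (lam : ℝ)) / (1 + lam)) • (e : Eu n) = x := by
  by_cases h0 : x = 0
  · exact ⟨O, ⟨1, by norm_num, le_rfl⟩, by simp [h0]⟩
  · have hn : 0 < ‖x‖ := norm_pos_iff.2 h0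
    refine ⟨⟨‖x‖⁻¹ • x, by simp [norm_smul, hn.ne']⟩, ⟨(1 - ‖x‖) / (1 + ‖x‖), ?_, ?_⟩, ?_⟩
    · exact div_pos (by linarith) (by linarith)
    · rw [div_le_one (by linarith)]; linarith
    · simp only [smul_smul]
      have : (1 - (1 - ‖x‖) / (1 + ‖x‖)) / (1 + (1 - ‖x‖) / (1 + ‖x‖)) * ‖x‖⁻¹ = 1 := by
        have : 1 + ‖x‖ ≠ 0 := by linarith
        field_simp
        ring
      rw [this, one_smul]

lemma norm_bubble_index_lt {n : ℕ} (e : Sph n) {lam : ℝ} (hlam : lam ∈ Ioc (0 : ℝ) 1) :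
    ‖((1 - lam) / (1 + lam)) • (e : Eu n)‖ < 1 := by
  obtain ⟨h0, h1⟩ := hlam
  have he : ‖(e : Eu n)‖ = 1 := by simp
  rw [norm_smul, he, Real.norm_of_nonneg (div_nonneg (by linarith) (by linarith)), mul_one,
    div_lt_one (by linarith)]
  linarith

/-! ### Jacobians of the involutions, on the ball and on the sphere -/

/-- The absolute value of the determinant depends only on the lengths of the images of vectors. The
Jacobians of the involutions are found from this, by comparison with a simple map. -/
lemma abs_det_eq_of_norm_eq {n : ℕ} {L M : Eu n →L[ℝ] Eu n} (h : ∀ v, ‖L v‖ = ‖M v‖) :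
    |L.det| = |M.det| := by
  have key : (L : Eu n →ₗ[ℝ] Eu n).normDet = (M : Eu n →ₗ[ℝ] Eu n).normDet := by
    have h1 := ContinuousLinearMap.normDet_sq L
    have h2 := ContinuousLinearMap.normDet_sq M
    have hin : ∀ v w, ⟪L v, L w⟫_ℝ = ⟪M v, M w⟫_ℝ := by
      intro v w
      rw [real_inner_eq_norm_add_mul_self_sub_norm_mul_self_sub_norm_mul_self_div_two,
        real_inner_eq_norm_add_mul_self_sub_norm_mul_self_sub_norm_mul_self_div_two,
        ← map_add, ← map_add, h, h, h]
    have : L.adjoint ∘L L = M.adjoint ∘L M := by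
      ext1 v
      refine ext_inner_right ℝ fun w => ?_
      simp only [ContinuousLinearMap.comp_apply, ContinuousLinearMap.adjoint_inner_left, hin]
    rw [this, ← h2] at h1
    have h3 : (L : Eu n →ₗ[ℝ] Eu n).normDet ^ 2 = (M : Eu n →ₗ[ℝ] Eu n).normDet ^ 2 := by
      exact_mod_cast h1
    exact (pow_left_inj₀ (LinearMap.normDet_nonneg _) (LinearMap.normDet_nonneg _)
      two_ne_zero).1 h3
  rw [LinearMap.normDet_eq_norm_det, LinearMap.normDet_eq_norm_det] at key
  simpa using key

/-- The length of a directional derivative, from a formula for the distances between values. -/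
lemma norm_fderiv_sq_eq {n : ℕ} {f : Eu n → Eu n} {f' : Eu n →L[ℝ] Eu n} {z h : Eu n}
    (hf : HasFDerivAt f f' z) {G : ℝ → ℝ} {a : ℝ} (hG : Tendsto G (𝓝[≠] 0) (𝓝 a))
    (hfG : ∀ᶠ t in 𝓝[≠] (0 : ℝ), ‖f (z + t • h) - f z‖ ^ 2 = t ^ 2 * G t) :
    ‖f' h‖ ^ 2 = a := by
  have h1 := hasDerivAt_iff_tendsto_slope_zero.1 (hf.hasLineDerivAt h)
  simp only [zero_add, zero_smul, add_zero] at h1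
  have h2 := (h1.norm.pow 2)
  refine tendsto_nhds_unique h2 (hG.congr' ?_)
  filter_upwards [hfG, self_mem_nhdsWithin] with t ht ht0
  have : t ≠ 0 := ht0
  rw [norm_smul, mul_pow, ht, norm_inv, Real.norm_eq_abs, inv_pow, sq_abs]
  field_simp

section
variable {n : ℕ} {x z : Eu n}

lemma contDiff_den (x : Eu n) : ContDiff ℝ ∞ (den x) := by
  unfold den
  exact ((contDiff_const.sub (contDiff_const.mul (contDiff_const.inner ℝ contDiff_id))).add
    (contDiff_const.mul (contDiff_id.norm_sq ℝ)))

lemma contDiffAt_conf (hd : den x z ≠ 0) : ContDiffAt ℝ ∞ (conf x) z :=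
  contDiffAt_const.div (contDiff_den x).contDiffAt hd

lemma contDiffAt_mob (hd : den x z ≠ 0) : ContDiffAt ℝ ∞ (mob x) z := by
  unfold mob
  have h : ContDiff ℝ ∞ fun z : Eu n => 1 - 2 * ⟪x, z⟫_ℝ + ‖z‖ ^ 2 :=
    (contDiff_const.sub (contDiff_const.mul (contDiff_const.inner ℝ contDiff_id))).add
      (contDiff_id.norm_sq ℝ)
  have h2 : ContDiff ℝ ∞ fun z : Eu n =>
      (1 - 2 * ⟪x, z⟫_ℝ + ‖z‖ ^ 2) • x - (1 - ‖x‖ ^ 2) • z :=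
    (h.smul contDiff_const).sub (contDiff_id.const_smul _)
  exact ((contDiff_den x).contDiffAt.inv hd).smul h2.contDiffAt

lemma contDiffAt_bub (hx : ‖x‖ < 1) (hd : 0 < den x z) : ContDiffAt ℝ ∞ (bub x) z :=
  (contDiffAt_conf hd.ne').rpow_const_of_ne
    (div_pos (one_sub_norm_sq_pos hx) hd).ne'

lemma continuousOn_conf (hx : ‖x‖ < 1) : ContinuousOn (conf x) (closedBall 0 1) := fun z hz =>
  (contDiffAt_conf (den_pos hx (by simpa using hz)).ne').continuousAt.continuousWithinAt

lemma continuousOn_mob (hx : ‖x‖ < 1) : ContinuousOn (mob x) (closedBall 0 1) := fun z hz =>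
  (contDiffAt_mob (den_pos hx (by simpa using hz)).ne').continuousAt.continuousWithinAt

lemma continuousOn_bub (hx : ‖x‖ < 1) : ContinuousOn (bub x) (closedBall 0 1) := fun z hz =>
  (contDiffAt_bub hx (den_pos hx (by simpa using hz))).continuousAt.continuousWithinAt

lemma hasFDerivAt_mob (hd : den x z ≠ 0) : HasFDerivAt (mob x) (fderiv ℝ (mob x) z) z :=
  ((contDiffAt_mob hd).differentiableAt (by simp)).hasFDerivAt

lemma eventually_den_line (hd : den x z ≠ 0) (h : Eu n) :
    ∀ᶠ t in 𝓝[≠] (0 : ℝ), den x (z + t • h) ≠ 0 := by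
  have hc : Continuous fun t : ℝ => den x (z + t • h) :=
    (contDiff_den x).continuous.comp (by fun_prop)
  refine (hc.continuousAt.eventually_ne ?_).filter_mono nhdsWithin_le_nhds
  simpa using hd

lemma tendsto_conf_line (hd : den x z ≠ 0) (h : Eu n) :
    Tendsto (fun t : ℝ => conf x (z + t • h)) (𝓝[≠] 0) (𝓝 (conf x z)) := by
  have hc : ContinuousAt (conf x) (z + (0 : ℝ) • h) := by
    simpa using (contDiffAt_conf hd).continuousAt
  have h2 : ContinuousAt (fun t : ℝ => z + t • h) 0 := by fun_prop
  have := ContinuousAt.comp (f := fun t : ℝ => z + t • h) (x := (0 : ℝ)) hc h2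
  have h3 := this.tendsto.mono_left (nhdsWithin_le_nhds (s := {0}ᶜ))
  simpa [Function.comp_def] using h3

lemma norm_fderiv_mob_sq (hd : den x z ≠ 0) (h : Eu n) :
    ‖fderiv ℝ (mob x) z h‖ ^ 2 = conf x z ^ 2 * ‖h‖ ^ 2 := by
  refine norm_fderiv_sq_eq (hasFDerivAt_mob hd)
    (G := fun t => conf x (z + t • h) * conf x z * ‖h‖ ^ 2) ?_ ?_
  · rw [sq (conf x z)]
    exact ((tendsto_conf_line hd h).mul_const _).mul_const _
  · filter_upwards [eventually_den_line hd h] with t ht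
    rw [norm_mob_sub_mob_sq ht hd, add_sub_cancel_left, norm_smul, mul_pow, Real.norm_eq_abs,
      sq_abs]
    ring

lemma norm_fderiv_mob (hx : ‖x‖ < 1) (hz : ‖z‖ ≤ 1) (h : Eu n) :
    ‖fderiv ℝ (mob x) z h‖ = conf x z * ‖h‖ := by
  have h1 := norm_fderiv_mob_sq (den_pos hx hz).ne' h
  rw [← mul_pow] at h1
  exact (pow_left_inj₀ (norm_nonneg _) (mul_nonneg (conf_pos hx hz).le (norm_nonneg _))
    two_ne_zero).1 h1

lemma abs_det_fderiv_mob (hx : ‖x‖ < 1) (hz : ‖z‖ ≤ 1) :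
    |(fderiv ℝ (mob x) z).det| = conf x z ^ n := by
  have hc := conf_pos hx hz
  rw [abs_det_eq_of_norm_eq (M := conf x z • ContinuousLinearMap.id ℝ (Eu n))]
  · have : (conf x z • ContinuousLinearMap.id ℝ (Eu n)).det = conf x z ^ n := by
      rw [ContinuousLinearMap.det]
      simp
    rw [this, abs_of_pos (pow_pos hc n)]
  · intro v
    simp [norm_fderiv_mob hx hz, norm_smul, abs_of_pos hc]

lemma image_mob_ball (hx : ‖x‖ < 1) : mob x '' ball 0 1 = ball 0 1 := by
  ext z
  simp only [mem_image, mem_ball_zero_iff]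
  constructor
  · rintro ⟨w, hw, rfl⟩
    exact norm_mob_lt hx hw
  · exact fun hz => ⟨mob x z, norm_mob_lt hx hz, mob_mob hx hz.le⟩

/-- Change of variables in the ball. -/
lemma integral_ball_mob {F : Type*} [NormedAddCommGroup F] [NormedSpace ℝ F] (hx : ‖x‖ < 1)
    (g : Eu n → F) :
    ∫ z, conf x z ^ n • g (mob x z) ∂(ballMeasure n) = ∫ z, g z ∂(ballMeasure n) := by
  have := integral_image_eq_integral_abs_det_fderiv_smul volume (s := ball (0 : Eu n) 1)
    measurableSet_ball (f := mob x) (f' := fderiv ℝ (mob x))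
    (fun z hz => (hasFDerivAt_mob (den_pos hx (mem_ball_zero_iff.1 hz).le).ne').hasFDerivWithinAt)
    (fun z hz w hw h => by
      rw [mem_ball_zero_iff] at hz hw
      rw [← mob_mob hx hz.le, h, mob_mob hx hw.le])
    g
  rw [image_mob_ball hx] at this
  rw [ballMeasure, this]
  refine setIntegral_congr_fun measurableSet_ball fun z hz => ?_
  rw [abs_det_fderiv_mob hx (mem_ball_zero_iff.1 hz).le]

end

lemma nontrivial_Eu {n : ℕ} (hn : 0 < n) : Nontrivial (Eu n) :=
  have : Nonempty (Fin n) := ⟨⟨0, hn⟩⟩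
  inferInstance

/-- Polar coordinates in the unit ball. -/
lemma integral_ball_polar {n : ℕ} (hn : 0 < n) {f : Eu n → ℝ} (hf : Integrable f (ballMeasure n)) :
    ∫ z, f z ∂(ballMeasure n) =
      ∫ θ : Sph n, (∫ r in Ioo (0 : ℝ) 1, r ^ (n - 1) * f (r • (θ : Eu n))) ∂(sphMeasure n) := by
  have := nontrivial_Eu hn
  set g : Eu n → ℝ := (ball (0 : Eu n) 1).indicator f with hg
  have hgi : Integrable g volume := (integrable_indicator_iff measurableSet_ball).2 hf
  have hmp := (volume : Measure (Eu n)).measurePreserving_homeomorphUnitSphereProd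
  have hemb := (homeomorphUnitSphereProd (Eu n)).measurableEmbedding
  set G : Sph n × Ioi (0 : ℝ) → ℝ := fun p => g ((p.2 : ℝ) • (p.1 : Eu n)) with hG
  have hGc : ∀ x : ({0}ᶜ : Set (Eu n)), G (homeomorphUnitSphereProd (Eu n) x) = g x := by
    intro x
    have hx : ‖(x : Eu n)‖ ≠ 0 := norm_ne_zero_iff.2 x.2
    simp [hG, smul_smul, hx]
  have hGi : Integrable G ((sphMeasure n).prod
      (Measure.volumeIoiPow (Module.finrank ℝ (Eu n) - 1))) := by
    rw [← hmp.integrable_comp_emb hemb]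
    have : (G ∘ homeomorphUnitSphereProd (Eu n)) = g ∘ Subtype.val := funext hGc
    rw [this]
    exact (integrableOn_iff_comap_subtypeVal (measurableSet_singleton _).compl).1
      hgi.integrableOn
  calc ∫ z, f z ∂(ballMeasure n) = ∫ z, g z := (integral_indicator measurableSet_ball).symm
    _ = ∫ x : ({0}ᶜ : Set (Eu n)), g x ∂(Measure.comap Subtype.val volume) := by
      rw [integral_subtype_comap (measurableSet_singleton _).compl, restrict_compl_singleton]
    _ = ∫ p, G p ∂((sphMeasure n).prod
        (Measure.volumeIoiPow (Module.finrank ℝ (Eu n) - 1))) := by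
      rw [← hmp.integral_comp hemb]
      simp only [hGc]
    _ = _ := by
      rw [integral_prod _ hGi]
      refine integral_congr_ae (Eventually.of_forall fun θ => ?_)
      simp only [Measure.volumeIoiPow, finrank_euclideanSpace_fin, ENNReal.ofReal]
      rw [integral_withDensity_eq_integral_smul (by fun_prop)]
      simp only [hG]
      rw [integral_subtype_comap measurableSet_Ioi
        fun a : ℝ ↦ Real.toNNReal (a ^ (n - 1)) • g (a • (θ : Eu n)),
        ← Ioi_inter_Iio, inter_comm, ← Measure.restrict_restrict measurableSet_Iio,
        ← integral_indicator measurableSet_Iio]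
      refine setIntegral_congr_fun measurableSet_Ioi fun a ha => ?_
      have ha' : 0 < a := ha
      have hn : ‖a • (θ : Eu n)‖ = a := by simp [norm_smul, abs_of_pos ha']
      simp only [hg, indicator, mem_ball_zero_iff, hn, mem_Iio, NNReal.smul_def,
        Real.coe_toNNReal _ (pow_nonneg ha'.le _)]
      split_ifs <;> simp

lemma continuousOn_normalize {n : ℕ} :
    ContinuousOn (fun y : Eu n => ‖y‖⁻¹ • y) ({0}ᶜ : Set (Eu n)) :=
  (continuous_norm.continuousOn.inv₀ fun _ hy => norm_ne_zero_iff.2 hy).smul continuousOn_id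

/-- Integrals over the sphere as integrals of `0`-homogeneous functions over the ball. -/
lemma integral_sphere_eq_ball {n : ℕ} (hn : 0 < n) {g : Eu n → ℝ}
    (hg : ContinuousOn g (sphere 0 1)) :
    ∫ θ : Sph n, g θ ∂(sphMeasure n) = n * ∫ y, g (‖y‖⁻¹ • y) ∂(ballMeasure n) := by
  have hmaps : MapsTo (fun y : Eu n => ‖y‖⁻¹ • y) ({0}ᶜ) (sphere 0 1) := by
    intro y hy
    have : ‖y‖ ≠ 0 := norm_ne_zero_iff.2 hy
    simp [norm_smul, this]
  obtain ⟨C, hC⟩ := (isCompact_sphere (0 : Eu n) 1).exists_bound_of_continuousOn hg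
  have := nontrivial_Eu hn
  have h0 : ∀ᵐ y ∂(ballMeasure n), y ∈ ({0}ᶜ : Set (Eu n)) :=
    ae_restrict_of_ae (measure_eq_zero_iff_ae_notMem.1 (measure_singleton (0 : Eu n)))
  have hint : Integrable (fun y => g (‖y‖⁻¹ • y)) (ballMeasure n) := by
    refine Integrable.of_bound (C := C) ?_ ?_
    · have := ((hg.comp continuousOn_normalize hmaps).aestronglyMeasurable
        (measurableSet_singleton _).compl (μ := volume))
      rw [restrict_compl_singleton] at this
      exact this.restrict
    · filter_upwards [h0] with y hy
      exact hC _ (hmaps hy)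
  rw [integral_ball_polar hn hint, ← integral_const_mul]
  refine integral_congr_ae (Eventually.of_forall fun θ => ?_)
  have : ∀ r ∈ Ioo (0 : ℝ) 1, r ^ (n - 1) * g (‖r • (θ : Eu n)‖⁻¹ • r • (θ : Eu n))
      = r ^ (n - 1) * g θ := by
    intro r hr
    simp [norm_smul, abs_of_pos hr.1, smul_smul, hr.1.ne']
  simp only
  rw [setIntegral_congr_fun measurableSet_Ioo this, integral_mul_const,
    ← integral_Ioc_eq_integral_Ioo, ← intervalIntegral.integral_of_le zero_le_one, integral_pow]
  have : ((n - 1 : ℕ) : ℝ) + 1 = n := by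
    rw [Nat.cast_sub hn]; simp
  rw [this, Nat.sub_add_cancel hn]
  simp [hn.ne']

/-- The homogeneous extension of degree one of the restriction of `mob x` to the sphere. -/
def coneMob {n : ℕ} (x y : Eu n) : Eu n := ‖y‖ • mob x (‖y‖⁻¹ • y)

section Cone
variable {n : ℕ} {x y w : Eu n}

lemma norm_normalize (hy : y ≠ 0) : ‖‖y‖⁻¹ • y‖ = 1 := by
  have : ‖y‖ ≠ 0 := norm_ne_zero_iff.2 hy
  simp [norm_smul, this]

lemma norm_coneMob (hx : ‖x‖ < 1) (hy : y ≠ 0) : ‖coneMob x y‖ = ‖y‖ := by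
  rw [coneMob, norm_smul, norm_mob_eq hx (norm_normalize hy), norm_norm, mul_one]

lemma normalize_coneMob (hx : ‖x‖ < 1) (hy : y ≠ 0) :
    ‖coneMob x y‖⁻¹ • coneMob x y = mob x (‖y‖⁻¹ • y) := by
  have : ‖y‖ ≠ 0 := norm_ne_zero_iff.2 hy
  rw [norm_coneMob hx hy, coneMob, smul_smul, inv_mul_cancel₀ this, one_smul]

lemma coneMob_coneMob (hx : ‖x‖ < 1) (hy : y ≠ 0) : coneMob x (coneMob x y) = y := by
  have : ‖y‖ ≠ 0 := norm_ne_zero_iff.2 hy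
  rw [coneMob, normalize_coneMob hx hy, norm_coneMob hx hy,
    mob_mob hx (norm_normalize hy).le, smul_smul, mul_inv_cancel₀ this, one_smul]

lemma coneMob_ne_zero (hx : ‖x‖ < 1) (hy : y ≠ 0) : coneMob x y ≠ 0 := by
  rw [← norm_ne_zero_iff, norm_coneMob hx hy]
  exact norm_ne_zero_iff.2 hy

lemma norm_coneMob_sub_sq (hx : ‖x‖ < 1) (hy : y ≠ 0) (hw : w ≠ 0) :
    ‖coneMob x y - coneMob x w‖ ^ 2 =
      (1 - conf x (‖y‖⁻¹ • y) * conf x (‖w‖⁻¹ • w)) * (‖y‖ - ‖w‖) ^ 2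
      + conf x (‖y‖⁻¹ • y) * conf x (‖w‖⁻¹ • w) * ‖y - w‖ ^ 2 := by
  have hy' := norm_normalize hy
  have hw' := norm_normalize hw
  have hy0 : ‖y‖ ≠ 0 := norm_ne_zero_iff.2 hy
  have hw0 : ‖w‖ ≠ 0 := norm_ne_zero_iff.2 hw
  have h1 := norm_mob_sub_mob_sq (den_pos hx hy'.le).ne' (den_pos hx hw'.le).ne'
  rw [norm_sub_sq_real, norm_mob_eq hx hy', norm_mob_eq hx hw', norm_sub_sq_real, hy', hw',
    real_inner_smul_left, real_inner_smul_right] at h1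
  rw [norm_sub_sq_real, norm_sub_sq_real, norm_coneMob hx hy, norm_coneMob hx hw]
  simp only [coneMob, real_inner_smul_left, real_inner_smul_right]
  set A := ⟪mob x (‖y‖⁻¹ • y), mob x (‖w‖⁻¹ • w)⟫_ℝ
  set c := conf x (‖y‖⁻¹ • y) * conf x (‖w‖⁻¹ • w)
  have h2 : A = 1 - c * (1 - ‖y‖⁻¹ * (‖w‖⁻¹ * ⟪y, w⟫_ℝ)) := by linarith
  rw [h2]
  field_simp
  ring

lemma contDiffAt_normalize (hy : y ≠ 0) : ContDiffAt ℝ ∞ (fun y : Eu n => ‖y‖⁻¹ • y) y :=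
  ((contDiffAt_norm ℝ hy).inv (norm_ne_zero_iff.2 hy)).smul contDiffAt_id

lemma contDiffAt_coneMob (hx : ‖x‖ < 1) (hy : y ≠ 0) : ContDiffAt ℝ ∞ (coneMob x) y :=
  (contDiffAt_norm ℝ hy).smul (ContDiffAt.comp (g := mob x) y
    (contDiffAt_mob (den_pos hx (norm_normalize hy).le).ne') (contDiffAt_normalize hy))

lemma norm_fderiv_coneMob_sq (hx : ‖x‖ < 1) (hy : y ≠ 0) (h : Eu n) :
    ‖fderiv ℝ (coneMob x) y h‖ ^ 2 =
      (1 - conf x (‖y‖⁻¹ • y) ^ 2) * (⟪‖y‖⁻¹ • y, h⟫_ℝ) ^ 2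
      + conf x (‖y‖⁻¹ • y) ^ 2 * ‖h‖ ^ 2 := by
  have hy0 : ‖y‖ ≠ 0 := norm_ne_zero_iff.2 hy
  have hline : Tendsto (fun t : ℝ => y + t • h) (𝓝[≠] 0) (𝓝 y) := by
    have : ContinuousAt (fun t : ℝ => y + t • h) 0 := by fun_prop
    have h3 := this.tendsto.mono_left (nhdsWithin_le_nhds (s := {0}ᶜ))
    simpa using h3
  have hc : Tendsto (fun t : ℝ => conf x (‖y + t • h‖⁻¹ • (y + t • h))) (𝓝[≠] 0)
      (𝓝 (conf x (‖y‖⁻¹ • y))) := by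
    have h1 : ContinuousAt (fun y => conf x (‖y‖⁻¹ • y)) y :=
      ContinuousAt.comp (g := conf x)
        (contDiffAt_conf (den_pos hx (norm_normalize hy).le).ne').continuousAt
        (contDiffAt_normalize hy).continuousAt
    exact h1.tendsto.comp hline
  -- the radial part of the derivative comes from the derivative of the norm
  have hr : Tendsto (fun t : ℝ => t⁻¹ * (‖y + t • h‖ - ‖y‖)) (𝓝[≠] 0)
      (𝓝 ⟪‖y‖⁻¹ • y, h⟫_ℝ) := by
    have hd : HasDerivAt (fun t : ℝ => ‖y + t • h‖) ⟪‖y‖⁻¹ • y, h⟫_ℝ 0 := by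
      have h1 : HasDerivAt (fun t : ℝ => y + t • h) h 0 := by
        simpa using ((hasDerivAt_id (0 : ℝ)).smul_const h).const_add y
      have h2 := h1.norm_sq.sqrt (by simpa using hy)
      simp only [Real.sqrt_sq (norm_nonneg _), zero_smul, add_zero] at h2
      convert h2 using 1
      rw [real_inner_smul_left]
      field_simp
    have := hasDerivAt_iff_tendsto_slope_zero.1 hd
    simpa using this
  refine norm_fderiv_sq_eq ((contDiffAt_coneMob hx hy).differentiableAt (by simp)).hasFDerivAt
    (G := fun t => (1 - conf x (‖y + t • h‖⁻¹ • (y + t • h)) * conf x (‖y‖⁻¹ • y))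
      * (t⁻¹ * (‖y + t • h‖ - ‖y‖)) ^ 2
      + conf x (‖y + t • h‖⁻¹ • (y + t • h)) * conf x (‖y‖⁻¹ • y) * ‖h‖ ^ 2) ?_ ?_
  · rw [sq (conf x (‖y‖⁻¹ • y))]
    exact (((hc.mul_const _).const_sub 1).mul (hr.pow 2)).add ((hc.mul_const _).mul_const _)
  · filter_upwards [hline.eventually_ne hy, self_mem_nhdsWithin] with t ht ht0
    have ht0 : t ≠ 0 := ht0
    rw [norm_coneMob_sub_sq hx ht hy, add_sub_cancel_left, norm_smul, mul_pow, mul_pow,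
      Real.norm_eq_abs, sq_abs]
    field_simp

lemma abs_det_fderiv_coneMob (hn : 0 < n) (hx : ‖x‖ < 1) (hy : y ≠ 0) :
    |(fderiv ℝ (coneMob x) y).det| = conf x (‖y‖⁻¹ • y) ^ (n - 1) := by
  set e := ‖y‖⁻¹ • y with he
  set c := conf x e
  have hc : 0 < c := conf_pos hx (norm_normalize hy).le
  set T : Eu n →ₗ[ℝ] Eu n :=
    c • LinearMap.transvection ((c⁻¹ - 1) • (innerₛₗ ℝ e : Module.Dual ℝ (Eu n))) e
  have he1 : ‖e‖ = 1 := norm_normalize hy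
  have hT : ∀ v, T v = c • v + ((1 - c) * ⟪e, v⟫_ℝ) • e := by
    intro v
    have : T v = c • (v + ((c⁻¹ - 1) * ⟪e, v⟫_ℝ) • e) := rfl
    rw [this, smul_add, smul_smul]
    congr 2
    field_simp
  rw [abs_det_eq_of_norm_eq (M := LinearMap.toContinuousLinearMap T)]
  · have : (LinearMap.toContinuousLinearMap T).det = LinearMap.det T := rfl
    rw [this, LinearMap.det_smul, LinearMap.transvection.det, finrank_euclideanSpace_fin]
    have : ((c⁻¹ - 1) • (innerₛₗ ℝ e : Module.Dual ℝ (Eu n))) e = c⁻¹ - 1 := by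
      have : ((c⁻¹ - 1) • (innerₛₗ ℝ e : Module.Dual ℝ (Eu n))) e = (c⁻¹ - 1) * ⟪e, e⟫_ℝ := rfl
      rw [this, real_inner_self_eq_norm_sq, he1]; ring
    rw [this]
    obtain ⟨m, rfl⟩ : ∃ m, n = m + 1 := ⟨n - 1, by omega⟩
    have : c ^ (m + 1) * (1 + (c⁻¹ - 1)) = c ^ m := by
      field_simp; ring
    rw [this, abs_of_pos (pow_pos hc m), Nat.add_sub_cancel]
  · intro v
    have h1 := norm_fderiv_coneMob_sq hx hy v
    have h2 : ‖T v‖ ^ 2 = (1 - c ^ 2) * ⟪e, v⟫_ℝ ^ 2 + c ^ 2 * ‖v‖ ^ 2 := by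
      rw [hT, norm_add_sq_real, norm_smul, norm_smul, real_inner_smul_left, real_inner_smul_right,
        he1, mul_pow, mul_pow, Real.norm_eq_abs, Real.norm_eq_abs, sq_abs, sq_abs,
        real_inner_comm]
      ring
    have h3 : ‖fderiv ℝ (coneMob x) y v‖ ^ 2 = ‖T v‖ ^ 2 := h1.trans h2.symm
    exact (pow_left_inj₀ (norm_nonneg _) (norm_nonneg _) two_ne_zero).1 h3

lemma image_coneMob (hx : ‖x‖ < 1) :
    coneMob x '' (ball 0 1 \ {0}) = ball 0 1 \ {0} := by
  ext z
  simp only [mem_image, Set.mem_sdiff, mem_ball_zero_iff, mem_singleton_iff]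
  constructor
  · rintro ⟨w, ⟨hw, hw0⟩, rfl⟩
    exact ⟨by rwa [norm_coneMob hx hw0], coneMob_ne_zero hx hw0⟩
  · rintro ⟨hz, hz0⟩
    exact ⟨coneMob x z, ⟨by rwa [norm_coneMob hx hz0], coneMob_ne_zero hx hz0⟩,
      coneMob_coneMob hx hz0⟩

/-- Change of variables on the sphere. -/
lemma integral_sphere_mob (hn : 0 < n) (hx : ‖x‖ < 1) {g : Eu n → ℝ}
    (hg : ContinuousOn g (sphere 0 1)) :
    ∫ z : Sph n, conf x z ^ (n - 1) * g (mob x z) ∂(sphMeasure n)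
      = ∫ z : Sph n, g z ∂(sphMeasure n) := by
  have hmaps : MapsTo (mob x) (sphere (0 : Eu n) 1) (sphere 0 1) := fun z hz => by
    simp only [mem_sphere_zero_iff_norm] at hz ⊢
    exact norm_mob_eq hx hz
  have hc1 : ContinuousOn (fun z => conf x z ^ (n - 1) * g (mob x z)) (sphere 0 1) :=
    (((continuousOn_conf hx).mono sphere_subset_closedBall).pow _).mul
      (hg.comp ((continuousOn_mob hx).mono sphere_subset_closedBall) hmaps)
  rw [integral_sphere_eq_ball hn hc1, integral_sphere_eq_ball hn hg]
  congr 1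
  have := nontrivial_Eu hn
  have hball : ballMeasure n = volume.restrict (ball (0 : Eu n) 1 \ {0}) :=
    Measure.restrict_congr_set (sdiff_null_ae_eq_self (measure_singleton _)).symm
  have := integral_image_eq_integral_abs_det_fderiv_smul volume (s := ball (0 : Eu n) 1 \ {0})
    (measurableSet_ball.diff (measurableSet_singleton _)) (f := coneMob x)
    (f' := fderiv ℝ (coneMob x))
    (fun z hz => ((contDiffAt_coneMob hx hz.2).differentiableAt
      (by simp)).hasFDerivAt.hasFDerivWithinAt)
    (fun z hz w hw h => by
      rw [← coneMob_coneMob hx hz.2, h, coneMob_coneMob hx hw.2])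
    (fun y => g (‖y‖⁻¹ • y))
  rw [image_coneMob hx] at this
  rw [hball, this]
  refine setIntegral_congr_fun (measurableSet_ball.diff (measurableSet_singleton _))
    fun z hz => ?_
  simp only [smul_eq_mul]
  rw [abs_det_fderiv_coneMob hn hx hz.2, normalize_coneMob hx hz.2]

end Cone

/-! ### The divergence theorem in the ball -/

/-- `f` is of class `C¹` in a neighbourhood of the closed unit ball. -/
def C1OnBall {n : ℕ} (f : Eu n → ℝ) : Prop :=
  ∃ U : Set (Eu n), IsOpen U ∧ closedBall (0 : Eu n) 1 ⊆ U ∧ ContDiffOn ℝ 1 f U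

section C1
variable {n : ℕ} {f g : Eu n → ℝ} {z : Eu n}

lemma SmoothOnBall.c1OnBall (hf : SmoothOnBall f) : C1OnBall f := by
  obtain ⟨U, hU, hB, h⟩ := hf
  exact ⟨U, hU, hB, h.of_le (by simp)⟩

lemma C1OnBall.of_contDiffAt (h : ∀ z ∈ closedBall (0 : Eu n) 1, ContDiffAt ℝ 1 f z) :
    C1OnBall f := by
  refine ⟨{z | ∀ᶠ y in 𝓝 z, ContDiffAt ℝ 1 f y}, isOpen_setOfPred_eventually_nhds, fun z hz => ?_,
    fun z hz => ?_⟩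
  · exact (h z hz).eventually (by simp)
  · have : ContDiffAt ℝ 1 f z := mem_of_mem_nhds (s := {y | ContDiffAt ℝ 1 f y}) hz
    exact this.contDiffWithinAt

lemma C1OnBall.contDiffAt (hf : C1OnBall f) (hz : z ∈ closedBall (0 : Eu n) 1) :
    ContDiffAt ℝ 1 f z := by
  obtain ⟨U, hU, hB, h⟩ := hf
  exact h.contDiffAt (hU.mem_nhds (hB hz))

lemma C1OnBall.differentiableAt (hf : C1OnBall f) (hz : z ∈ closedBall (0 : Eu n) 1) :
    DifferentiableAt ℝ f z := (hf.contDiffAt hz).differentiableAt (by simp)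

lemma C1OnBall.continuousOn (hf : C1OnBall f) : ContinuousOn f (closedBall 0 1) := fun _ hz =>
  (hf.differentiableAt hz).continuousAt.continuousWithinAt

lemma C1OnBall.continuousOn_fderiv (hf : C1OnBall f) :
    ContinuousOn (fderiv ℝ f) (closedBall 0 1) := by
  obtain ⟨U, hU, hB, h⟩ := hf
  exact (h.continuousOn_fderiv_of_isOpen hU (by simp)).mono hB

lemma C1OnBall.continuousOn_gradient (hf : C1OnBall f) :
    ContinuousOn (gradient f) (closedBall 0 1) :=
  (InnerProductSpace.toDual ℝ (Eu n)).symm.continuous.comp_continuousOn hf.continuousOn_fderiv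

lemma C1OnBall.mul (hf : C1OnBall f) (hg : C1OnBall g) : C1OnBall (fun z => f z * g z) :=
  .of_contDiffAt fun _ hz => (hf.contDiffAt hz).mul (hg.contDiffAt hz)

lemma c1OnBall_inner (v : Eu n) : C1OnBall (fun z => ⟪z, v⟫_ℝ) :=
  ⟨univ, isOpen_univ, subset_univ _, (contDiff_id.inner ℝ contDiff_const).contDiffOn⟩

lemma integrable_ball_of_continuousOn {F : Type*} [NormedAddCommGroup F] {f : Eu n → F}
    (hf : ContinuousOn f (closedBall 0 1)) : Integrable f (ballMeasure n) :=
  (hf.integrableOn_compact (isCompact_closedBall _ _)).mono_set ball_subset_closedBall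

lemma integrable_sphere_of_continuousOn {F : Type*} [NormedAddCommGroup F]
    {f : Eu n → F} (hf : ContinuousOn f (sphere 0 1)) :
    Integrable (fun z : Sph n => f z) (sphMeasure n) := by
  have hc : Continuous fun z : Sph n => f z := hf.comp_continuous continuous_subtype_val
    fun z => z.2
  obtain ⟨C, hC⟩ := (isCompact_sphere (0 : Eu n) 1).exists_bound_of_continuousOn hf
  exact Integrable.of_bound (C := C)
    (hc.stronglyMeasurable_of_hasCompactSupport
      (HasCompactSupport.of_compactSpace _)).aestronglyMeasurable
      (Eventually.of_forall fun z => hC z z.2)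

/-- The divergence theorem for the radial field `f(z) z`, from polar coordinates and the
fundamental theorem of calculus on rays. -/
lemma integral_sphere_eq_integral_radial (hn : 0 < n) (hf : C1OnBall f) :
    ∫ z : Sph n, f z ∂(sphMeasure n) = ∫ z, (n * f z + fderiv ℝ f z z) ∂(ballMeasure n) := by
  have hc : ContinuousOn (fun z => n * f z + fderiv ℝ f z z) (closedBall (0 : Eu n) 1) :=
    (continuousOn_const.mul hf.continuousOn).add (hf.continuousOn_fderiv.clm_apply continuousOn_id)
  rw [integral_ball_polar hn (integrable_ball_of_continuousOn hc)]
  refine integral_congr_ae (Eventually.of_forall fun θ => ?_)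
  have hmem : ∀ r ∈ Icc (0 : ℝ) 1, r • (θ : Eu n) ∈ closedBall (0 : Eu n) 1 := by
    intro r hr
    simp [norm_smul, abs_of_nonneg hr.1, hr.2]
  have hline : ∀ r : ℝ, HasDerivAt (fun r : ℝ => r • (θ : Eu n)) (θ : Eu n) r := fun r => by
    simpa using (hasDerivAt_id r).smul_const (θ : Eu n)
  have key := intervalIntegral.integral_eq_sub_of_hasDerivAt (a := 0) (b := 1)
    (f := fun r => r ^ n * f (r • (θ : Eu n)))
    (f' := fun r => r ^ (n - 1) * (n * f (r • (θ : Eu n))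
      + fderiv ℝ f (r • (θ : Eu n)) (r • (θ : Eu n)))) (fun r hr => ?_) ?_
  · simp only [one_pow, one_smul, one_mul, zero_pow hn.ne', zero_mul, sub_zero] at key
    beta_reduce
    rw [← integral_Ioc_eq_integral_Ioo, ← intervalIntegral.integral_of_le zero_le_one, key]
  · rw [uIcc_of_le zero_le_one] at hr
    have h1 := (hf.differentiableAt (hmem r hr)).hasFDerivAt.comp_hasDerivAt r (hline r)
    have h2 := (hasDerivAt_pow n r).mul h1
    refine h2.congr_deriv ?_
    obtain ⟨m, rfl⟩ : ∃ m, n = m + 1 := ⟨n - 1, by omega⟩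
    simp only [Nat.add_sub_cancel, map_smul, smul_eq_mul, Function.comp_apply]
    rw [pow_succ]
    ring
  · refine ContinuousOn.intervalIntegrable ?_
    rw [uIcc_of_le zero_le_one]
    exact (continuousOn_pow _).mul (hc.comp (by fun_prop) hmem)

end C1

/-! The cutoffs `((1 - |x|^(2k))₊)²` tend to the indicator of the ball, and their gradients
concentrate on the sphere. -/

lemma hasDerivAt_posPart_sq (t : ℝ) :
    HasDerivAt (fun t : ℝ => max 0 t ^ 2) (2 * max 0 t) t := by
  rcases lt_trichotomy t 0 with h | h | h
  · rw [max_eq_left h.le, mul_zero]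
    refine (hasDerivAt_const t (0 : ℝ)).congr_of_eventuallyEq ?_
    filter_upwards [Iio_mem_nhds h] with s hs
    have : s ≤ 0 := le_of_lt hs
    simp [max_eq_left this]
  · subst h
    rw [max_self, mul_zero, hasDerivAt_iff_isLittleO]
    have h1 : (fun s : ℝ => max 0 s ^ 2) =O[𝓝 0] fun s : ℝ => s ^ 2 := by
      refine IsBigO.of_bound 1 (Eventually.of_forall fun s => ?_)
      rw [one_mul, Real.norm_of_nonneg (sq_nonneg _), Real.norm_of_nonneg (sq_nonneg _)]
      rcases le_total 0 s with h | h
      · rw [max_eq_right h]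
      · rw [max_eq_left h]; nlinarith [sq_nonneg s]
    have h2 : (fun s : ℝ => s ^ 2) =o[𝓝 0] fun s : ℝ => s := by
      simpa using isLittleO_pow_id (𝕜 := ℝ) (n := 2) (by norm_num)
    simpa using h1.trans_isLittleO h2
  · rw [max_eq_right h.le]
    have h1 : HasDerivAt (fun s : ℝ => s ^ 2) (2 * t) t := by simpa using hasDerivAt_pow 2 t
    refine h1.congr_of_eventuallyEq ?_
    filter_upwards [Ioi_mem_nhds h] with s hs
    have : 0 ≤ s := le_of_lt hs
    simp [max_eq_right this]

/-- A `C¹` cutoff supported in the closed ball. -/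
def cutoff {n : ℕ} (k : ℕ) (x : Eu n) : ℝ := max 0 (1 - (‖x‖ ^ 2) ^ k) ^ 2

/-- The function `w` for which the gradient of `cutoff k` is `- w x`. -/
def cutoffWeight {n : ℕ} (k : ℕ) (x : Eu n) : ℝ :=
  4 * k * max 0 (1 - (‖x‖ ^ 2) ^ k) * (‖x‖ ^ 2) ^ (k - 1)

section Cutoff
variable {n k : ℕ} {f g : Eu n → ℝ} {x : Eu n}

lemma hasFDerivAt_cutoff (k : ℕ) (x : Eu n) :
    HasFDerivAt (cutoff k) (-(cutoffWeight k x) • innerSL ℝ x) x := by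
  have h0 := (hasStrictFDerivAt_norm_sq x).hasFDerivAt
  have h1 := (hasDerivAt_pow k (‖x‖ ^ 2)).comp_hasFDerivAt x h0
  have h2 := (hasDerivAt_posPart_sq (1 - (‖x‖ ^ 2) ^ k)).comp_hasFDerivAt x (h1.const_sub 1)
  refine h2.congr_fderiv ?_
  ext v
  simp [cutoffWeight]
  ring

lemma contDiff_cutoff (k : ℕ) : ContDiff ℝ 1 (cutoff k : Eu n → ℝ) := by
  rw [contDiff_one_iff_fderiv]
  refine ⟨fun x => (hasFDerivAt_cutoff k x).differentiableAt, ?_⟩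
  have : fderiv ℝ (cutoff k : Eu n → ℝ) = fun x => -(cutoffWeight k x) • innerSL ℝ x :=
    funext fun x => (hasFDerivAt_cutoff k x).fderiv
  rw [this]
  unfold cutoffWeight
  fun_prop

lemma cutoff_eq_zero (hx : 1 ≤ ‖x‖) : cutoff k x = 0 := by
  have : 1 ≤ (‖x‖ ^ 2) ^ k := one_le_pow₀ (one_le_pow₀ hx)
  rw [cutoff, max_eq_left (by linarith)]; simp

lemma cutoffWeight_eq_zero (hx : 1 ≤ ‖x‖) : cutoffWeight k x = 0 := by
  have : 1 ≤ (‖x‖ ^ 2) ^ k := one_le_pow₀ (one_le_pow₀ hx)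
  rw [cutoffWeight, max_eq_left (by linarith)]; simp

lemma cutoff_nonneg : 0 ≤ cutoff k x := sq_nonneg _

lemma cutoffWeight_nonneg : 0 ≤ cutoffWeight k x := by
  unfold cutoffWeight; positivity

lemma cutoff_le_one : cutoff k x ≤ 1 := by
  have h : 0 ≤ (‖x‖ ^ 2) ^ k := by positivity
  have h1 : max 0 (1 - (‖x‖ ^ 2) ^ k) ≤ 1 := max_le zero_le_one (by linarith)
  exact pow_le_one₀ (le_max_left _ _) h1

lemma continuous_cutoff : Continuous (cutoff k : Eu n → ℝ) := (contDiff_cutoff k).continuous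

lemma continuous_cutoffWeight : Continuous (cutoffWeight k : Eu n → ℝ) := by
  unfold cutoffWeight; fun_prop

lemma tsupport_cutoff : tsupport (cutoff k : Eu n → ℝ) ⊆ closedBall 0 1 := by
  refine closure_minimal (fun x hx => ?_) isClosed_closedBall
  by_contra h
  exact hx (cutoff_eq_zero (by simpa using (not_le.1 (by simpa using h)).le))

lemma integrable_of_eq_zero_outside (hf : ContinuousOn f (closedBall 0 1))
    (h0 : ∀ x, 1 ≤ ‖x‖ → f x = 0) : Integrable f := by
  rw [← integrableOn_iff_integrable_of_support_subset (s := ball (0 : Eu n) 1)]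
  · exact integrable_ball_of_continuousOn hf
  · intro x hx
    by_contra h
    exact hx (h0 x (by simpa using h))

lemma integral_eq_of_eq_zero_outside (h0 : ∀ x, 1 ≤ ‖x‖ → f x = 0) :
    ∫ x, f x ∂(ballMeasure n) = ∫ x, f x :=
  setIntegral_eq_integral_of_forall_compl_eq_zero fun x hx => h0 x (by simpa using hx)

lemma integral_cutoff_mul_fderiv (hf : C1OnBall f) (v : Eu n) :
    ∫ x, cutoff k x * fderiv ℝ f x v ∂(ballMeasure n)
      = ∫ x, cutoffWeight k x * (⟪x, v⟫_ℝ * f x) ∂(ballMeasure n) := by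
  have hd : ∀ x : Eu n, fderiv ℝ (cutoff k) x v = -(cutoffWeight k x * ⟪x, v⟫_ℝ) := fun x => by
    rw [(hasFDerivAt_cutoff k x).fderiv]; simp
  rw [integral_eq_of_eq_zero_outside fun x hx => by rw [cutoff_eq_zero hx, zero_mul],
    integral_eq_of_eq_zero_outside fun x hx => by rw [cutoffWeight_eq_zero hx, zero_mul],
    integral_mul_fderiv_eq_neg_fderiv_mul_of_integrable, ← integral_neg]
  · refine integral_congr_ae (Eventually.of_forall fun x => ?_)
    simp only [hd]; ring
  · simp only [hd]
    refine integrable_of_eq_zero_outside ?_ fun x hx => by rw [cutoffWeight_eq_zero hx]; simp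
    exact ((continuous_cutoffWeight.mul (by fun_prop)).neg.continuousOn).mul hf.continuousOn
  · refine integrable_of_eq_zero_outside ?_ fun x hx => by rw [cutoff_eq_zero hx]; simp
    exact continuous_cutoff.continuousOn.mul (hf.continuousOn_fderiv.clm_apply continuousOn_const)
  · refine integrable_of_eq_zero_outside ?_ fun x hx => by rw [cutoff_eq_zero hx]; simp
    exact continuous_cutoff.continuousOn.mul hf.continuousOn
  · exact fun x _ => (hasFDerivAt_cutoff k x).differentiableAt
  · exact fun x hx => hf.differentiableAt (tsupport_cutoff hx)

lemma apply_eq_sum_single (L : Eu n →L[ℝ] ℝ) (z : Eu n) :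
    L z = ∑ i, z i * L (EuclideanSpace.single i 1) := by
  have h := (EuclideanSpace.basisFun (Fin n) ℝ).sum_repr z
  conv_lhs => rw [← h]
  simp

lemma inner_single_one (z : Eu n) (i : Fin n) :
    ⟪z, EuclideanSpace.single i (1 : ℝ)⟫_ℝ = z i := by
  rw [EuclideanSpace.inner_single_right]; simp

lemma norm_sq_eq_sum (z : Eu n) : ‖z‖ ^ 2 = ∑ i, z i ^ 2 := by
  rw [EuclideanSpace.norm_sq_eq]; simp

lemma integral_cutoffWeight_norm_sq (hf : C1OnBall f) :
    ∫ x, cutoffWeight k x * (‖x‖ ^ 2 * f x) ∂(ballMeasure n)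
      = ∫ x, cutoff k x * (n * f x + fderiv ℝ f x x) ∂(ballMeasure n) := by
  have hi : ∀ i : Fin n, C1OnBall fun x : Eu n => x i * f x := fun i => by
    have := (c1OnBall_inner (EuclideanSpace.single i (1 : ℝ))).mul hf
    simpa only [inner_single_one] using this
  have h1 : ∀ x, cutoffWeight k x * (‖x‖ ^ 2 * f x)
      = ∑ i, cutoffWeight k x * (⟪x, EuclideanSpace.single i (1 : ℝ)⟫_ℝ * (x i * f x)) := by
    intro x
    rw [norm_sq_eq_sum, Finset.sum_mul, Finset.mul_sum]
    refine Finset.sum_congr rfl fun i _ => ?_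
    rw [inner_single_one]
    ring
  have h2 : ∀ x ∈ ball (0 : Eu n) 1, cutoff k x * (n * f x + fderiv ℝ f x x)
      = ∑ i, cutoff k x *
        fderiv ℝ (fun x : Eu n => x i * f x) x (EuclideanSpace.single i (1 : ℝ)) := by
    intro x hx
    rw [apply_eq_sum_single, ← Finset.mul_sum]
    congr 1
    have hcoord : ∀ i : Fin n, HasFDerivAt (fun x : Eu n => x i)
        (EuclideanSpace.proj i : Eu n →L[ℝ] ℝ) x := fun i =>
      (EuclideanSpace.proj i : Eu n →L[ℝ] ℝ).hasFDerivAt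
    have : ∀ i : Fin n, fderiv ℝ (fun x : Eu n => x i * f x) x (EuclideanSpace.single i (1 : ℝ))
        = x i * fderiv ℝ f x (EuclideanSpace.single i (1 : ℝ)) + f x := by
      intro i
      have h := ((hcoord i).mul
        (hf.differentiableAt (ball_subset_closedBall hx)).hasFDerivAt).fderiv
      rw [show (fun x : Eu n => x i * f x) = (fun x : Eu n => x i) * f from rfl, h]
      simp
    simp only [this, Finset.sum_add_distrib]
    simp
    ring
  rw [integral_congr_ae (Eventually.of_forall h1), setIntegral_congr_fun measurableSet_ball h2,
    integral_finsetSum, integral_finsetSum]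
  · exact Finset.sum_congr rfl fun i _ => (integral_cutoff_mul_fderiv (hi i) _).symm
  · exact fun i _ => integrable_ball_of_continuousOn (continuous_cutoff.continuousOn.mul
      ((hi i).continuousOn_fderiv.clm_apply continuousOn_const))
  · exact fun i _ => integrable_ball_of_continuousOn (continuous_cutoffWeight.continuousOn.mul
      ((c1OnBall_inner _).continuousOn.mul (hi i).continuousOn))

lemma tendsto_integral_cutoff (hg : ContinuousOn g (closedBall 0 1)) :
    Tendsto (fun k : ℕ => ∫ x, cutoff k x * g x ∂(ballMeasure n)) atTop
      (𝓝 (∫ x, g x ∂(ballMeasure n))) := by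
  refine tendsto_integral_of_dominated_convergence (fun x => ‖g x‖) ?_
    (integrable_ball_of_continuousOn hg).norm ?_ ?_
  · exact fun k => (integrable_ball_of_continuousOn
      (continuous_cutoff.continuousOn.mul hg)).aestronglyMeasurable
  · refine fun k => Eventually.of_forall fun x => ?_
    rw [norm_mul, Real.norm_of_nonneg cutoff_nonneg]
    exact mul_le_of_le_one_left (norm_nonneg _) cutoff_le_one
  · filter_upwards [ae_restrict_mem measurableSet_ball] with x hx
    rw [mem_ball_zero_iff] at hx
    have h1 : Tendsto (fun k : ℕ => (‖x‖ ^ 2) ^ k) atTop (𝓝 0) :=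
      tendsto_pow_atTop_nhds_zero_of_lt_one (by positivity)
        (pow_lt_one₀ (norm_nonneg _) hx two_ne_zero)
    have h2 : Tendsto (fun k : ℕ => cutoff k x) atTop (𝓝 (max 0 (1 - 0) ^ 2)) :=
      (tendsto_const_nhds.max (h1.const_sub 1)).pow 2
    simpa using h2.mul_const (g x)

lemma mul_pow_mul_one_sub_le (t : ℝ) (h0 : 0 ≤ t) (h1 : t ≤ 1) (k : ℕ) :
    k * t ^ (k - 1) * (1 - t) ≤ 1 := by
  have h2 : (k : ℝ) * t ^ (k - 1) ≤ ∑ i ∈ Finset.range k, t ^ i := by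
    rw [← Finset.card_range k, ← nsmul_eq_mul, Finset.card_range]
    have := Finset.card_nsmul_le_sum (Finset.range k) (fun i => t ^ i) (t ^ (k - 1))
      fun i hi => pow_le_pow_of_le_one h0 h1 (by have := Finset.mem_range.1 hi; omega)
    simpa using this
  calc k * t ^ (k - 1) * (1 - t) ≤ (∑ i ∈ Finset.range k, t ^ i) * (1 - t) :=
        mul_le_mul_of_nonneg_right h2 (by linarith)
    _ = 1 - t ^ k := by
      have := geom_sum_mul t k
      linarith
    _ ≤ 1 := by
      have := pow_nonneg h0 k
      linarith

lemma tendsto_integral_cutoffWeight_one_sub (hg : ContinuousOn g (closedBall 0 1)) :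
    Tendsto (fun k : ℕ => ∫ x, cutoffWeight k x * ((1 - ‖x‖ ^ 2) * g x) ∂(ballMeasure n)) atTop
      (𝓝 0) := by
  have : (0 : ℝ) = ∫ x, (0 : ℝ) ∂(ballMeasure n) := by simp
  rw [this]
  refine tendsto_integral_of_dominated_convergence (fun x => 4 * ‖g x‖) ?_
    ((integrable_ball_of_continuousOn hg).norm.const_mul 4) ?_ ?_
  · exact fun k => (integrable_ball_of_continuousOn (continuous_cutoffWeight.continuousOn.mul
      (ContinuousOn.mul (by fun_prop) hg))).aestronglyMeasurable
  · intro k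
    filter_upwards [ae_restrict_mem measurableSet_ball] with x hx
    rw [mem_ball_zero_iff] at hx
    have hx2 : ‖x‖ ^ 2 ≤ 1 := pow_le_one₀ (norm_nonneg _) hx.le
    have h1 := mul_pow_mul_one_sub_le (‖x‖ ^ 2) (by positivity) hx2 k
    have h2 : max 0 (1 - (‖x‖ ^ 2) ^ k) ≤ 1 :=
      max_le zero_le_one (by have : 0 ≤ (‖x‖ ^ 2) ^ k := by positivity
                             linarith)
    rw [← mul_assoc, norm_mul]
    refine mul_le_mul_of_nonneg_right ?_ (norm_nonneg _)
    rw [Real.norm_of_nonneg (mul_nonneg cutoffWeight_nonneg (by linarith)), cutoffWeight]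
    have h3 : 0 ≤ max 0 (1 - (‖x‖ ^ 2) ^ k) := le_max_left _ _
    calc 4 * k * max 0 (1 - (‖x‖ ^ 2) ^ k) * (‖x‖ ^ 2) ^ (k - 1) * (1 - ‖x‖ ^ 2)
        = 4 * (k * (‖x‖ ^ 2) ^ (k - 1) * (1 - ‖x‖ ^ 2)) * max 0 (1 - (‖x‖ ^ 2) ^ k) := by ring
      _ ≤ 4 * 1 * 1 := by gcongr
      _ = 4 := by norm_num
  · filter_upwards [ae_restrict_mem measurableSet_ball] with x hx
    rw [mem_ball_zero_iff] at hx
    have hlt : ‖x‖ ^ 2 < 1 := pow_lt_one₀ (norm_nonneg _) hx two_ne_zero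
    have h1 : Tendsto (fun k : ℕ => (‖x‖ ^ 2) ^ k) atTop (𝓝 0) :=
      tendsto_pow_atTop_nhds_zero_of_lt_one (by positivity) hlt
    have h2 : Tendsto (fun k : ℕ => (k : ℝ) * (‖x‖ ^ 2) ^ (k - 1)) atTop (𝓝 0) := by
      rw [← tendsto_add_atTop_iff_nat 1]
      have h3 := tendsto_self_mul_const_pow_of_lt_one (r := ‖x‖ ^ 2) (by positivity) hlt
      have := h3.add h1
      simp only [Nat.add_sub_cancel, Nat.cast_add, Nat.cast_one, add_mul, one_mul]
      simpa using this
    have h4 := ((h2.mul (tendsto_const_nhds.max (h1.const_sub 1) :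
      Tendsto (fun k : ℕ => max 0 (1 - (‖x‖ ^ 2) ^ k)) atTop (𝓝 (max 0 (1 - 0))))).const_mul
        4).mul_const ((1 - ‖x‖ ^ 2) * g x)
    simp only [zero_mul, mul_zero] at h4
    refine h4.congr fun k => ?_
    rw [cutoffWeight]; ring

/-- The gradients of the cutoffs tend to the surface measure. -/
lemma tendsto_integral_cutoffWeight (hn : 0 < n) (hf : C1OnBall f) :
    Tendsto (fun k : ℕ => ∫ x, cutoffWeight k x * f x ∂(ballMeasure n)) atTop
      (𝓝 (∫ z : Sph n, f z ∂(sphMeasure n))) := by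
  have hc : ContinuousOn (fun z => n * f z + fderiv ℝ f z z) (closedBall (0 : Eu n) 1) :=
    (continuousOn_const.mul hf.continuousOn).add (hf.continuousOn_fderiv.clm_apply continuousOn_id)
  have h1 := (tendsto_integral_cutoff hc).add (tendsto_integral_cutoffWeight_one_sub
    hf.continuousOn)
  rw [add_zero, ← integral_sphere_eq_integral_radial hn hf] at h1
  refine h1.congr fun k => ?_
  rw [← integral_cutoffWeight_norm_sq hf, ← integral_add]
  · refine integral_congr_ae (Eventually.of_forall fun x => ?_)
    simp only; ring
  · exact integrable_ball_of_continuousOn (continuous_cutoffWeight.continuousOn.mul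
      (ContinuousOn.mul (by fun_prop) hf.continuousOn))
  · exact integrable_ball_of_continuousOn (continuous_cutoffWeight.continuousOn.mul
      (ContinuousOn.mul (by fun_prop) hf.continuousOn))

/-- The Gauss–Green formula in the unit ball. -/
lemma integral_fderiv_eq_integral_sphere (hn : 0 < n) (hf : C1OnBall f) (v : Eu n) :
    ∫ x, fderiv ℝ f x v ∂(ballMeasure n)
      = ∫ z : Sph n, ⟪(z : Eu n), v⟫_ℝ * f z ∂(sphMeasure n) := by
  have h1 := tendsto_integral_cutoff (n := n) (g := fun x => fderiv ℝ f x v)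
    (hf.continuousOn_fderiv.clm_apply continuousOn_const)
  have h2 := tendsto_integral_cutoffWeight hn ((c1OnBall_inner v).mul hf)
  refine tendsto_nhds_unique h1 (h2.congr fun k => ?_)
  exact (integral_cutoff_mul_fderiv hf v).symm

end Cutoff

/-- Green's formula for a divergence-free field `F`. -/
lemma integral_inner_gradient_eq {n : ℕ} (hn : 0 < n) {f : Eu n → ℝ} {F : Fin n → Eu n → ℝ}
    (hf : C1OnBall f) (hF : ∀ i, C1OnBall (F i))
    (hdiv : ∀ z ∈ ball (0 : Eu n) 1, ∑ i, fderiv ℝ (F i) z (EuclideanSpace.single i 1) = 0) :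
    ∫ z, ∑ i, fderiv ℝ f z (EuclideanSpace.single i 1) * F i z ∂(ballMeasure n)
      = ∫ z : Sph n, f z * ∑ i, (z : Eu n) i * F i z ∂(sphMeasure n) := by
  have h1 : ∀ z ∈ ball (0 : Eu n) 1,
      ∑ i, fderiv ℝ f z (EuclideanSpace.single i 1) * F i z
      = ∑ i, fderiv ℝ (fun z => f z * F i z) z (EuclideanSpace.single i 1) := by
    intro z hz
    have hz' := ball_subset_closedBall hz
    have : ∀ i, fderiv ℝ (fun z => f z * F i z) z (EuclideanSpace.single i 1)
        = f z * fderiv ℝ (F i) z (EuclideanSpace.single i 1)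
          + fderiv ℝ f z (EuclideanSpace.single i 1) * F i z := by
      intro i
      rw [fderiv_fun_mul (hf.differentiableAt hz') ((hF i).differentiableAt hz')]
      simp
      ring
    simp only [this, Finset.sum_add_distrib, ← Finset.mul_sum, hdiv z hz]
    ring
  rw [setIntegral_congr_fun measurableSet_ball h1, integral_finsetSum]
  · simp only [Finset.mul_sum]
    rw [integral_finsetSum]
    · refine Finset.sum_congr rfl fun i _ => ?_
      rw [integral_fderiv_eq_integral_sphere hn (hf.mul (hF i))]
      refine integral_congr_ae (Eventually.of_forall fun z => ?_)
      simp only [inner_single_one]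
      ring
    · intro i _
      exact integrable_sphere_of_continuousOn (f := fun z => f z * (z i * F i z))
        ((hf.continuousOn.mul (ContinuousOn.mul (by fun_prop) (hF i).continuousOn)).mono
          sphere_subset_closedBall)
  · exact fun i _ => integrable_ball_of_continuousOn
      ((hf.mul (hF i)).continuousOn_fderiv.clm_apply continuousOn_const)

/-! ### Sobolev and trace inequalities -/

/-- The energy of a function that is `C¹` up to the boundary. -/
def energyOf {n : ℕ} (f : Eu n → ℝ) : ℝ :=
  (∫ z, ‖gradient f z‖ ^ 2 ∂(ballMeasure n)) + ∫ z : Sph n, gam n * f z ^ 2 ∂(sphMeasure n)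

lemma norm_gradient {n : ℕ} (f : Eu n → ℝ) (z : Eu n) : ‖gradient f z‖ = ‖fderiv ℝ f z‖ := by
  simp [gradient]

lemma gam_pos {n : ℕ} (hn : 3 ≤ n) : 0 < gam n := by
  have : (3 : ℝ) ≤ n := by exact_mod_cast hn
  unfold gam; linarith

lemma half_le_gam {n : ℕ} (hn : 3 ≤ n) : 1 / 2 ≤ gam n := by
  have : (3 : ℝ) ≤ n := by exact_mod_cast hn
  unfold gam; linarith

lemma tau_eq {n : ℕ} (hn : 3 ≤ n) : tau n = 1 + 1 / gam n := by
  have h : (3 : ℝ) ≤ n := by exact_mod_cast hn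
  have h2 : (n : ℝ) - 2 ≠ 0 := by linarith
  unfold tau gam
  field_simp
  ring

lemma tau_mul_gam {n : ℕ} (hn : 3 ≤ n) : tau n * gam n = gam n + 1 := by
  have := gam_pos hn
  rw [tau_eq hn]; field_simp

lemma one_lt_tau {n : ℕ} (hn : 3 ≤ n) : 1 < tau n := by
  rw [tau_eq hn]
  have := one_div_pos.2 (gam_pos hn)
  linarith

lemma integral_mul_le_sqrt {X : Type*} [MeasurableSpace X] {μ : Measure X} {f g : X → ℝ}
    (hf : MemLp f 2 μ) (hg : MemLp g 2 μ) :
    ∫ x, |f x * g x| ∂μ ≤ √(∫ x, f x ^ 2 ∂μ) * √(∫ x, g x ^ 2 ∂μ) := by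
  have h := integral_mul_norm_le_Lp_mul_Lq (μ := μ) (f := f) (g := g) (p := 2) (q := 2)
    Real.HolderConjugate.two_two (by simpa using hf) (by simpa using hg)
  simp only [Real.norm_eq_abs, Real.rpow_two, sq_abs] at h
  rw [Real.sqrt_eq_rpow, Real.sqrt_eq_rpow]
  simpa only [abs_mul] using h

section Sobolev
variable {n : ℕ} {f u : Eu n → ℝ}

lemma contDiff_cutoff_mul (hf : C1OnBall f) (k : ℕ) :
    ContDiff ℝ 1 fun x => cutoff k x * f x := by
  rw [contDiff_iff_contDiffAt]
  intro x
  by_cases hx : x ∈ closedBall (0 : Eu n) 1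
  · exact (contDiff_cutoff k).contDiffAt.mul (hf.contDiffAt hx)
  · refine (contDiffAt_const (c := (0 : ℝ))).congr_of_eventuallyEq ?_
    filter_upwards [isClosed_closedBall.isOpen_compl.mem_nhds hx] with y hy
    have : 1 ≤ ‖y‖ := by
      have : ¬ ‖y‖ ≤ 1 := by simpa using hy
      exact (not_le.1 this).le
    rw [cutoff_eq_zero this, zero_mul]

lemma hasCompactSupport_cutoff_mul (f : Eu n → ℝ) (k : ℕ) :
    HasCompactSupport fun x => cutoff k x * f x :=
  HasCompactSupport.intro (isCompact_closedBall (0 : Eu n) 1) fun x hx => by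
    have : ¬ ‖x‖ ≤ 1 := by simpa using hx
    rw [cutoff_eq_zero (not_le.1 this).le, zero_mul]

/-- The Gagliardo–Nirenberg–Sobolev inequality with exponent one, for compactly supported
functions and in terms of Bochner integrals. -/
lemma exists_integral_rpow_le_fderiv {p : ℝ} (hp : Real.HolderConjugate n p) :
    ∃ C : ℝ, 0 ≤ C ∧ ∀ w : Eu n → ℝ, ContDiff ℝ 1 w → HasCompactSupport w →
      ∫ x, |w x| ^ p ≤ C * (∫ x, ‖fderiv ℝ w x‖) ^ p := by
  have hp' : Real.HolderConjugate (Module.finrank ℝ (Eu n)) p := by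
    rwa [finrank_euclideanSpace_fin]
  refine ⟨lintegralPowLePowLIntegralFDerivConst (volume : Measure (Eu n)) p, NNReal.coe_nonneg _,
    fun w hw hws => ?_⟩
  have h := lintegral_pow_le_pow_lintegral_fderiv volume hw hws hp'
  have hp0 : 0 < p := hp.symm.pos
  have hd : Integrable (fderiv ℝ w) :=
    (hw.continuous_fderiv (by simp)).integrable_of_hasCompactSupport (hws.fderiv ℝ)
  have e1 : ∫ x, |w x| ^ p = (∫⁻ x, ‖w x‖ₑ ^ p).toReal := by
    rw [integral_eq_lintegral_of_nonneg_ae (Eventually.of_forall fun x => by positivity)]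
    · congr 1
      refine lintegral_congr fun x => ?_
      rw [← ENNReal.ofReal_rpow_of_nonneg (abs_nonneg _) hp0.le, Real.enorm_eq_ofReal_abs]
    · exact ((hw.continuous.abs).rpow_const fun _ => Or.inr hp0.le).aestronglyMeasurable
  have e2 : ∫ x, ‖fderiv ℝ w x‖ = (∫⁻ x, ‖fderiv ℝ w x‖ₑ).toReal :=
    integral_norm_eq_lintegral_enorm hd.aestronglyMeasurable
  rw [e1, e2, ENNReal.toReal_rpow]
  refine (ENNReal.toReal_mono ?_ h).trans (by rw [ENNReal.toReal_mul]; rfl)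
  exact ENNReal.mul_ne_top ENNReal.coe_ne_top
    (ENNReal.rpow_ne_top_of_nonneg hp0.le hd.hasFiniteIntegral.ne)

/-- The Sobolev inequality with exponent one for functions that need not vanish on the boundary:
the jump across the sphere adds a boundary term. -/
lemma exists_integral_rpow_le_fderiv_add_sphere (hn : 2 ≤ n) {p : ℝ}
    (hp : Real.HolderConjugate n p) :
    ∃ C : ℝ, 0 ≤ C ∧ ∀ f : Eu n → ℝ, C1OnBall f → (∀ z, 0 ≤ f z) →
      ∫ x, f x ^ p ∂(ballMeasure n) ≤
        C * ((∫ x, ‖fderiv ℝ f x‖ ∂(ballMeasure n)) + ∫ z : Sph n, f z ∂(sphMeasure n)) ^ p := by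
  obtain ⟨C, hC, h⟩ := exists_integral_rpow_le_fderiv hp
  have hp0 : 0 < p := hp.symm.pos
  refine ⟨C, hC, fun f hf h0 => ?_⟩
  have hfp : ContinuousOn (fun x => f x ^ p) (closedBall 0 1) :=
    hf.continuousOn.rpow_const fun _ _ => Or.inr hp0.le
  have hlim1 : Tendsto (fun k : ℕ => ∫ x, (cutoff k x * f x) ^ p ∂(ballMeasure n)) atTop
      (𝓝 (∫ x, f x ^ p ∂(ballMeasure n))) := by
    refine tendsto_integral_of_dominated_convergence (fun x => f x ^ p) ?_
      (integrable_ball_of_continuousOn hfp) ?_ ?_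
    · exact fun k => (integrable_ball_of_continuousOn
        ((continuous_cutoff.continuousOn.mul hf.continuousOn).rpow_const
          fun _ _ => Or.inr hp0.le)).aestronglyMeasurable
    · refine fun k => Eventually.of_forall fun x => ?_
      rw [Real.norm_of_nonneg (Real.rpow_nonneg (mul_nonneg cutoff_nonneg (h0 x)) _)]
      exact Real.rpow_le_rpow (mul_nonneg cutoff_nonneg (h0 x))
        (mul_le_of_le_one_left (h0 x) cutoff_le_one) hp0.le
    · filter_upwards [ae_restrict_mem measurableSet_ball] with x hx
      rw [mem_ball_zero_iff] at hx
      have h1 : Tendsto (fun k : ℕ => (‖x‖ ^ 2) ^ k) atTop (𝓝 0) :=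
        tendsto_pow_atTop_nhds_zero_of_lt_one (by positivity)
          (pow_lt_one₀ (norm_nonneg _) hx two_ne_zero)
      have h2 : Tendsto (fun k : ℕ => cutoff k x) atTop (𝓝 (max 0 (1 - 0) ^ 2)) :=
        (tendsto_const_nhds.max (h1.const_sub 1)).pow 2
      have h3 := (h2.mul_const (f x)).rpow_const (p := p) (Or.inr hp0.le)
      simpa using h3
  have hlim2 := ((tendsto_const_nhds (x := ∫ x, ‖fderiv ℝ f x‖ ∂(ballMeasure n))).add
    (tendsto_integral_cutoffWeight (by omega) hf)).rpow_const (p := p) (Or.inr hp0.le)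
  refine le_of_tendsto_of_tendsto' hlim1 (hlim2.const_mul C) fun k => ?_
  have hw := contDiff_cutoff_mul hf k
  have hk := h _ hw (hasCompactSupport_cutoff_mul f k)
  have e1 : ∫ x, |cutoff k x * f x| ^ p = ∫ x, (cutoff k x * f x) ^ p ∂(ballMeasure n) := by
    rw [integral_eq_of_eq_zero_outside fun x hx => by
      rw [cutoff_eq_zero hx, zero_mul, Real.zero_rpow hp0.ne']]
    refine integral_congr_ae (Eventually.of_forall fun x => ?_)
    simp only
    rw [abs_of_nonneg (mul_nonneg cutoff_nonneg (h0 x))]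
  rw [← e1]
  refine hk.trans (mul_le_mul_of_nonneg_left (Real.rpow_le_rpow
    (integral_nonneg fun _ => norm_nonneg _) ?_ hp0.le) hC)
  -- `f` need not be differentiable outside a neighbourhood of the closed ball, but the cutoff
  -- vanishes there
  have hzero : ∀ x : Eu n, 1 ≤ ‖x‖ → ‖fderiv ℝ (fun x => cutoff k x * f x) x‖ = 0 := by
    intro x hx
    rcases hx.lt_or_eq with hx | hx
    · have : (fun x => cutoff k x * f x) =ᶠ[𝓝 x] fun _ => 0 := by
        filter_upwards [(continuous_norm.continuousAt (x := x)).eventually (lt_mem_nhds hx)]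
          with y hy
        rw [cutoff_eq_zero (le_of_lt hy), zero_mul]
      rw [this.fderiv_eq]; simp
    · have hmem : x ∈ closedBall (0 : Eu n) 1 := by simp [← hx]
      rw [fderiv_fun_mul (hasFDerivAt_cutoff k x).differentiableAt (hf.differentiableAt hmem),
        (hasFDerivAt_cutoff k x).fderiv, cutoff_eq_zero hx.le, cutoffWeight_eq_zero hx.le]
      simp
  have hint := integrable_ball_of_continuousOn (continuous_cutoffWeight.continuousOn.mul
    hf.continuousOn (s := closedBall (0 : Eu n) 1)) (f := fun x => cutoffWeight k x * f x)
  rw [← integral_eq_of_eq_zero_outside hzero, ← integral_add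
    (integrable_ball_of_continuousOn hf.continuousOn_fderiv.norm) hint]
  refine integral_mono_ae ?_ ?_ ?_
  · exact integrable_ball_of_continuousOn (hw.continuous_fderiv (by simp)).norm.continuousOn
  · exact (integrable_ball_of_continuousOn hf.continuousOn_fderiv.norm).add hint
  filter_upwards [ae_restrict_mem measurableSet_ball] with x hx
  have hmem := ball_subset_closedBall hx
  rw [mem_ball_zero_iff] at hx
  rw [fderiv_fun_mul (hasFDerivAt_cutoff k x).differentiableAt (hf.differentiableAt hmem),
    (hasFDerivAt_cutoff k x).fderiv]
  refine (norm_add_le _ _).trans (add_le_add ?_ ?_)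
  · rw [norm_smul, Real.norm_of_nonneg cutoff_nonneg]
    exact mul_le_of_le_one_left (norm_nonneg _) cutoff_le_one
  · rw [norm_smul, norm_smul, innerSL_apply_norm, norm_neg, Real.norm_of_nonneg (h0 x),
      Real.norm_of_nonneg cutoffWeight_nonneg]
    have := mul_nonneg (cutoffWeight_nonneg (k := k) (x := x)) (h0 x)
    nlinarith

lemma C1OnBall.abs_rpow (hu : C1OnBall u) {q : ℝ} (hq : 1 < q) : C1OnBall fun z => |u z| ^ q :=
  .of_contDiffAt fun _ hz => ((contDiff_norm_rpow hq).contDiffAt (E := ℝ)).comp _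
    (hu.contDiffAt hz)

lemma C1OnBall.norm_fderiv_abs_rpow_le (hu : C1OnBall u) {q : ℝ} (hq : 1 < q) {z : Eu n}
    (hz : z ∈ closedBall (0 : Eu n) 1) :
    ‖fderiv ℝ (fun z => |u z| ^ q) z‖ ≤ q * (|u z| ^ (q - 1) * ‖fderiv ℝ u z‖) := by
  have h := (hasDerivAt_abs_rpow (u z) hq).comp_hasFDerivAt z (hu.differentiableAt hz).hasFDerivAt
  rw [show (fun z => |u z| ^ q) = (fun x : ℝ => |x| ^ q) ∘ u from rfl, h.fderiv, norm_smul,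
    norm_mul, norm_mul, Real.norm_of_nonneg (by linarith : 0 ≤ q),
    Real.norm_of_nonneg (by positivity : 0 ≤ |u z| ^ (q - 2)), Real.norm_eq_abs, mul_assoc q,
    ← Real.rpow_add_one' (abs_nonneg _) (by linarith), mul_assoc]
  ring_nf
  rfl

/-- The `L²` norm in the ball is controlled by the energy. -/
lemma integral_sq_le_energyOf (hn : 3 ≤ n) (hu : C1OnBall u) :
    ∫ z, u z ^ 2 ∂(ballMeasure n) ≤ 3 * energyOf u := by
  have hn3 : (3 : ℝ) ≤ n := by exact_mod_cast hn
  have h1 := integral_sphere_eq_integral_radial (by omega) (hu.mul hu)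
  have i1 : Integrable (fun z => u z ^ 2) (ballMeasure n) :=
    integrable_ball_of_continuousOn (hu.continuousOn.pow 2)
  have i2 : Integrable (fun z => ‖fderiv ℝ u z‖ ^ 2) (ballMeasure n) :=
    integrable_ball_of_continuousOn (hu.continuousOn_fderiv.norm.pow 2)
  have h2 : ∫ z, ((n - 1) * u z ^ 2 - ‖fderiv ℝ u z‖ ^ 2) ∂(ballMeasure n)
      ≤ ∫ z : Sph n, u z * u z ∂(sphMeasure n) := by
    rw [h1]
    refine integral_mono_ae ((i1.const_mul _).sub i2) ?_ ?_
    · exact integrable_ball_of_continuousOn ((continuousOn_const.mul (hu.mul hu).continuousOn).add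
        ((hu.mul hu).continuousOn_fderiv.clm_apply continuousOn_id))
    filter_upwards [ae_restrict_mem measurableSet_ball] with z hz
    have hmem := ball_subset_closedBall hz
    rw [mem_ball_zero_iff] at hz
    rw [fderiv_fun_mul (hu.differentiableAt hmem) (hu.differentiableAt hmem)]
    simp only [add_apply, smul_apply, smul_eq_mul]
    have h3 : |fderiv ℝ u z z| ≤ ‖fderiv ℝ u z‖ := by
      have := (fderiv ℝ u z).le_opNorm z
      rw [Real.norm_eq_abs] at this
      nlinarith [norm_nonneg (fderiv ℝ u z)]
    have h4 : (fderiv ℝ u z z) ^ 2 ≤ ‖fderiv ℝ u z‖ ^ 2 := by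
      rw [← sq_abs]
      exact pow_le_pow_left₀ (abs_nonneg _) h3 2
    nlinarith [sq_nonneg (u z + fderiv ℝ u z z)]
  rw [integral_sub (i1.const_mul _) i2, integral_const_mul] at h2
  have hG : ∫ z, ‖gradient u z‖ ^ 2 ∂(ballMeasure n) =
      ∫ z, ‖fderiv ℝ u z‖ ^ 2 ∂(ballMeasure n) := by
    simp only [norm_gradient]
  have hS : ∫ z : Sph n, u z * u z ∂(sphMeasure n) = ∫ z : Sph n, u z ^ 2 ∂(sphMeasure n) := by
    simp only [sq]
  rw [hS] at h2
  have hg := half_le_gam hn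
  have p1 : 0 ≤ ∫ z : Sph n, u z ^ 2 ∂(sphMeasure n) := integral_nonneg fun _ => sq_nonneg _
  have p2 : 0 ≤ ∫ z, ‖fderiv ℝ u z‖ ^ 2 ∂(ballMeasure n) := integral_nonneg fun _ => sq_nonneg _
  have p3 : 0 ≤ ∫ z, u z ^ 2 ∂(ballMeasure n) := integral_nonneg fun _ => sq_nonneg _
  rw [energyOf, integral_const_mul, hG]
  nlinarith

lemma energyOf_nonneg (hn : 3 ≤ n) (f : Eu n → ℝ) : 0 ≤ energyOf f :=
  add_nonneg (integral_nonneg fun _ => sq_nonneg _)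
    (integral_nonneg fun _ => mul_nonneg (gam_pos hn).le (sq_nonneg _))

/-- The critical Sobolev and trace inequalities for functions that are `C¹` up to the boundary,
with some constant. They follow from the Sobolev inequality with exponent one for `|u| ^ (τ + 1)`
and the divergence theorem for the field `|u(z)| ^ (τ + 1) z`. -/
lemma exists_sobolev_of_c1 (hn : 3 ≤ n) : ∃ C : ℝ, 0 ≤ C ∧ ∀ u : Eu n → ℝ, C1OnBall u →
    ∫ z, |u z| ^ (2 * tau n) ∂(ballMeasure n) ≤ C * energyOf u ^ tau n ∧
    ∫ z : Sph n, |u z| ^ (tau n + 1) ∂(sphMeasure n) ≤ C * energyOf u ^ ((tau n + 1) / 2) := by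
  have hn3 : (3 : ℝ) ≤ n := by exact_mod_cast hn
  have hn2 : (n : ℝ) - 2 ≠ 0 := by linarith
  have hn1 : (n : ℝ) - 1 ≠ 0 := by linarith
  set p : ℝ := n / (n - 1) with hp_def
  have hp : Real.HolderConjugate n p := by
    rw [Real.holderConjugate_iff]
    refine ⟨by linarith, ?_⟩
    rw [hp_def]; field_simp; ring
  have hp0 : 0 < p := hp.symm.pos
  set τ := tau n with hτ
  have hτ1 : 1 < τ := one_lt_tau hn
  -- the exponents fit: `|u| ^ (τ + 1)` in `L ^ p` is `|u|` in `L ^ (2τ)`, and below the factor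
  -- `X ^ (p / 2)` can be absorbed because `p < 2`
  have hqp : (τ + 1) * p = 2 * τ := by
    rw [hτ, tau, hp_def]; field_simp; ring
  have hpτ : p / 2 = τ * (1 - p / 2) := by
    rw [hτ, tau, hp_def]; field_simp; ring
  have hp2 : 0 < 1 - p / 2 := by
    rw [hp_def, sub_pos, div_div, div_lt_one (by nlinarith)]; nlinarith
  obtain ⟨C, hC, h⟩ := exists_integral_rpow_le_fderiv_add_sphere (n := n) (by omega) hp
  set K : ℝ := 2 * n + 2 * (τ + 1) with hK
  have hK0 : 0 < K := by positivity
  set A : ℝ := (C * K ^ p) ^ (1 - p / 2)⁻¹ with hA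
  have hA0 : 0 ≤ A := by positivity
  refine ⟨A + K * √A, by positivity, fun u hu => ?_⟩
  set E := energyOf u with hE
  have hE0 : 0 ≤ E := energyOf_nonneg hn u
  set X := ∫ z, |u z| ^ (2 * τ) ∂(ballMeasure n) with hX
  have hX0 : 0 ≤ X := integral_nonneg fun _ => by positivity
  set Y := ∫ z : Sph n, |u z| ^ (τ + 1) ∂(sphMeasure n) with hY
  have hq : 1 < τ + 1 := by linarith
  have hf := hu.abs_rpow hq
  have huc := hu.continuousOn
  have hτc : ContinuousOn (fun z => |u z| ^ τ) (closedBall (0 : Eu n) 1) :=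
    huc.abs.rpow_const fun _ _ => Or.inr (by linarith)
  have hsqX : ∫ z, (|u z| ^ τ) ^ 2 ∂(ballMeasure n) = X := by
    refine integral_congr_ae (Eventually.of_forall fun z => ?_)
    simp only
    rw [← Real.rpow_natCast, ← Real.rpow_mul (abs_nonneg _)]
    congr 1; push_cast; ring
  have hZ := integral_sq_le_energyOf hn hu
  have hG : ∫ z, ‖fderiv ℝ u z‖ ^ 2 ∂(ballMeasure n) ≤ E := by
    rw [hE, energyOf]
    simp only [norm_gradient]
    have : 0 ≤ ∫ z : Sph n, gam n * u z ^ 2 ∂(sphMeasure n) :=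
      integral_nonneg fun _ => mul_nonneg (gam_pos hn).le (sq_nonneg _)
    linarith
  have hXG : ∫ z, |u z| ^ τ * ‖fderiv ℝ u z‖ ∂(ballMeasure n) ≤ √X * √E := by
    have h1 := integral_mul_le_sqrt (memLp_of_continuousOn hτc)
      (memLp_of_continuousOn hu.continuousOn_fderiv.norm)
    rw [hsqX] at h1
    calc ∫ z, |u z| ^ τ * ‖fderiv ℝ u z‖ ∂(ballMeasure n)
        = ∫ z, |(|u z| ^ τ * ‖fderiv ℝ u z‖)| ∂(ballMeasure n) := by
          refine integral_congr_ae (Eventually.of_forall fun z => ?_)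
          exact (abs_of_nonneg (by positivity)).symm
      _ ≤ _ := h1
      _ ≤ _ := by gcongr
  have hXZ : ∫ z, |u z| ^ (τ + 1) ∂(ballMeasure n) ≤ 2 * (√X * √E) := by
    have h1 := integral_mul_le_sqrt (memLp_of_continuousOn hτc) (memLp_of_continuousOn huc.abs)
    rw [hsqX] at h1
    simp only [sq_abs] at h1
    calc ∫ z, |u z| ^ (τ + 1) ∂(ballMeasure n) = ∫ z, |(|u z| ^ τ * |u z|)| ∂(ballMeasure n) := by
          refine integral_congr_ae (Eventually.of_forall fun z => ?_)
          simp only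
          rw [Real.rpow_add_one' (abs_nonneg _) (by linarith)]
          exact (abs_of_nonneg (by positivity)).symm
      _ ≤ _ := h1
      _ ≤ √X * √(4 * E) := by gcongr; linarith
      _ = 2 * (√X * √E) := by
          rw [Real.sqrt_mul (by norm_num), show (4 : ℝ) = 2 ^ 2 by norm_num,
            Real.sqrt_sq (by norm_num)]
          ring
  have hder : ∀ z ∈ ball (0 : Eu n) 1, ‖fderiv ℝ (fun z => |u z| ^ (τ + 1)) z‖
      ≤ (τ + 1) * (|u z| ^ τ * ‖fderiv ℝ u z‖) := fun z hz => by
    have := hu.norm_fderiv_abs_rpow_le hq (ball_subset_closedBall hz)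
    rwa [add_sub_cancel_right] at this
  have iXG : Integrable (fun z => |u z| ^ τ * ‖fderiv ℝ u z‖) (ballMeasure n) :=
    integrable_ball_of_continuousOn (hτc.mul hu.continuousOn_fderiv.norm)
  have hD : ∫ z, ‖fderiv ℝ (fun z => |u z| ^ (τ + 1)) z‖ ∂(ballMeasure n)
      ≤ (τ + 1) * (√X * √E) := by
    calc _ ≤ ∫ z, (τ + 1) * (|u z| ^ τ * ‖fderiv ℝ u z‖) ∂(ballMeasure n) := by
          refine setIntegral_mono_on ?_ (iXG.const_mul _) measurableSet_ball hder
          exact integrable_ball_of_continuousOn hf.continuousOn_fderiv.norm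
      _ ≤ _ := by
          rw [integral_const_mul]
          exact mul_le_mul_of_nonneg_left hXG (by linarith)
  have hYle : Y ≤ (2 * n + (τ + 1)) * (√X * √E) := by
    have i1 : Integrable (fun z => (n : ℝ) * |u z| ^ (τ + 1)) (ballMeasure n) :=
      (integrable_ball_of_continuousOn hf.continuousOn).const_mul _
    have i2 : Integrable (fun z => fderiv ℝ (fun z => |u z| ^ (τ + 1)) z z) (ballMeasure n) :=
      integrable_ball_of_continuousOn (hf.continuousOn_fderiv.clm_apply continuousOn_id)
    rw [hY, integral_sphere_eq_integral_radial (by omega) hf, integral_add i1 i2,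
      integral_const_mul]
    have h2 : ∫ z, fderiv ℝ (fun z => |u z| ^ (τ + 1)) z z ∂(ballMeasure n)
        ≤ ∫ z, ‖fderiv ℝ (fun z => |u z| ^ (τ + 1)) z‖ ∂(ballMeasure n) := by
      refine setIntegral_mono_on (integrable_ball_of_continuousOn
        (hf.continuousOn_fderiv.clm_apply continuousOn_id))
        (integrable_ball_of_continuousOn hf.continuousOn_fderiv.norm) measurableSet_ball
        fun z hz => ?_
      rw [mem_ball_zero_iff] at hz
      refine (le_abs_self _).trans ?_
      have := (fderiv ℝ (fun z => |u z| ^ (τ + 1)) z).le_opNorm z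
      rw [Real.norm_eq_abs] at this
      nlinarith [norm_nonneg (fderiv ℝ (fun z => |u z| ^ (τ + 1)) z)]
    have h3 : (n : ℝ) * ∫ z, |u z| ^ (τ + 1) ∂(ballMeasure n) ≤ n * (2 * (√X * √E)) :=
      mul_le_mul_of_nonneg_left hXZ (by linarith)
    linarith
  have hXle : X ≤ A * E ^ τ := by
    have h1 := h _ hf fun z => by positivity
    have h2 : ∫ z, (|u z| ^ (τ + 1)) ^ p ∂(ballMeasure n) = X := by
      refine integral_congr_ae (Eventually.of_forall fun z => ?_)
      simp only
      rw [← Real.rpow_mul (abs_nonneg _), hqp]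
    rw [h2] at h1
    have h3 : X ≤ C * (K * (√X * √E)) ^ p := by
      refine h1.trans (mul_le_mul_of_nonneg_left (Real.rpow_le_rpow ?_ ?_ hp0.le) hC)
      · exact add_nonneg (integral_nonneg fun _ => norm_nonneg _)
          (integral_nonneg fun _ => by positivity)
      · rw [hK]; nlinarith [hD, hYle]
    rcases hX0.eq_or_lt with h0 | h0
    · rw [← h0]; positivity
    have h4 : X ≤ C * K ^ p * (X ^ (p / 2) * E ^ (p / 2)) := by
      refine h3.trans_eq ?_
      rw [Real.mul_rpow hK0.le (by positivity), Real.mul_rpow (by positivity) (by positivity),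
        Real.sqrt_eq_rpow, Real.sqrt_eq_rpow, ← Real.rpow_mul hX0, ← Real.rpow_mul hE0]
      ring_nf
    have h5 : X ^ (1 - p / 2) ≤ C * K ^ p * E ^ (p / 2) := by
      rw [Real.rpow_sub h0, Real.rpow_one, div_le_iff₀ (Real.rpow_pos_of_pos h0 _)]
      linarith
    have h6 := Real.rpow_le_rpow (by positivity) h5 (inv_nonneg.2 hp2.le)
    rw [Real.rpow_rpow_inv hX0 hp2.ne', Real.mul_rpow (by positivity) (by positivity),
      ← Real.rpow_mul hE0, show p / 2 * (1 - p / 2)⁻¹ = τ from by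
        rw [eq_comm, eq_mul_inv_iff_mul_eq₀ hp2.ne', ← hpτ]] at h6
    exact h6
  refine ⟨hXle.trans ?_, hYle.trans ?_⟩
  · have : 0 ≤ K * √A * E ^ τ := by positivity
    linarith
  · have h1 : √X * √E ≤ √A * E ^ ((τ + 1) / 2) := by
      calc √X * √E ≤ √(A * E ^ τ) * √E := by gcongr
        _ = √A * E ^ ((τ + 1) / 2) := by
          rw [Real.sqrt_mul hA0, mul_assoc, Real.sqrt_eq_rpow (E ^ τ), Real.sqrt_eq_rpow E,
            ← Real.rpow_mul hE0, ← Real.rpow_add' hE0 (by positivity)]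
          ring_nf
    have h2 : 0 ≤ A * E ^ ((τ + 1) / 2) := by positivity
    have h3 : (2 * n + (τ + 1)) * (√X * √E) ≤ K * (√X * √E) :=
      mul_le_mul_of_nonneg_right (by rw [hK]; linarith) (by positivity)
    have h4 := mul_le_mul_of_nonneg_left h1 hK0.le
    linarith

end Sobolev

/-! ### Harmonic polynomials and the Steklov spectral gap of the ball -/

section HarmonicPolynomials

open MvPolynomial

variable {n : ℕ}

/-- The Laplacian on polynomials. -/
def lap (n : ℕ) : MvPolynomial (Fin n) ℝ →ₗ[ℝ] MvPolynomial (Fin n) ℝ :=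
  ∑ i, (pderiv i).toLinearMap ∘ₗ (pderiv i).toLinearMap

lemma lap_apply (p : MvPolynomial (Fin n) ℝ) : lap n p = ∑ i, pderiv i (pderiv i p) := by
  simp [lap, LinearMap.sum_apply]

/-- The polynomial `|X|²`. -/
def normSqPoly (n : ℕ) : MvPolynomial (Fin n) ℝ := ∑ i, X i ^ 2

lemma isHomogeneous_normSqPoly_pow (j : ℕ) : (normSqPoly n ^ j).IsHomogeneous (2 * j) := by
  have h : (normSqPoly n).IsHomogeneous 2 := by
    refine IsHomogeneous.sum _ _ _ fun i _ => ?_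
    simpa using (isHomogeneous_X ℝ i).pow 2
  exact h.pow j

lemma pderiv_normSqPoly_pow (i : Fin n) (j : ℕ) : pderiv i (normSqPoly n ^ (j + 1)) =
    C (2 * (j + 1) : ℝ) * (normSqPoly n ^ j * X i) := by
  have h : pderiv i (normSqPoly n) = 2 * X i := by
    rw [normSqPoly, map_sum, Finset.sum_eq_single i]
    · rw [Derivation.leibniz_pow]
      simp
    · intro k _ hk
      rw [Derivation.leibniz_pow, pderiv_X_of_ne hk]
      simp
    · simp
  rw [Derivation.leibniz_pow, h]
  simp only [add_tsub_cancel_right, nsmul_eq_mul, Nat.cast_add, Nat.cast_one, smul_eq_mul,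
    map_mul, map_add, map_natCast, map_ofNat, map_one]
  ring

lemma lap_normSqPoly_pow_mul {h : MvPolynomial (Fin n) ℝ} {d : ℕ} (hh : h.IsHomogeneous d)
    (hl : lap n h = 0) (j : ℕ) : lap n (normSqPoly n ^ (j + 1) * h) =
      C (2 * (j + 1) * (n + 2 * j + 2 * d) : ℝ) * (normSqPoly n ^ j * h) := by
  have e1 : ∑ i, X i * pderiv i (normSqPoly n ^ j) = C (2 * j : ℝ) * normSqPoly n ^ j := by
    rw [(isHomogeneous_normSqPoly_pow j).sum_X_mul_pderiv, nsmul_eq_mul]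
    simp only [Nat.cast_mul, Nat.cast_ofNat, map_mul, map_ofNat, map_natCast]
  have e2 : ∑ i, X i * pderiv i h = C (d : ℝ) * h := by
    rw [hh.sum_X_mul_pderiv, nsmul_eq_mul]
    simp
  rw [lap_apply] at hl ⊢
  have e3 : ∀ i : Fin n, pderiv i (pderiv i (normSqPoly n ^ (j + 1) * h)) =
      C (2 * (j + 1) : ℝ) * ((X i * pderiv i (normSqPoly n ^ j)) * h + normSqPoly n ^ j * h
        + 2 * (normSqPoly n ^ j * (X i * pderiv i h)))
      + normSqPoly n ^ (j + 1) * pderiv i (pderiv i h) := by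
    intro i
    simp only [Derivation.leibniz, pderiv_normSqPoly_pow, map_add, pderiv_C, pderiv_X_self,
      smul_eq_mul]
    ring
  simp only [e3, Finset.sum_add_distrib, ← Finset.mul_sum, ← Finset.sum_mul, e1, e2, hl]
  simp only [Finset.sum_const, Finset.card_univ, Fintype.card_fin, nsmul_eq_mul, map_mul, map_add,
    map_natCast, map_ofNat, map_one]
  ring

/-- The span of the products of powers of `|X|²` and harmonic polynomials, in degree `d`. -/
def harmonicSpan (n d : ℕ) : Submodule ℝ (MvPolynomial (Fin n) ℝ) :=
  Submodule.span ℝ {q | ∃ (j e : ℕ) (h : MvPolynomial (Fin n) ℝ), 2 * j + e = d ∧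
    h.IsHomogeneous e ∧ lap n h = 0 ∧ q = normSqPoly n ^ j * h}

lemma isHomogeneous_of_mem_harmonicSpan {d : ℕ} {q : MvPolynomial (Fin n) ℝ}
    (hq : q ∈ harmonicSpan n d) : q.IsHomogeneous d := by
  have : harmonicSpan n d ≤ homogeneousSubmodule (Fin n) ℝ d := by
    refine Submodule.span_le.2 ?_
    rintro _ ⟨j, e, h, hd, hh, -, rfl⟩
    rw [← hd]
    exact (isHomogeneous_normSqPoly_pow j).mul hh
  exact this hq

/-- The Laplacian of `|X|^(2j+2) h`, with `h` harmonic, is a non-zero multiple of `|X|^(2j) h`, so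
it maps the span in degree `d + 2` onto the one in degree `d`. -/
lemma exists_lap_eq (hn : 0 < n) {d : ℕ} {q : MvPolynomial (Fin n) ℝ}
    (hq : q ∈ harmonicSpan n d) : ∃ r ∈ harmonicSpan n (d + 2), lap n r = q := by
  have : harmonicSpan n d ≤ (harmonicSpan n (d + 2)).map (lap n) := by
    refine Submodule.span_le.2 ?_
    rintro _ ⟨j, e, h, hd, hh, hl, rfl⟩
    set c : ℝ := 2 * (j + 1) * (n + 2 * j + 2 * e)
    have hc : c ≠ 0 := by
      have : (0 : ℝ) < n := by exact_mod_cast hn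
      positivity
    refine ⟨c⁻¹ • (normSqPoly n ^ (j + 1) * h), Submodule.smul_mem _ _ (Submodule.subset_span
      ⟨j + 1, e, h, by omega, hh, hl, rfl⟩), ?_⟩
    rw [map_smul, lap_normSqPoly_pow_mul hh hl, ← smul_eq_C_mul, smul_smul, inv_mul_cancel₀ hc,
      one_smul]
  exact this hq

/-- Every homogeneous polynomial is a combination of products of powers of `|X|²` and harmonic
polynomials: its Laplacian has this form by induction, hence is the Laplacian of such a
combination, and the difference is harmonic. -/
lemma mem_harmonicSpan (hn : 0 < n) (d : ℕ) (p : MvPolynomial (Fin n) ℝ)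
    (hp : p.IsHomogeneous d) : p ∈ harmonicSpan n d := by
  induction d using Nat.strong_induction_on generalizing p with
  | _ d ih =>
    have hmem : ∀ q : MvPolynomial (Fin n) ℝ, q.IsHomogeneous d → lap n q = 0 →
        q ∈ harmonicSpan n d := fun q hq hl =>
      Submodule.subset_span ⟨0, d, q, by omega, hq, hl, by simp⟩
    rcases Nat.lt_or_ge d 2 with hd | hd
    · refine hmem p hp ?_
      rw [lap_apply]
      refine Finset.sum_eq_zero fun i _ => ?_
      have h := hp.pderiv (i := i)
      rw [show d - 1 = 0 by omega, ← totalDegree_zero_iff_isHomogeneous,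
        totalDegree_eq_zero_iff_eq_C] at h
      rw [h, pderiv_C]
    · obtain ⟨m, rfl⟩ : ∃ m, d = m + 2 := ⟨d - 2, by omega⟩
      have hl : (lap n p).IsHomogeneous m := by
        rw [lap_apply]
        refine IsHomogeneous.sum _ _ _ fun i _ => ?_
        exact (hp.pderiv (i := i)).pderiv (i := i)
      obtain ⟨r, hr, hrp⟩ := exists_lap_eq hn (ih m (by omega) _ hl)
      have h1 : p - r ∈ harmonicSpan n (m + 2) := by
        refine hmem _ ((homogeneousSubmodule (Fin n) ℝ (m + 2)).sub_mem hp
          (isHomogeneous_of_mem_harmonicSpan hr)) ?_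
        rw [map_sub, hrp, sub_self]
      simpa using Submodule.add_mem _ h1 hr

/-- The polynomial function on `Eu n`. -/
def ev (p : MvPolynomial (Fin n) ℝ) (z : Eu n) : ℝ := eval (fun i => z i) p

lemma hasFDerivAt_ev (p : MvPolynomial (Fin n) ℝ) (z : Eu n) :
    HasFDerivAt (ev p) (∑ i, ev (pderiv i p) z • (EuclideanSpace.proj i : Eu n →L[ℝ] ℝ)) z := by
  induction p using MvPolynomial.induction_on with
  | C a =>
    have : ev (C a : MvPolynomial (Fin n) ℝ) = fun _ => a := by ext; simp [ev]
    rw [this]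
    refine (hasFDerivAt_const a z).congr_fderiv ?_
    simp [ev]
  | add p q hp hq =>
    have : ev (p + q) = ev p + ev q := by ext; simp [ev]
    rw [this]
    refine (hp.add hq).congr_fderiv ?_
    simp [ev, add_smul, Finset.sum_add_distrib]
  | mul_X p k hp =>
    have : ev (p * X k) = ev p * fun z : Eu n => z k := by ext; simp [ev]
    rw [this]
    refine (hp.mul (EuclideanSpace.proj k : Eu n →L[ℝ] ℝ).hasFDerivAt).congr_fderiv ?_
    ext v
    simp only [ev, Derivation.leibniz, smul_eq_mul, map_add, map_mul, eval_X, pderiv_X]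
    simp [Finset.sum_add_distrib, Finset.mul_sum, add_mul, Pi.single_apply]
    refine Finset.sum_congr rfl fun i _ => by ring

lemma fderiv_ev_single (p : MvPolynomial (Fin n) ℝ) (z : Eu n) (i : Fin n) :
    fderiv ℝ (ev p) z (EuclideanSpace.single i 1) = ev (pderiv i p) z := by
  rw [(hasFDerivAt_ev p z).fderiv]
  simp

lemma continuous_ev (p : MvPolynomial (Fin n) ℝ) : Continuous (ev p) :=
  (MvPolynomial.continuous_eval p).comp (by fun_prop)

lemma c1OnBall_ev (p : MvPolynomial (Fin n) ℝ) : C1OnBall (ev p) := by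
  refine ⟨univ, isOpen_univ, subset_univ _, ContDiff.contDiffOn ?_⟩
  rw [contDiff_one_iff_fderiv]
  refine ⟨fun z => (hasFDerivAt_ev p z).differentiableAt, ?_⟩
  rw [show fderiv ℝ (ev p) = _ from funext fun z => (hasFDerivAt_ev p z).fderiv]
  exact continuous_finsetSum _ fun i _ => (continuous_ev _).smul continuous_const

/-- Green's formula for a harmonic polynomial. -/
lemma integral_gradient_harmonic (hn : 0 < n) {f : Eu n → ℝ} (hf : C1OnBall f)
    {W : MvPolynomial (Fin n) ℝ} (hW : lap n W = 0) :
    ∫ z, ∑ i, fderiv ℝ f z (EuclideanSpace.single i 1) * ev (pderiv i W) z ∂(ballMeasure n)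
      = ∫ z : Sph n, f z * ev (∑ i, X i * pderiv i W) z ∂(sphMeasure n) := by
  rw [integral_inner_gradient_eq hn hf (fun i => c1OnBall_ev (pderiv i W))]
  · simp [ev]
  · intro z _
    simp only [fderiv_ev_single]
    rw [lap_apply] at hW
    have := congrArg (fun p => ev p z) hW
    simpa [ev] using this

/-- Green's formula, applied in both orders, multiplies the integral of the product by either of
the two degrees. -/
lemma integral_mul_eq_zero_of_ne (hn : 0 < n) {k l : ℕ} (hkl : k ≠ l)
    {p q : MvPolynomial (Fin n) ℝ} (hp : p.IsHomogeneous k) (hq : q.IsHomogeneous l)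
    (hlp : lap n p = 0) (hlq : lap n q = 0) :
    ∫ z : Sph n, ev p z * ev q z ∂(sphMeasure n) = 0 := by
  have h1 := integral_gradient_harmonic hn (c1OnBall_ev p) hlq
  have h2 := integral_gradient_harmonic hn (c1OnBall_ev q) hlp
  simp only [fderiv_ev_single] at h1 h2
  rw [hq.sum_X_mul_pderiv] at h1
  rw [hp.sum_X_mul_pderiv] at h2
  have e : ∀ (m : ℕ) (r : MvPolynomial (Fin n) ℝ) (z : Eu n), ev (m • r) z = m * ev r z := by
    intro m r z
    simp [ev]
  simp only [e] at h1 h2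
  have h3 : ∫ z : Sph n, ev p z * (l * ev q z) ∂(sphMeasure n)
      = ∫ z : Sph n, ev q z * (k * ev p z) ∂(sphMeasure n) := by
    rw [← h1, ← h2]
    refine integral_congr_ae (Eventually.of_forall fun z => ?_)
    exact Finset.sum_congr rfl fun i _ => mul_comm _ _
  have h4 : (l : ℝ) * ∫ z : Sph n, ev p z * ev q z ∂(sphMeasure n)
      = k * ∫ z : Sph n, ev p z * ev q z ∂(sphMeasure n) := by
    rw [← integral_const_mul, ← integral_const_mul]
    refine (integral_congr_ae (Eventually.of_forall fun z => ?_)).trans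
      (h3.trans (integral_congr_ae (Eventually.of_forall fun z => ?_)))
    · show _ = _; ring
    · show _ = _; ring
  have h5 : ((l : ℝ) - k) * ∫ z : Sph n, ev p z * ev q z ∂(sphMeasure n) = 0 := by
    rw [sub_mul, h4, sub_self]
  rcases mul_eq_zero.1 h5 with h | h
  · exact absurd (by exact_mod_cast (sub_eq_zero.1 h).symm) hkl
  · exact h

/-- The polynomial `p` agrees on the unit sphere with a finite sum of harmonic polynomials `h k`,
with `h k` homogeneous of degree `k`. -/
def IsHarmonicSumOnSphere (p : MvPolynomial (Fin n) ℝ) : Prop :=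
  ∃ (N : ℕ) (h : ℕ → MvPolynomial (Fin n) ℝ), (∀ k, (h k).IsHomogeneous k) ∧
    (∀ k, lap n (h k) = 0) ∧ (∀ k, N ≤ k → h k = 0) ∧
    ∀ z : Sph n, ev p z = ∑ k ∈ Finset.range N, ev (h k) z

lemma IsHarmonicSumOnSphere.add {p q : MvPolynomial (Fin n) ℝ} (hp : IsHarmonicSumOnSphere p)
    (hq : IsHarmonicSumOnSphere q) : IsHarmonicSumOnSphere (p + q) := by
  obtain ⟨N, h, h1, h2, h3, h4⟩ := hp
  obtain ⟨M, g, g1, g2, g3, g4⟩ := hq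
  have pad : ∀ (N' : ℕ) (h : ℕ → MvPolynomial (Fin n) ℝ) (N : ℕ), (∀ k, N ≤ k → h k = 0) →
      N ≤ N' → ∀ z : Eu n,
      ∑ k ∈ Finset.range N, ev (h k) z = ∑ k ∈ Finset.range N', ev (h k) z := by
    intro N' h N h3 hN z
    refine Finset.sum_subset (Finset.range_mono hN) fun k _ hk => ?_
    rw [h3 k (by simpa using hk)]
    simp [ev]
  refine ⟨max N M, fun k => h k + g k, fun k => (h1 k).add (g1 k), fun k => ?_, fun k hk => ?_,
    fun z => ?_⟩
  · simp only [map_add, h2, g2, add_zero]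
  · simp only [h3 k ((le_max_left _ _).trans hk), g3 k ((le_max_right _ _).trans hk), add_zero]
  · have : ∀ (p q : MvPolynomial (Fin n) ℝ) (z : Eu n), ev (p + q) z = ev p z + ev q z := by
      intro p q z; simp [ev]
    simp only [this, Finset.sum_add_distrib]
    rw [h4, g4, pad _ h N h3 (le_max_left N M), pad _ g M g3 (le_max_right N M)]

lemma IsHarmonicSumOnSphere.smul {p : MvPolynomial (Fin n) ℝ} (c : ℝ)
    (hp : IsHarmonicSumOnSphere p) : IsHarmonicSumOnSphere (c • p) := by
  obtain ⟨N, h, h1, h2, h3, h4⟩ := hp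
  refine ⟨N, fun k => c • h k, fun k => (homogeneousSubmodule (Fin n) ℝ k).smul_mem c (h1 k),
    fun k => by simp only [map_smul, h2, smul_zero],
    fun k hk => by simp only [h3 k hk, smul_zero], fun z => ?_⟩
  have : ∀ (p : MvPolynomial (Fin n) ℝ) (z : Eu n), ev (c • p) z = c * ev p z := by
    intro p z; simp [ev]
  simp only [this, ← Finset.mul_sum]
  rw [h4]

lemma isHarmonicSumOnSphere_zero : IsHarmonicSumOnSphere (0 : MvPolynomial (Fin n) ℝ) :=
  ⟨0, fun _ => 0, fun k => isHomogeneous_zero _ _ k, fun _ => map_zero _, fun _ _ => rfl,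
    fun z => by simp [ev]⟩

/-- On the sphere every polynomial is a sum of homogeneous harmonic polynomials, because `|X|² = 1`
there. -/
lemma isHarmonicSumOnSphere (hn : 0 < n) (p : MvPolynomial (Fin n) ℝ) :
    IsHarmonicSumOnSphere p := by
  have key : ∀ d, ∀ q ∈ harmonicSpan n d, IsHarmonicSumOnSphere q := by
    intro d q hq
    refine Submodule.span_induction ?_ isHarmonicSumOnSphere_zero (fun _ _ _ _ => .add)
      (fun c _ _ => .smul c) hq
    rintro _ ⟨j, e, h, -, hh, hl, rfl⟩
    refine ⟨e + 1, fun k => if k = e then h else 0, fun k => ?_, fun k => ?_, fun k hk => ?_,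
      fun z => ?_⟩
    · beta_reduce
      split_ifs with hk
      · rw [hk]; exact hh
      · exact isHomogeneous_zero _ _ k
    · beta_reduce
      split_ifs
      · exact hl
      · exact map_zero _
    · exact if_neg (by omega)
    · have h1 : ev (normSqPoly n) z = 1 := by
        have h2 : ‖(z : Eu n)‖ ^ 2 = 1 := by simp
        rw [norm_sq_eq_sum] at h2
        simpa [ev, normSqPoly] using h2
      rw [Finset.sum_eq_single e]
      · beta_reduce
        rw [if_pos rfl]
        have : ev (normSqPoly n ^ j * h) z = ev (normSqPoly n) z ^ j * ev h z := by simp [ev]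
        rw [this, h1]; simp
      · intro k _ hk
        beta_reduce
        rw [if_neg hk]; simp [ev]
      · simp
  rw [← sum_homogeneousComponent p]
  refine Finset.sum_induction _ _ (fun _ _ => .add) isHarmonicSumOnSphere_zero fun d _ => ?_
  exact key d _ (mem_harmonicSpan hn d _ (homogeneousComponent_isHomogeneous d p))

/-- Stone–Weierstrass on the sphere. -/
lemma exists_poly_near {g : Eu n → ℝ} (hg : ContinuousOn g (sphere 0 1)) {ε : ℝ} (hε : 0 < ε) :
    ∃ p : MvPolynomial (Fin n) ℝ, ∀ z : Sph n, |g z - ev p z| < ε := by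
  let coord : Fin n → C(Sph n, ℝ) := fun i => ⟨fun z => (z : Eu n) i, by fun_prop⟩
  let A : Subalgebra ℝ C(Sph n, ℝ) := (aeval (R := ℝ) coord).range
  have hA : A.SeparatesPoints := by
    intro z w hzw
    have : ∃ i, (z : Eu n) i ≠ (w : Eu n) i := by
      by_contra h
      push Not at h
      exact hzw (Subtype.ext (PiLp.ext h))
    obtain ⟨i, hi⟩ := this
    exact ⟨coord i, ⟨coord i, ⟨X i, by simp⟩, rfl⟩, hi⟩
  let g' : C(Sph n, ℝ) := ⟨fun z => g z, hg.comp_continuous continuous_subtype_val fun z => z.2⟩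
  obtain ⟨⟨_, ⟨p, rfl⟩⟩, hp⟩ :=
    ContinuousMap.exists_mem_subalgebra_near_continuousMap_of_separatesPoints A hA g' ε hε
  refine ⟨p, fun z => ?_⟩
  have h1 := (ContinuousMap.norm_lt_iff _ hε).1 hp z
  have h2 : (aeval (R := ℝ) coord p) z = ev p z := by
    have h3 : (aeval (R := ℝ) coord p) z
        = (ContinuousMap.evalAlgHom ℝ ℝ z).comp (aeval (R := ℝ) coord) p := rfl
    rw [h3, MvPolynomial.comp_aeval, ev, aeval_def]
    rfl
  rw [← h2, abs_sub_comm, ← Real.norm_eq_abs]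
  exact h1

end HarmonicPolynomials

section SteklovGap

open MvPolynomial

variable {n : ℕ}

lemma integrable_sphere_of_continuous {f : Sph n → ℝ} (hf : Continuous f) :
    Integrable f (sphMeasure n) :=
  hf.integrable_of_hasCompactSupport (HasCompactSupport.of_compactSpace _)

lemma ContinuousOn.continuous_sphere {f : Eu n → ℝ} (hf : ContinuousOn f (sphere 0 1)) :
    Continuous fun z : Sph n => f z :=
  hf.comp_continuous continuous_subtype_val fun z => z.2

lemma continuous_ev_sphere (p : MvPolynomial (Fin n) ℝ) : Continuous fun z : Sph n => ev p z :=
  (continuous_ev p).comp continuous_subtype_val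

/-- A continuous function on the sphere that is orthogonal to itself is orthogonal to
everything. -/
lemma integral_mul_eq_zero_of_integral_sq_eq_zero {f g : Sph n → ℝ} (hg : Continuous g)
    (h : ∫ z, g z ^ 2 ∂(sphMeasure n) = 0) : ∫ z, f z * g z ∂(sphMeasure n) = 0 := by
  have h1 := (integral_eq_zero_iff_of_nonneg (fun z => sq_nonneg (g z))
    (integrable_sphere_of_continuous (hg.pow 2))).1 h
  rw [integral_eq_zero_of_ae]
  filter_upwards [h1] with z hz
  have : g z = 0 := by simpa using hz
  simp [this]

lemma norm_gradient_sq_eq_sum (f : Eu n → ℝ) (z : Eu n) :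
    ‖gradient f z‖ ^ 2 = ∑ i, fderiv ℝ f z (EuclideanSpace.single i 1) ^ 2 := by
  rw [norm_sq_eq_sum]
  refine Finset.sum_congr rfl fun i _ => ?_
  rw [← inner_single_one, gradient, InnerProductSpace.toDual_symm_apply]

/-- The part of the Dirichlet integral carried by a harmonic polynomial. -/
lemma two_mul_sub_le_dirichlet (hn : 0 < n) {f : Eu n → ℝ} (hf : C1OnBall f)
    {W : MvPolynomial (Fin n) ℝ} (hW : lap n W = 0) :
    2 * ∫ z : Sph n, f z * ev (∑ i, X i * pderiv i W) z ∂(sphMeasure n)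
      - ∫ z : Sph n, ev W z * ev (∑ i, X i * pderiv i W) z ∂(sphMeasure n)
      ≤ ∫ z, ‖gradient f z‖ ^ 2 ∂(ballMeasure n) := by
  rw [← integral_gradient_harmonic hn hf hW, ← integral_gradient_harmonic hn (c1OnBall_ev W) hW,
    ← integral_const_mul, ← integral_sub]
  · refine integral_mono ?_ ?_ fun z => ?_
    · refine integrable_ball_of_continuousOn (.sub (.mul continuousOn_const ?_) ?_)
      · exact continuousOn_finsetSum _ fun i _ =>
          (hf.continuousOn_fderiv.clm_apply continuousOn_const).mul (continuous_ev _).continuousOn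
      · simp only [fderiv_ev_single]
        exact continuousOn_finsetSum _ fun i _ =>
          (continuous_ev _).continuousOn.mul (continuous_ev _).continuousOn
    · exact integrable_ball_of_continuousOn (hf.continuousOn_gradient.norm.pow 2)
    · simp only [fderiv_ev_single, norm_gradient_sq_eq_sum]
      rw [Finset.mul_sum, ← Finset.sum_sub_distrib]
      refine Finset.sum_le_sum fun i _ => ?_
      nlinarith [sq_nonneg (fderiv ℝ f z (EuclideanSpace.single i 1) - ev (pderiv i W) z)]
  · refine integrable_ball_of_continuousOn (.mul continuousOn_const ?_)
    exact continuousOn_finsetSum _ fun i _ =>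
      (hf.continuousOn_fderiv.clm_apply continuousOn_const).mul (continuous_ev _).continuousOn
  · simp only [fderiv_ev_single]
    refine integrable_ball_of_continuousOn (continuousOn_finsetSum _ fun i _ =>
      (continuous_ev _).continuousOn.mul (continuous_ev _).continuousOn)

lemma ev_sum {ι : Type*} (s : Finset ι) (p : ι → MvPolynomial (Fin n) ℝ) (z : Eu n) :
    ev (∑ k ∈ s, p k) z = ∑ k ∈ s, ev (p k) z := by
  simp [ev]

lemma ev_smul (c : ℝ) (p : MvPolynomial (Fin n) ℝ) (z : Eu n) : ev (c • p) z = c * ev p z := by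
  simp [ev]

lemma euler_sum (N : ℕ) (c : ℕ → ℝ) {h : ℕ → MvPolynomial (Fin n) ℝ}
    (hh : ∀ k, (h k).IsHomogeneous k) (z : Eu n) :
    ev (∑ i, X i * pderiv i (∑ k ∈ Finset.range N, c k • h k)) z
      = ∑ k ∈ Finset.range N, k * c k * ev (h k) z := by
  simp only [map_sum, Finset.mul_sum]
  rw [Finset.sum_comm, ev_sum]
  refine Finset.sum_congr rfl fun k _ => ?_
  have : ∑ i, X i * pderiv i (c k • h k) = (k * c k : ℝ) • h k := by
    simp only [Derivation.map_smul, mul_smul_comm, ← Finset.smul_sum, (hh k).sum_X_mul_pderiv]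
    rw [← Nat.cast_smul_eq_nsmul ℝ, smul_smul, mul_comm]
  rw [this, ev_smul]

lemma integral_const_sphere (c : ℝ) : ∫ _ : Sph n, c ∂(sphMeasure n) = sphArea n * c := by
  simp [sphArea]

lemma sphArea_pos (hn : 0 < n) : 0 < sphArea n := by
  have := nontrivial_Eu hn
  refine ENNReal.toReal_pos ?_ (measure_ne_top _ _)
  rw [Measure.toSphere_apply_univ]
  simp [hn.ne', (measure_ball_pos (volume : Measure (Eu n)) 0 one_pos).ne']

/-- The volume of the unit ball. -/
def ballVol (n : ℕ) : ℝ := (ballMeasure n).real univ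

lemma ballVol_pos : 0 < ballVol n := by
  refine ENNReal.toReal_pos ?_ (measure_ne_top _ _)
  simpa using (measure_ball_pos (volume : Measure (Eu n)) 0 one_pos).ne'

lemma integral_inner_sq_sphere (hn : 0 < n) (v : Eu n) :
    ∫ z : Sph n, ⟪(z : Eu n), v⟫_ℝ ^ 2 ∂(sphMeasure n) = ballVol n * ‖v‖ ^ 2 := by
  have h := integral_fderiv_eq_integral_sphere hn (c1OnBall_inner v) v
  have h1 : ∀ x : Eu n, fderiv ℝ (fun z : Eu n => ⟪z, v⟫_ℝ) x v = ‖v‖ ^ 2 := by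
    intro x
    have : HasFDerivAt (fun z : Eu n => ⟪z, v⟫_ℝ) (innerSL ℝ v) x :=
      (innerSL ℝ v).hasFDerivAt.congr_of_eventuallyEq
        (Eventually.of_forall fun z => real_inner_comm _ _)
    rw [this.fderiv]; simp
  simp only [h1] at h
  simp only [sq] at h ⊢
  rw [← h]
  simp [ballVol]

/-- The square of the projection to a one-dimensional space of degree-one polynomials. -/
lemma sq_div_le_of_isHomogeneous_one (hn : 0 < n) {f : Sph n → ℝ} (hf : Continuous f)
    {p : MvPolynomial (Fin n) ℝ} (hp : p.IsHomogeneous 1) :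
    (∫ z : Sph n, f z * ev p z ∂(sphMeasure n)) ^ 2 / ∫ z : Sph n, ev p z ^ 2 ∂(sphMeasure n) ≤
      (∑ i, (∫ z : Sph n, (z : Eu n) i * f z ∂(sphMeasure n)) ^ 2) / ballVol n := by
  have hc : ∀ i : Fin n, ∃ c : ℝ, pderiv i p = C c := fun i => by
    have h := hp.pderiv (i := i)
    rw [Nat.sub_self, ← totalDegree_zero_iff_isHomogeneous, totalDegree_eq_zero_iff_eq_C] at h
    exact ⟨_, h⟩
  choose c hc using hc
  have h1 : ∀ z : Eu n, ev p z = ∑ i, z i * c i := by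
    intro z
    have h := hp.sum_X_mul_pderiv
    rw [one_nsmul] at h
    nth_rewrite 1 [← h]
    simp [ev, hc]
  set v : Eu n := WithLp.toLp 2 c
  have h2 : ∀ z : Eu n, ev p z = ⟪z, v⟫_ℝ := fun z => by
    rw [h1, PiLp.inner_apply]
    exact Finset.sum_congr rfl fun i _ => by simp [v, mul_comm]
  have h3 : ∫ z : Sph n, ev p z ^ 2 ∂(sphMeasure n) = ballVol n * ‖v‖ ^ 2 := by
    simp only [h2]; exact integral_inner_sq_sphere hn v
  have h4 : ∫ z : Sph n, f z * ev p z ∂(sphMeasure n)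
      = ∑ i, c i * ∫ z : Sph n, (z : Eu n) i * f z ∂(sphMeasure n) := by
    simp only [h1, Finset.mul_sum, ← integral_const_mul]
    rw [integral_finsetSum]
    · exact Finset.sum_congr rfl fun i _ =>
        integral_congr_ae (Eventually.of_forall fun z => by show _ = _; ring)
    · intro i _
      exact integrable_sphere_of_continuous (by fun_prop)
  have h5 : ‖v‖ ^ 2 = ∑ i, c i ^ 2 := norm_sq_eq_sum v
  have hB := ballVol_pos (n := n)
  rw [h3, h4]
  have h6 := Finset.sum_mul_sq_le_sq_mul_sq Finset.univ c
    fun i => ∫ z : Sph n, (z : Eu n) i * f z ∂(sphMeasure n)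
  rw [← h5] at h6
  rcases eq_or_ne (‖v‖ ^ 2) 0 with h0 | h0
  · rw [h0, mul_zero, div_zero]
    exact div_nonneg (Finset.sum_nonneg fun _ _ => sq_nonneg _) hB.le
  · have h7 : 0 < ‖v‖ ^ 2 := lt_of_le_of_ne (sq_nonneg _) (Ne.symm h0)
    rw [div_le_div_iff₀ (by positivity) hB]
    nlinarith

lemma sq_div_le_of_isHomogeneous_zero (hn : 0 < n) {f : Sph n → ℝ}
    {p : MvPolynomial (Fin n) ℝ} (hp : p.IsHomogeneous 0) :
    (∫ z : Sph n, f z * ev p z ∂(sphMeasure n)) ^ 2 / ∫ z : Sph n, ev p z ^ 2 ∂(sphMeasure n) ≤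
      (∫ z : Sph n, f z ∂(sphMeasure n)) ^ 2 / sphArea n := by
  rw [← totalDegree_zero_iff_isHomogeneous, totalDegree_eq_zero_iff_eq_C] at hp
  set t := coeff 0 p
  have h1 : ∀ z : Eu n, ev p z = t := fun z => by rw [hp]; simp [ev]
  have hA := sphArea_pos hn
  simp only [h1, integral_mul_const, integral_const_sphere]
  rcases eq_or_ne t 0 with h0 | h0
  · rw [h0]; simp; positivity
  · apply le_of_eq
    field_simp

/-- The first Steklov eigenvalues of the ball are zero, one and two: on functions orthogonal to
the affine functions on the sphere, the Dirichlet integral is at least twice the boundary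
integral of the square. On the sphere `f` is close to a sum of homogeneous harmonic polynomials
`h k`, and the comparison is made with the projections of `f` to the lines spanned by the `h k`. -/
lemma steklov_gap (hn : 0 < n) {f : Eu n → ℝ} (hf : C1OnBall f) :
    2 * ∫ z : Sph n, f z ^ 2 ∂(sphMeasure n) ≤ (∫ z, ‖gradient f z‖ ^ 2 ∂(ballMeasure n))
      + 2 * ((∫ z : Sph n, f z ∂(sphMeasure n)) ^ 2 / sphArea n)
      + (∑ i, (∫ z : Sph n, (z : Eu n) i * f z ∂(sphMeasure n)) ^ 2) / ballVol n := by
  have hfS : ContinuousOn f (sphere 0 1) := hf.continuousOn.mono sphere_subset_closedBall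
  have hfc := ContinuousOn.continuous_sphere hfS
  have hA := sphArea_pos hn
  refine le_of_forall_pos_le_add fun δ hδ => ?_
  obtain ⟨ε, hε, hεδ⟩ : ∃ ε : ℝ, 0 < ε ∧ 2 * (sphArea n * ε ^ 2) ≤ δ := by
    refine ⟨√(δ / (2 * sphArea n)), by positivity, ?_⟩
    rw [Real.sq_sqrt (by positivity)]
    field_simp; rfl
  obtain ⟨p, hp⟩ := exists_poly_near hfS hε
  obtain ⟨N, h, h1, h2, h3, h4⟩ := isHarmonicSumOnSphere hn p
  have h4' : ∀ z : Sph n, ev p z = ∑ k ∈ Finset.range (N + 2), ev (h k) z := by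
    intro z
    rw [h4, Finset.sum_range_succ, Finset.sum_range_succ, h3 N le_rfl, h3 (N + 1) (by omega)]
    simp [ev]
  set a : ℕ → ℝ := fun k => ∫ z : Sph n, f z * ev (h k) z ∂(sphMeasure n) with ha
  set b : ℕ → ℝ := fun k => ∫ z : Sph n, ev (h k) z ^ 2 ∂(sphMeasure n) with hb
  set c : ℕ → ℝ := fun k => a k / b k with hc
  have hb0 : ∀ k, 0 ≤ b k := fun k => integral_nonneg fun _ => sq_nonneg _
  have hcb : ∀ k, c k * b k = a k := by
    intro k
    by_cases h0 : b k = 0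
    · rw [h0, mul_zero]
      exact (integral_mul_eq_zero_of_integral_sq_eq_zero (continuous_ev_sphere _) h0).symm
    · exact div_mul_cancel₀ _ h0
  have hca : ∀ k, c k * a k = a k ^ 2 / b k := fun k => by simp only [hc]; ring
  have hca0 : ∀ k, 0 ≤ c k * a k := fun k => by rw [hca]; exact div_nonneg (sq_nonneg _) (hb0 k)
  -- the `h k` are pairwise orthogonal on the sphere
  have sumf : ∀ d : ℕ → ℝ, ∫ z : Sph n, f z * ∑ k ∈ Finset.range (N + 2), d k * ev (h k) z
      ∂(sphMeasure n) = ∑ k ∈ Finset.range (N + 2), d k * a k := by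
    intro d
    simp only [Finset.mul_sum, ha, ← integral_const_mul]
    rw [integral_finsetSum]
    · exact Finset.sum_congr rfl fun k _ =>
        integral_congr_ae (Eventually.of_forall fun z => by show _ = _; ring)
    · intro k _
      exact integrable_sphere_of_continuous
        (hfc.mul (continuous_const.mul (continuous_ev_sphere _)))
  have sumsum : ∀ d e : ℕ → ℝ, ∫ z : Sph n, (∑ k ∈ Finset.range (N + 2), d k * ev (h k) z) *
      ∑ k ∈ Finset.range (N + 2), e k * ev (h k) z ∂(sphMeasure n)
      = ∑ k ∈ Finset.range (N + 2), d k * e k * b k := by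
    intro d e
    have hint : ∀ k l, Integrable (fun z : Sph n => d k * ev (h k) z * (e l * ev (h l) z))
        (sphMeasure n) := fun k l => integrable_sphere_of_continuous
      ((continuous_const.mul (continuous_ev_sphere _)).mul
        (continuous_const.mul (continuous_ev_sphere _)))
    simp only [Finset.sum_mul_sum]
    rw [integral_finsetSum _ fun k _ => integrable_finsetSum _ fun l _ => hint k l]
    refine Finset.sum_congr rfl fun k hk => ?_
    rw [integral_finsetSum _ fun l _ => hint k l]
    have hkl : ∀ l, ∫ z : Sph n, d k * ev (h k) z * (e l * ev (h l) z) ∂(sphMeasure n)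
        = d k * e l * ∫ z : Sph n, ev (h k) z * ev (h l) z ∂(sphMeasure n) := by
      intro l
      rw [← integral_const_mul]
      exact integral_congr_ae (Eventually.of_forall fun z => by show _ = _; ring)
    rw [Finset.sum_eq_single k]
    · rw [hkl]
      simp only [hb, sq]
    · intro l _ hl
      rw [hkl, integral_mul_eq_zero_of_ne hn (Ne.symm hl) (h1 k) (h1 l) (h2 k) (h2 l), mul_zero]
    · intro h; exact absurd hk h
  -- comparison of `f` with the harmonic function `∑ c k • h k` in the Dirichlet integral
  have hW : lap n (∑ k ∈ Finset.range (N + 2), c k • h k) = 0 := by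
    simp only [map_sum, map_smul, h2, smul_zero, Finset.sum_const_zero]
  have hD := two_mul_sub_le_dirichlet hn hf hW
  simp only [euler_sum _ _ h1] at hD
  rw [sumf] at hD
  simp only [ev_sum, ev_smul] at hD
  rw [sumsum] at hD
  have hD' : ∑ k ∈ Finset.range (N + 2), k * (c k * a k) ≤
      ∫ z, ‖gradient f z‖ ^ 2 ∂(ballMeasure n) := by
    refine le_trans (le_of_eq ?_) hD
    rw [Finset.mul_sum, ← Finset.sum_sub_distrib]
    refine Finset.sum_congr rfl fun k _ => ?_
    linear_combination ((k : ℝ) * c k) * hcb k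
  -- the projections `c k • h k` approximate `f` in `L²` at least as well as `p` does
  have hS : ∫ z : Sph n, f z ^ 2 ∂(sphMeasure n) ≤
      ∑ k ∈ Finset.range (N + 2), c k * a k + sphArea n * ε ^ 2 := by
    have e1 : ∫ z : Sph n, (f z - ev p z) ^ 2 ∂(sphMeasure n) ≤ sphArea n * ε ^ 2 := by
      rw [← integral_const_sphere]
      refine integral_mono (integrable_sphere_of_continuous
        ((hfc.sub (continuous_ev_sphere _)).pow 2)) (integrable_const _) fun z => ?_
      exact sq_le_sq.2 ((hp z).le.trans (le_abs_self _))
    have e2 : ∫ z : Sph n, (f z - ev p z) ^ 2 ∂(sphMeasure n)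
        = ∫ z : Sph n, f z ^ 2 ∂(sphMeasure n)
          - 2 * ∑ k ∈ Finset.range (N + 2), a k + ∑ k ∈ Finset.range (N + 2), b k := by
      have s1 := sumf fun _ => 1
      have s2 := sumsum (fun _ => 1) fun _ => 1
      simp only [one_mul, ← h4'] at s1 s2
      rw [← s1, ← s2, ← integral_const_mul, ← integral_sub, ← integral_add]
      · exact integral_congr_ae (Eventually.of_forall fun z => by show _ = _; ring)
      · exact integrable_sphere_of_continuous ((hfc.pow 2).sub
          (continuous_const.mul (hfc.mul (continuous_ev_sphere _))))
      · exact integrable_sphere_of_continuous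
          ((continuous_ev_sphere _).mul (continuous_ev_sphere _))
      · exact integrable_sphere_of_continuous (hfc.pow 2)
      · exact integrable_sphere_of_continuous
          (continuous_const.mul (hfc.mul (continuous_ev_sphere _)))
    have e3 : 0 ≤ ∑ k ∈ Finset.range (N + 2), (b k - 2 * a k + c k * a k) := by
      refine Finset.sum_nonneg fun k _ => ?_
      have : b k - 2 * a k + c k * a k = b k * (1 - c k) ^ 2 := by
        linear_combination (2 - c k) * hcb k
      rw [this]
      exact mul_nonneg (hb0 k) (sq_nonneg _)
    rw [Finset.sum_add_distrib, Finset.sum_sub_distrib, ← Finset.mul_sum] at e3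
    linarith
  -- in degree `k` the Dirichlet integral is `k` times the boundary integral, so that only the
  -- degrees zero and one need a correction
  have h01 : 2 * ∑ k ∈ Finset.range (N + 2), c k * a k ≤
      ∑ k ∈ Finset.range (N + 2), k * (c k * a k) + 2 * (c 0 * a 0) + c 1 * a 1 := by
    have : ∑ k ∈ Finset.range N, 2 * (c (k + 1 + 1) * a (k + 1 + 1)) ≤
        ∑ k ∈ Finset.range N, ((k + 1 + 1 : ℕ) : ℝ) * (c (k + 1 + 1) * a (k + 1 + 1)) := by
      refine Finset.sum_le_sum fun k _ => mul_le_mul_of_nonneg_right ?_ (hca0 _)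
      push_cast
      have : (0 : ℝ) ≤ k := k.cast_nonneg
      linarith
    rw [← Finset.mul_sum] at this
    rw [Finset.sum_range_succ', Finset.sum_range_succ', Finset.sum_range_succ',
      Finset.sum_range_succ']
    simp only [zero_add, Nat.cast_zero, Nat.cast_one, zero_mul, one_mul, add_zero]
    linarith
  have hk0 : c 0 * a 0 ≤ (∫ z : Sph n, f z ∂(sphMeasure n)) ^ 2 / sphArea n := by
    rw [hca]; exact sq_div_le_of_isHomogeneous_zero hn (h1 0)
  have hk1 : c 1 * a 1 ≤
      (∑ i, (∫ z : Sph n, (z : Eu n) i * f z ∂(sphMeasure n)) ^ 2) / ballVol n := by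
    rw [hca]; exact sq_div_le_of_isHomogeneous_one hn hfc (h1 1)
  linarith

end SteklovGap

/-! ### Conformal invariance of the energy -/

section ConformalInvariance

variable {n : ℕ} {x z : Eu n}

lemma hasFDerivAt_den (x z : Eu n) :
    HasFDerivAt (den x) (innerSL ℝ ((2 * ‖x‖ ^ 2) • z - (2 : ℝ) • x)) z := by
  have h1 : HasFDerivAt (fun z : Eu n => ⟪x, z⟫_ℝ) (innerSL ℝ x) z := (innerSL ℝ x).hasFDerivAt
  have h2 : HasFDerivAt (fun z : Eu n => ‖z‖ ^ 2) ((2 : ℝ) • innerSL ℝ z) z := by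
    refine (hasStrictFDerivAt_norm_sq z).hasFDerivAt.congr_fderiv ?_
    ext v
    simp
  refine (((h1.const_mul 2).const_sub 1).add (h2.const_mul (‖x‖ ^ 2))).congr_fderiv ?_
  ext v
  simp
  ring

/-- The powers of the denominator. -/
lemma hasFDerivAt_den_rpow (hd : 0 < den x z) (s : ℝ) :
    HasFDerivAt (fun z => den x z ^ s)
      ((s * den x z ^ (s - 1)) • innerSL ℝ ((2 * ‖x‖ ^ 2) • z - (2 : ℝ) • x)) z :=
  (hasFDerivAt_den x z).rpow_const (Or.inl hd.ne')

lemma bub_eq (hx : ‖x‖ < 1) (hd : 0 < den x z) :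
    bub x z = (1 - ‖x‖ ^ 2) ^ gam n * den x z ^ (-gam n) := by
  rw [bub, conf, Real.div_rpow (one_sub_norm_sq_pos hx).le hd.le, Real.rpow_neg hd.le]
  rfl

/-- The `i`-th partial derivative of the bubble. -/
def bubPartial (x : Eu n) (i : Fin n) (z : Eu n) : ℝ :=
  (-gam n * (1 - ‖x‖ ^ 2) ^ gam n) * (den x z ^ (-gam n - 1) * (2 * ‖x‖ ^ 2 * z i - 2 * x i))

lemma hasFDerivAt_bub (hx : ‖x‖ < 1) (hd : 0 < den x z) :
    HasFDerivAt (bub x) (((1 - ‖x‖ ^ 2) ^ gam n * (-gam n * den x z ^ (-gam n - 1))) •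
      innerSL ℝ ((2 * ‖x‖ ^ 2) • z - (2 : ℝ) • x)) z := by
  have h := (hasFDerivAt_den_rpow hd (-gam n)).const_mul ((1 - ‖x‖ ^ 2) ^ gam n)
  rw [smul_smul] at h
  refine h.congr_of_eventuallyEq ?_
  filter_upwards [(contDiff_den x).continuous.continuousAt.eventually (lt_mem_nhds hd)] with y hy
  exact bub_eq hx hy

lemma fderiv_bub_single (hx : ‖x‖ < 1) (hd : 0 < den x z) (i : Fin n) :
    fderiv ℝ (bub x) z (EuclideanSpace.single i 1) = bubPartial x i z := by
  rw [(hasFDerivAt_bub hx hd).fderiv]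
  simp only [bubPartial, smul_apply, innerSL_apply_apply, smul_eq_mul,
    inner_single_one]
  simp
  ring

lemma c1OnBall_bubPartial (hx : ‖x‖ < 1) (i : Fin n) : C1OnBall (bubPartial x i) := by
  refine .of_contDiffAt fun z hz => ?_
  have hd : den x z ≠ 0 := (den_pos hx (by simpa using hz)).ne'
  have h1 : ContDiff ℝ 1 fun z : Eu n => z i := (EuclideanSpace.proj i : Eu n →L[ℝ] ℝ).contDiff
  exact contDiffAt_const.mul ((((contDiff_den x).of_le (by simp)).contDiffAt.rpow_const_of_ne
    hd).mul ((contDiffAt_const.mul h1.contDiffAt).sub contDiffAt_const))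

/-- The bubbles are harmonic. -/
lemma sum_fderiv_bubPartial (hd : 0 < den x z) :
    ∑ i, fderiv ℝ (bubPartial x i) z (EuclideanSpace.single i 1) = 0 := by
  have h : ∀ i, fderiv ℝ (bubPartial x i) z (EuclideanSpace.single i 1) =
      (-gam n * (1 - ‖x‖ ^ 2) ^ gam n) * (den x z ^ (-gam n - 1) * (2 * ‖x‖ ^ 2)
        + (-gam n - 1) * den x z ^ (-gam n - 1 - 1) * (2 * ‖x‖ ^ 2 * z i - 2 * x i) ^ 2) := by
    intro i
    have h1 : HasFDerivAt (fun z : Eu n => 2 * ‖x‖ ^ 2 * z i - 2 * x i)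
        ((2 * ‖x‖ ^ 2) • (EuclideanSpace.proj i : Eu n →L[ℝ] ℝ)) z :=
      ((EuclideanSpace.proj i : Eu n →L[ℝ] ℝ).hasFDerivAt.const_mul _).sub_const _
    have h2 := (((hasFDerivAt_den_rpow hd (-gam n - 1)).mul h1).const_mul
      (-gam n * (1 - ‖x‖ ^ 2) ^ gam n)).fderiv
    have h3 : fderiv ℝ (bubPartial x i) z = _ := h2
    rw [h3]
    have h4 : (EuclideanSpace.proj i : Eu n →L[ℝ] ℝ) (EuclideanSpace.single i 1) = 1 := by simp
    simp only [smul_apply, add_apply, innerSL_apply_apply, smul_eq_mul, inner_single_one, h4,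
      PiLp.sub_apply, PiLp.smul_apply]
    ring
  simp only [h, ← Finset.mul_sum, Finset.sum_add_distrib, Finset.sum_const, Finset.card_univ,
    Fintype.card_fin, nsmul_eq_mul]
  have h4 : ∑ i, (2 * ‖x‖ ^ 2 * z i - 2 * x i) ^ 2 = 4 * ‖x‖ ^ 2 * den x z := by
    have e1 : ∀ i, 2 * ‖x‖ ^ 2 * z i - 2 * x i = ((2 * ‖x‖ ^ 2) • z - (2 : ℝ) • x) i := fun i => by
      simp
    simp only [e1, ← norm_sq_eq_sum]
    rw [norm_sub_sq_real, norm_smul, norm_smul, inner_smul_left, inner_smul_right, den,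
      real_inner_comm x z]
    simp
    ring
  rw [h4, show den x z ^ (-gam n - 1) = den x z ^ (-gam n - 1 - 1) * den x z by
    rw [← Real.rpow_add_one hd.ne']; ring_nf]
  rw [gam]
  ring

lemma sum_mul_bubPartial (hn : 3 ≤ n) (hx : ‖x‖ < 1) (hz : ‖z‖ = 1) :
    ∑ i, z i * bubPartial x i z = gam n * (bub x z ^ tau n - bub x z) := by
  have hd := den_pos hx hz.le
  have h0 := one_sub_norm_sq_pos hx
  have h1 : ∑ i, z i * bubPartial x i z = (-gam n * (1 - ‖x‖ ^ 2) ^ gam n) *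
      (den x z ^ (-gam n - 1) * (den x z - (1 - ‖x‖ ^ 2))) := by
    have e : ∀ i, z i * bubPartial x i z = (-gam n * (1 - ‖x‖ ^ 2) ^ gam n) *
      (den x z ^ (-gam n - 1) * (2 * ‖x‖ ^ 2 * z i ^ 2 - 2 * (x i * z i))) := fun i => by
      rw [bubPartial]; ring
    simp only [e, ← Finset.mul_sum, Finset.sum_sub_distrib, ← norm_sq_eq_sum]
    have e2 : ∑ i, x i * z i = ⟪x, z⟫_ℝ := by
      rw [PiLp.inner_apply]
      exact Finset.sum_congr rfl fun i _ => by simp [mul_comm]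
    rw [e2, den, hz]
    ring
  have h2 : bub x z ^ tau n = (1 - ‖x‖ ^ 2) ^ gam n * (1 - ‖x‖ ^ 2) * den x z ^ (-gam n - 1) := by
    rw [bub, ← Real.rpow_mul (conf_pos hx hz.le).le, mul_comm (gam n), tau_mul_gam hn, conf,
      Real.div_rpow h0.le hd.le, Real.rpow_add_one h0.ne', div_eq_mul_inv, ← Real.rpow_neg hd.le,
      show -(gam n + 1) = -gam n - 1 by ring]
  have h3 : den x z ^ (-gam n) = den x z ^ (-gam n - 1) * den x z := by
    rw [← Real.rpow_add_one hd.ne']; ring_nf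
  rw [h1, h2, bub_eq hx hd, h3]
  ring

lemma smoothOnBall_bub (hx : ‖x‖ < 1) : SmoothOnBall (bub x) := by
  refine ⟨{z | 0 < den x z}, isOpen_lt continuous_const (contDiff_den x).continuous, ?_, ?_⟩
  · intro z hz
    exact den_pos hx (by simpa using hz)
  · intro z hz
    exact (contDiffAt_bub hx hz).contDiffWithinAt

/-- Green's formula with a bubble. -/
lemma integral_fderiv_mul_bub (hn : 3 ≤ n) (hx : ‖x‖ < 1) {f : Eu n → ℝ} (hf : C1OnBall f) :
    ∫ z, ∑ i, fderiv ℝ f z (EuclideanSpace.single i 1) *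
        fderiv ℝ (bub x) z (EuclideanSpace.single i 1) ∂(ballMeasure n)
      = ∫ z : Sph n, f z * (gam n * (bub x z ^ tau n - bub x z)) ∂(sphMeasure n) := by
  have h := integral_inner_gradient_eq (by omega) hf (c1OnBall_bubPartial hx) fun z hz =>
    sum_fderiv_bubPartial (den_pos hx (mem_ball_zero_iff.1 hz).le)
  rw [show (∫ z, ∑ i, fderiv ℝ f z (EuclideanSpace.single i 1) *
        fderiv ℝ (bub x) z (EuclideanSpace.single i 1) ∂(ballMeasure n)) =
      ∫ z, ∑ i, fderiv ℝ f z (EuclideanSpace.single i 1) * bubPartial x i z ∂(ballMeasure n) by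
    refine setIntegral_congr_fun measurableSet_ball fun z hz => ?_
    exact Finset.sum_congr rfl fun i _ => by
      rw [fderiv_bub_single hx (den_pos hx (mem_ball_zero_iff.1 hz).le)], h]
  refine integral_congr_ae (Eventually.of_forall fun z => ?_)
  beta_reduce
  rw [sum_mul_bubPartial hn hx (by simp)]

lemma norm_comp_of_norm_eq {c : ℝ} (hc : 0 < c) {A : Eu n →L[ℝ] Eu n} (hA : ∀ h, ‖A h‖ = c * ‖h‖)
    (L : Eu n →L[ℝ] ℝ) : ‖L.comp A‖ = c * ‖L‖ := by
  refine le_antisymm ?_ ?_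
  · refine ContinuousLinearMap.opNorm_le_bound _ (by positivity) fun h => ?_
    calc ‖L (A h)‖ ≤ ‖L‖ * ‖A h‖ := L.le_opNorm _
      _ = c * ‖L‖ * ‖h‖ := by rw [hA]; ring
  · have hinj : Function.Injective A := by
      rw [injective_iff_map_eq_zero]
      intro h h0
      have := hA h
      rw [h0, norm_zero] at this
      exact norm_eq_zero.1 ((mul_eq_zero.1 this.symm).resolve_left hc.ne')
    have hsurj : Function.Surjective A :=
      (LinearMap.injective_iff_surjective (f := (A : Eu n →ₗ[ℝ] Eu n))).1 hinj
    rw [← le_div_iff₀' hc]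
    refine ContinuousLinearMap.opNorm_le_bound _ (by positivity) fun w => ?_
    obtain ⟨h, rfl⟩ := hsurj w
    calc ‖L (A h)‖ ≤ ‖L.comp A‖ * ‖h‖ := (L.comp A).le_opNorm h
      _ = ‖L.comp A‖ / c * ‖A h‖ := by rw [hA]; field_simp

lemma C1OnBall.comp_mob {f : Eu n → ℝ} (hx : ‖x‖ < 1) (hf : C1OnBall f) :
    C1OnBall fun z => f (mob x z) := by
  refine .of_contDiffAt fun z hz => ?_
  have hz' : ‖z‖ ≤ 1 := by simpa using hz
  exact (hf.contDiffAt (by simpa using norm_mob_le hx hz')).comp z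
    ((contDiffAt_mob (den_pos hx hz').ne').of_le (by simp))

lemma norm_gradient_comp_mob {f : Eu n → ℝ} (hx : ‖x‖ < 1) (hz : ‖z‖ ≤ 1) (hf : C1OnBall f) :
    ‖gradient (fun z => f (mob x z)) z‖ = conf x z * ‖gradient f (mob x z)‖ := by
  have h1 := (hf.differentiableAt (z := mob x z) (by simpa using norm_mob_le hx hz)).hasFDerivAt
  have h2 := h1.comp z (hasFDerivAt_mob (den_pos hx hz).ne')
  rw [norm_gradient, norm_gradient]
  have h3 : fderiv ℝ (fun z => f (mob x z)) z = _ := h2.fderiv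
  rw [h3, norm_comp_of_norm_eq (conf_pos hx hz) (norm_fderiv_mob hx hz)]

lemma conf_pow_eq_bub_rpow (hn : 3 ≤ n) (hx : ‖x‖ < 1) (hz : ‖z‖ ≤ 1) :
    conf x z ^ n = bub x z ^ (2 * tau n) := by
  have h3 : (3 : ℝ) ≤ n := by exact_mod_cast hn
  rw [bub, ← Real.rpow_mul (conf_pos hx hz).le, ← Real.rpow_natCast]
  congr 1
  have h := tau_mul_gam hn
  have h2 : gam n = ((n : ℝ) - 2) / 2 := rfl
  linear_combination -2 * h - 2 * h2

lemma conf_pow_eq_bub_sq_mul (hx : ‖x‖ < 1) (hz : ‖z‖ ≤ 1) :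
    conf x z ^ n = bub x z ^ 2 * conf x z ^ 2 := by
  rw [bub, ← Real.rpow_natCast (conf x z ^ gam n), ← Real.rpow_mul (conf_pos hx hz).le,
    ← Real.rpow_natCast (conf x z) 2, ← Real.rpow_add (conf_pos hx hz), ← Real.rpow_natCast]
  congr 1
  simp [gam]

lemma conf_pow_pred_eq_bub_rpow (hn : 3 ≤ n) (hx : ‖x‖ < 1) (hz : ‖z‖ ≤ 1) :
    conf x z ^ (n - 1) = bub x z ^ (tau n + 1) := by
  rw [bub, ← Real.rpow_mul (conf_pos hx hz).le, ← Real.rpow_natCast, Nat.cast_sub (by omega)]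
  congr 1
  have h := tau_mul_gam hn
  have h2 : gam n = ((n : ℝ) - 2) / 2 := rfl
  push_cast
  linear_combination - h - 2 * h2

/-- The Möbius involutions, weighted by the bubbles, preserve the energy. -/
lemma energyOf_bub_mul_comp_mob (hn : 3 ≤ n) (hx : ‖x‖ < 1) {f : Eu n → ℝ} (hf : C1OnBall f) :
    energyOf (fun z => bub x z * f (mob x z)) = energyOf f := by
  set g : Eu n → ℝ := fun z => f (mob x z) with hg
  have hgc : C1OnBall g := hf.comp_mob hx
  have hb : C1OnBall (bub x) := (smoothOnBall_bub hx).c1OnBall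
  have hbgg : C1OnBall fun z => bub x z * (g z * g z) := hb.mul (hgc.mul hgc)
  have hgreen := integral_fderiv_mul_bub hn hx hbgg
  have key : ∀ z ∈ ball (0 : Eu n) 1, ‖gradient (fun z => bub x z * g z) z‖ ^ 2 =
      conf x z ^ n • ‖gradient f (mob x z)‖ ^ 2 +
      ∑ i, fderiv ℝ (fun z => bub x z * (g z * g z)) z (EuclideanSpace.single i 1) *
        fderiv ℝ (bub x) z (EuclideanSpace.single i 1) := by
    intro z hz
    have hz' := ball_subset_closedBall hz
    have hz1 : ‖z‖ ≤ 1 := (mem_ball_zero_iff.1 hz).le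
    have d1 := (hb.differentiableAt hz').hasFDerivAt
    have d2 := (hgc.differentiableAt hz').hasFDerivAt
    have e1 := norm_gradient_comp_mob hx hz1 hf
    rw [smul_eq_mul, conf_pow_eq_bub_sq_mul hx hz1,
      show bub x z ^ 2 * conf x z ^ 2 * ‖gradient f (mob x z)‖ ^ 2
        = bub x z ^ 2 * (conf x z * ‖gradient f (mob x z)‖) ^ 2 by ring, ← e1,
      norm_gradient_sq_eq_sum, norm_gradient_sq_eq_sum, Finset.mul_sum, ← Finset.sum_add_distrib]
    refine Finset.sum_congr rfl fun i _ => ?_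
    have f1 : fderiv ℝ (fun z => bub x z * g z) z = _ := (d1.mul d2).fderiv
    have f2 : fderiv ℝ (fun z => bub x z * (g z * g z)) z = _ := (d1.mul (d2.mul d2)).fderiv
    rw [f1, f2]
    simp only [add_apply, smul_apply, smul_eq_mul,
      Pi.mul_apply]
    ring
  have hball : ∫ z, ‖gradient (fun z => bub x z * g z) z‖ ^ 2 ∂(ballMeasure n) =
      (∫ z, ‖gradient f z‖ ^ 2 ∂(ballMeasure n)) +
      ∫ z : Sph n, bub x z * (g z * g z) * (gam n * (bub x z ^ tau n - bub x z))
        ∂(sphMeasure n) := by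
    rw [← hgreen, ← integral_ball_mob hx fun z => ‖gradient f z‖ ^ 2, ← integral_add]
    · exact setIntegral_congr_fun measurableSet_ball key
    · refine integrable_ball_of_continuousOn ((continuousOn_conf hx).pow n |>.smul
        (((hf.continuousOn_gradient).comp (continuousOn_mob hx) fun z hz => ?_).norm.pow 2))
      simpa using norm_mob_le hx (by simpa using hz)
    · exact integrable_ball_of_continuousOn (continuousOn_finsetSum _ fun i _ =>
        (hbgg.continuousOn_fderiv.clm_apply continuousOn_const).mul
          (hb.continuousOn_fderiv.clm_apply continuousOn_const))
  have hsph := integral_sphere_mob (by omega : 0 < n) hx (g := fun z => gam n * f z ^ 2)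
    (continuousOn_const.mul ((hf.continuousOn.mono sphere_subset_closedBall).pow 2))
  have cb := ContinuousOn.continuous_sphere (hb.continuousOn.mono sphere_subset_closedBall)
  have cg := ContinuousOn.continuous_sphere (hgc.continuousOn.mono sphere_subset_closedBall)
  have ct : Continuous fun z : Sph n => bub x z ^ tau n := cb.rpow_const fun z =>
    Or.inl (bub_pos hx (by simp)).ne'
  rw [energyOf, energyOf, hball, ← hsph, add_assoc, ← integral_add]
  · congr 1
    refine integral_congr_ae (Eventually.of_forall fun z => ?_)
    have hz : ‖(z : Eu n)‖ ≤ 1 := by simp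
    simp only
    rw [conf_pow_pred_eq_bub_rpow hn hx hz, Real.rpow_add_one (bub_pos hx hz).ne']
    ring
  · exact integrable_sphere_of_continuous
      ((cb.mul (cg.mul cg)).mul (continuous_const.mul (ct.sub cb)))
  · exact integrable_sphere_of_continuous (continuous_const.mul ((cb.mul cg).pow 2))

end ConformalInvariance

/-! ### The Sobolev space of the ball -/

section SobolevSpace

variable {n : ℕ}

/-- Fatou's lemma for powers along a sequence that converges in `L²`. -/
lemma integrable_abs_rpow_of_tendsto {X : Type*} [MeasurableSpace X] {μ : Measure X}
    {f : ℕ → Lp ℝ 2 μ} {g : Lp ℝ 2 μ} (hfg : Tendsto f atTop (𝓝 g)) {p : ℝ} (hp : 0 < p)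
    (hi : ∀ k, Integrable (fun z => |f k z| ^ p) μ) {c : ℕ → ℝ} {C : ℝ}
    (hc : ∀ k, ∫ z, |f k z| ^ p ∂μ ≤ c k) (hcC : Tendsto c atTop (𝓝 C)) :
    Integrable (fun z => |g z| ^ p) μ ∧ ∫ z, |g z| ^ p ∂μ ≤ C := by
  obtain ⟨ns, hns, hae⟩ := (tendstoInMeasure_of_tendsto_Lp hfg).exists_seq_tendsto_ae
  have hm : ∀ h : Lp ℝ 2 μ, AEStronglyMeasurable (fun z => |h z| ^ p) μ := fun h =>
    ((Real.continuous_rpow_const hp.le).comp continuous_abs).comp_aestronglyMeasurable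
      (Lp.aestronglyMeasurable h)
  have hpos : ∀ h : Lp ℝ 2 μ, 0 ≤ᵐ[μ] fun z => |h z| ^ p := fun h =>
    Eventually.of_forall fun z => Real.rpow_nonneg (abs_nonneg _) _
  have hC0 : 0 ≤ C := ge_of_tendsto' hcC fun k => (integral_nonneg_of_ae (hpos _)).trans (hc k)
  have h1 : ∫⁻ z, ENNReal.ofReal (|g z| ^ p) ∂μ ≤ ENNReal.ofReal C := by
    calc ∫⁻ z, ENNReal.ofReal (|g z| ^ p) ∂μ
        = ∫⁻ z, liminf (fun i => ENNReal.ofReal (|f (ns i) z| ^ p)) atTop ∂μ := by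
          refine lintegral_congr_ae ?_
          filter_upwards [hae] with z hz
          refine (Tendsto.liminf_eq ?_).symm
          exact (ENNReal.continuous_ofReal.tendsto _).comp
            (((Real.continuous_rpow_const hp.le).comp continuous_abs).continuousAt.tendsto.comp hz)
      _ ≤ liminf (fun i => ∫⁻ z, ENNReal.ofReal (|f (ns i) z| ^ p) ∂μ) atTop :=
          lintegral_liminf_le' fun i => (hm _).aemeasurable.ennreal_ofReal
      _ ≤ liminf (fun i => ENNReal.ofReal (c (ns i))) atTop := by
          refine liminf_le_liminf (Eventually.of_forall fun i => ?_)
          rw [← ofReal_integral_eq_lintegral_ofReal (hi _) (hpos _)]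
          exact ENNReal.ofReal_le_ofReal (hc _)
      _ = ENNReal.ofReal C := Tendsto.liminf_eq
          ((ENNReal.continuous_ofReal.tendsto _).comp (hcC.comp hns.tendsto_atTop))
  have h2 : Integrable (fun z => |g z| ^ p) μ :=
    ⟨hm g, (hasFiniteIntegral_iff_ofReal (hpos g)).2 (h1.trans_lt ENNReal.ofReal_lt_top)⟩
  refine ⟨h2, ?_⟩
  rwa [← ofReal_integral_eq_lintegral_ofReal h2 (hpos g), ENNReal.ofReal_le_ofReal_iff hC0] at h1

lemma integral_mul_eq_inner {X : Type*} [MeasurableSpace X] {μ : Measure X} {w : X → ℝ}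
    (hw : MemLp w 2 μ) (f : Lp ℝ 2 μ) : ∫ z, w z * f z ∂μ = inner ℝ (hw.toLp w) f := by
  rw [L2.inner_def]
  refine integral_congr_ae ?_
  filter_upwards [hw.coeFn_toLp] with z hz
  rw [hz]
  simp [mul_comm]

lemma continuous_integral_mul {X : Type*} [MeasurableSpace X] {μ : Measure X} {w : X → ℝ}
    (hw : MemLp w 2 μ) : Continuous fun f : Lp ℝ 2 μ => ∫ z, w z * f z ∂μ := by
  simp only [integral_mul_eq_inner hw]
  exact continuous_const.inner continuous_id

lemma continuous_integral_mul_sq {X : Type*} [MeasurableSpace X] {μ : Measure X} {w : X → ℝ}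
    (hw : MemLp w ⊤ μ) : Continuous fun f : Lp ℝ 2 μ => ∫ z, w z * f z ^ 2 ∂μ := by
  let W : Lp ℝ 2 μ →L[ℝ] Lp ℝ 2 μ :=
    (ContinuousLinearMap.mul ℝ ℝ).holderL μ ⊤ 2 2 (hw.toLp w)
  have h : ∀ f : Lp ℝ 2 μ, ∫ z, w z * f z ^ 2 ∂μ = inner ℝ (W f) f := by
    intro f
    rw [L2.inner_def]
    refine integral_congr_ae ?_
    filter_upwards [hw.coeFn_toLp, (ContinuousLinearMap.mul ℝ ℝ).coeFn_holder (r := 2)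
      (hw.toLp w) f] with z h1 h2
    have h3 : W f z = w z * f z := by rw [← h1]; exact h2
    rw [h3]
    simp
    ring
  simp only [h]
  exact W.continuous.inner continuous_id

lemma exists_eq_ofSmooth {T : Triple n} (hT : T ∈ smoothTriples n) :
    ∃ (φ : Eu n → ℝ) (hφ : SmoothOnBall φ), T = (ofSmooth φ hφ : H1 n) := by
  obtain ⟨φ, hφ, h1, h2, h3⟩ := hT
  refine ⟨φ, hφ, Prod.ext ?_ (Prod.ext ?_ ?_)⟩
  · exact Lp.ext (h1.trans (memLp_of_continuousOn hφ.continuousOn).coeFn_toLp.symm)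
  · exact Lp.ext (h2.trans (memLp_of_continuousOn hφ.continuousOn_gradient).coeFn_toLp.symm)
  · exact Lp.ext (h3.trans hφ.memLp_trace.coeFn_toLp.symm)

/-- A closed property of triples that holds for smooth functions holds on `H¹`. -/
lemma H1.induction {P : Triple n → Prop} (hP : IsClosed {T | P T})
    (h : ∀ (φ : Eu n → ℝ) (hφ : SmoothOnBall φ), P (ofSmooth φ hφ : H1 n)) (u : H1 n) :
    P u := by
  refine closure_minimal (s := (smoothTriples n : Set (Triple n))) ?_ hP u.2
  intro T hT
  obtain ⟨φ, hφ, rfl⟩ := exists_eq_ofSmooth hT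
  exact h φ hφ

lemma H1.exists_seq (u : H1 n) : ∃ (φ : ℕ → Eu n → ℝ) (hφ : ∀ k, SmoothOnBall (φ k)),
    Tendsto (fun k => ofSmooth (φ k) (hφ k)) atTop (𝓝 u) := by
  have hu : ∀ k : ℕ, ∃ (φ : Eu n → ℝ) (hφ : SmoothOnBall φ),
      dist (ofSmooth φ hφ) u < 1 / (k + 1) := by
    intro k
    have hk : (0 : ℝ) < 1 / (k + 1) := by positivity
    obtain ⟨T, hT, hTu⟩ := Metric.mem_closure_iff.1 u.2 _ hk
    obtain ⟨φ, hφ, rfl⟩ := exists_eq_ofSmooth hT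
    exact ⟨φ, hφ, by rw [dist_comm]; exact hTu⟩
  choose φ hφ h using hu
  refine ⟨φ, hφ, ?_⟩
  rw [tendsto_iff_dist_tendsto_zero]
  exact squeeze_zero (fun _ => dist_nonneg) (fun k => (h k).le)
    tendsto_one_div_add_atTop_nhds_zero_nat

/-- The bilinear form of the energy. -/
def pairing (u v : Triple n) : ℝ := inner ℝ u.2.1 v.2.1 + gam n * inner ℝ u.2.2 v.2.2

lemma pairing_comm (u v : Triple n) : pairing u v = pairing v u := by
  simp only [pairing, real_inner_comm]

lemma pairing_add_left (u v w : Triple n) : pairing (u + v) w = pairing u w + pairing v w := by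
  simp only [pairing, Prod.snd_add, Prod.fst_add, inner_add_left]; ring

lemma pairing_smul_left (c : ℝ) (u w : Triple n) : pairing (c • u) w = c * pairing u w := by
  simp only [pairing, Prod.smul_snd, Prod.smul_fst, inner_smul_left]; simp; ring

lemma continuous_pairing_left (v : Triple n) : Continuous fun u : Triple n => pairing u v := by
  unfold pairing
  exact (Continuous.inner (by fun_prop) continuous_const).add
    (continuous_const.mul (Continuous.inner (by fun_prop) continuous_const))

lemma continuous_pairing_self : Continuous fun u : Triple n => pairing u u := by
  unfold pairing
  exact (Continuous.inner (by fun_prop) (by fun_prop)).add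
    (continuous_const.mul (Continuous.inner (by fun_prop) (by fun_prop)))

lemma energy_eq_pairing (u : H1 n) : energy u = pairing (u : Triple n) u := by
  rw [energy, pairing, L2.inner_def, L2.inner_def, ← integral_const_mul]
  congr 1
  · exact integral_congr_ae (Eventually.of_forall fun z => (real_inner_self_eq_norm_sq _).symm)
  · refine integral_congr_ae (Eventually.of_forall fun z => ?_)
    simp [trace, sq]

lemma energy_nonneg (hn : 3 ≤ n) (u : H1 n) : 0 ≤ energy u :=
  add_nonneg (integral_nonneg fun _ => sq_nonneg _)
    (integral_nonneg fun _ => mul_nonneg (gam_pos hn).le (sq_nonneg _))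

lemma energy_ofSmooth {φ : Eu n → ℝ} (hφ : SmoothOnBall φ) :
    energy (ofSmooth φ hφ) = energyOf φ := by
  rw [energy, energyOf]
  congr 1
  · refine integral_congr_ae ?_
    filter_upwards [(memLp_of_continuousOn hφ.continuousOn_gradient).coeFn_toLp] with z hz
    rw [← hz]; rfl
  · refine integral_congr_ae ?_
    filter_upwards [hφ.memLp_trace.coeFn_toLp] with z hz
    rw [← hz]; rfl

lemma trace_ofSmooth {φ : Eu n → ℝ} (hφ : SmoothOnBall φ) :
    trace (ofSmooth φ hφ) =ᵐ[sphMeasure n] fun z => φ z := hφ.memLp_trace.coeFn_toLp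

lemma funVal_ofSmooth {φ : Eu n → ℝ} (hφ : SmoothOnBall φ) :
    funVal (ofSmooth φ hφ) =ᵐ[ballMeasure n] φ :=
  (memLp_of_continuousOn hφ.continuousOn).coeFn_toLp

lemma energy_sub_smul (u v : H1 n) (t : ℝ) : energy (u - t • v) =
    energy u - 2 * t * pairing (u : Triple n) v + t ^ 2 * energy v := by
  have h : ((u - t • v : H1 n) : Triple n) = (u : Triple n) + (-t) • (v : Triple n) := by
    simp [sub_eq_add_neg]
  rw [energy_eq_pairing, energy_eq_pairing, energy_eq_pairing, h, pairing_add_left,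
    pairing_smul_left, pairing_comm _ ((u : Triple n) + _), pairing_comm _ ((u : Triple n) + _),
    pairing_add_left, pairing_add_left, pairing_smul_left, pairing_smul_left,
    pairing_comm (v : Triple n) u]
  ring

lemma pairing_sq_le (hn : 3 ≤ n) (u v : H1 n) :
    pairing (u : Triple n) v ^ 2 ≤ energy u * energy v := by
  have h : ∀ t : ℝ, 0 ≤ energy v * (t * t) + (-2 * pairing (u : Triple n) v) * t + energy u := by
    intro t
    have := energy_nonneg hn (u - t • v)
    rw [energy_sub_smul] at this
    linarith
  have := discrim_le_zero h
  rw [discrim] at this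
  linarith

lemma sq_normE (hn : 3 ≤ n) (u : H1 n) : normE u ^ 2 = energy u := Real.sq_sqrt (energy_nonneg hn u)

lemma normE_nonneg (u : H1 n) : 0 ≤ normE u := Real.sqrt_nonneg _

lemma energy_add (u v : H1 n) : energy (u + v) =
    energy u + 2 * pairing (u : Triple n) v + energy v := by
  have h : u + v = u - (-1 : ℝ) • v := Subtype.ext (by simp)
  rw [h, energy_sub_smul]; ring

lemma energy_smul (c : ℝ) (u : H1 n) : energy (c • u) = c ^ 2 * energy u := by
  rw [energy_eq_pairing, energy_eq_pairing, Submodule.coe_smul, pairing_smul_left, pairing_comm,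
    pairing_smul_left]
  ring

lemma normE_smul (c : ℝ) (u : H1 n) : normE (c • u) = |c| * normE u := by
  rw [normE, energy_smul, Real.sqrt_mul (sq_nonneg c), Real.sqrt_sq_eq_abs, normE]

lemma normE_neg (u : H1 n) : normE (-u) = normE u := by
  rw [← neg_one_smul ℝ, normE_smul]; simp

lemma normE_add_le (hn : 3 ≤ n) (u v : H1 n) : normE (u + v) ≤ normE u + normE v := by
  refine abs_le_of_sq_le_sq' ?_ (add_nonneg (normE_nonneg _) (normE_nonneg _)) |>.2
  have h1 : |pairing (u : Triple n) v| ≤ normE u * normE v := by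
    refine abs_le_of_sq_le_sq ?_ (mul_nonneg (normE_nonneg _) (normE_nonneg _))
    rw [mul_pow, sq_normE hn, sq_normE hn]
    exact pairing_sq_le hn u v
  have h2 := le_abs_self (pairing (u : Triple n) v)
  rw [sq_normE hn, energy_add, add_sq, sq_normE hn, sq_normE hn]
  linarith

lemma normE_sub_le (hn : 3 ≤ n) (u v w : H1 n) : normE (u - w) ≤ normE (u - v) + normE (v - w) := by
  have := normE_add_le hn (u - v) (v - w)
  rwa [sub_add_sub_cancel] at this

lemma continuous_energy : Continuous fun u : H1 n => energy u := by
  simp only [energy_eq_pairing]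
  exact continuous_pairing_self.comp continuous_subtype_val

/-- The Sobolev inequality and the trace inequality on `H¹`. -/
lemma exists_sobolev (hn : 3 ≤ n) : ∃ C : ℝ, 0 ≤ C ∧ ∀ u : H1 n,
    (Integrable (fun z => |funVal u z| ^ (2 * tau n)) (ballMeasure n) ∧
      ∫ z, |funVal u z| ^ (2 * tau n) ∂(ballMeasure n) ≤ C * energy u ^ tau n) ∧
    (Integrable (fun z => |trace u z| ^ (tau n + 1)) (sphMeasure n) ∧
      ∫ z, |trace u z| ^ (tau n + 1) ∂(sphMeasure n) ≤ C * energy u ^ ((tau n + 1) / 2)) := by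
  obtain ⟨C, hC, h⟩ := exists_sobolev_of_c1 hn
  have ht := one_lt_tau hn
  refine ⟨C, hC, fun u => ?_⟩
  obtain ⟨φ, hφ, hlim⟩ := H1.exists_seq u
  have hlim' : Tendsto (fun k => (ofSmooth (φ k) (hφ k) : Triple n)) atTop (𝓝 (u : Triple n)) :=
    (continuous_subtype_val.tendsto u).comp hlim
  have hE : ∀ s : ℝ, 0 < s → Tendsto (fun k => C * energyOf (φ k) ^ s) atTop
      (𝓝 (C * energy u ^ s)) := by
    intro s hs
    have h1 := (continuous_energy.tendsto u).comp hlim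
    simp only [Function.comp_def, energy_ofSmooth] at h1
    exact (((Real.continuous_rpow_const hs.le).tendsto _).comp h1).const_mul C
  constructor
  · have hfun : ∀ k, (fun z => |funVal (ofSmooth (φ k) (hφ k)) z| ^ (2 * tau n))
        =ᵐ[ballMeasure n] fun z => |φ k z| ^ (2 * tau n) := fun k => by
      filter_upwards [funVal_ofSmooth (hφ k)] with z hz
      rw [hz]
    refine integrable_abs_rpow_of_tendsto
      (f := fun k => (ofSmooth (φ k) (hφ k) : Triple n).1) (g := (u : Triple n).1)
      ((continuous_fst.tendsto _).comp hlim') (by linarith) (fun k => ?_) (fun k => ?_)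
      (hE _ (by linarith))
    · exact (integrable_ball_of_continuousOn ((hφ k).continuousOn.abs.rpow_const
        fun _ _ => Or.inr (by linarith))).congr (hfun k).symm
    · exact (integral_congr_ae (hfun k)).trans_le (h _ (hφ k).c1OnBall).1
  · have hfun : ∀ k, (fun z => |trace (ofSmooth (φ k) (hφ k)) z| ^ (tau n + 1))
        =ᵐ[sphMeasure n] fun z => |φ k z| ^ (tau n + 1) := fun k => by
      filter_upwards [trace_ofSmooth (hφ k)] with z hz
      rw [hz]
    refine integrable_abs_rpow_of_tendsto
      (f := fun k => (ofSmooth (φ k) (hφ k) : Triple n).2.2) (g := (u : Triple n).2.2)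
      ((continuous_snd.snd.tendsto _).comp hlim') (by linarith) (fun k => ?_) (fun k => ?_)
      (hE _ (by linarith))
    · exact (integrable_sphere_of_continuousOn (f := fun z => |φ k z| ^ (tau n + 1))
        (((hφ k).continuousOn.mono sphere_subset_closedBall).abs.rpow_const
        fun _ _ => Or.inr (by linarith))).congr (hfun k).symm
    · exact (integral_congr_ae (hfun k)).trans_le (h _ (hφ k).c1OnBall).2

end SobolevSpace

/-! ### Bubbles in the Sobolev space -/

section Bubbles

variable {n : ℕ} {x : Eu n}

/-- The bubble `bub x` as an element of `H¹`. -/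
def bubH (hx : ‖x‖ < 1) : H1 n := ofSmooth (bub x) (smoothOnBall_bub hx)

lemma bubble_eq_bubH (e : Sph n) (lam : Ioc (0 : ℝ) 1) :
    bubble e lam = bubH (norm_bubble_index_lt e lam.2) := by
  have h : ∀ (φ ψ : Eu n → ℝ) (hφ : SmoothOnBall φ) (hψ : SmoothOnBall ψ), φ = ψ →
      ofSmooth φ hφ = ofSmooth ψ hψ := by
    rintro φ _ hφ hψ rfl; rfl
  exact h _ _ _ _ (funext fun z => bubbleFun_eq_bub e lam.2 z)

lemma bubH_eq_bubble (O : Sph n) (hx : ‖x‖ < 1) : ∃ (e : Sph n) (lam : Ioc (0 : ℝ) 1),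
    bubH hx = bubble e lam := by
  obtain ⟨e, lam, rfl⟩ := exists_bubble_index O hx
  exact ⟨e, lam, (bubble_eq_bubH e lam).symm⟩

lemma continuous_bub_sphere (hx : ‖x‖ < 1) : Continuous fun z : Sph n => bub x z :=
  ContinuousOn.continuous_sphere ((continuousOn_bub hx).mono sphere_subset_closedBall)

lemma bub_pos_sphere (hx : ‖x‖ < 1) (z : Sph n) : 0 < bub x z := bub_pos hx (by simp)

lemma continuous_bub_rpow (hx : ‖x‖ < 1) (s : ℝ) : Continuous fun z : Sph n => bub x z ^ s :=
  (continuous_bub_sphere hx).rpow_const fun z => Or.inl (bub_pos_sphere hx z).ne'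

lemma continuousOn_mob_apply (hx : ‖x‖ < 1) (i : Fin n) :
    ContinuousOn (fun z => mob x z i) (closedBall 0 1) :=
  (EuclideanSpace.proj i : Eu n →L[ℝ] ℝ).continuous.comp_continuousOn (continuousOn_mob hx)

lemma continuous_mob_sphere (hx : ‖x‖ < 1) : Continuous fun z : Sph n => mob x z :=
  ((continuousOn_mob hx).mono sphere_subset_closedBall).comp_continuous continuous_subtype_val
    fun z => z.2

lemma continuous_mob_apply_sphere (hx : ‖x‖ < 1) (i : Fin n) :
    Continuous fun z : Sph n => mob x z i :=
  (EuclideanSpace.proj i : Eu n →L[ℝ] ℝ).continuous.comp (continuous_mob_sphere hx)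

lemma memLp_sphere_of_continuous {w : Sph n → ℝ} (hw : Continuous w) (p : ENNReal) :
    MemLp w p (sphMeasure n) := by
  obtain ⟨C, hC⟩ := isCompact_univ.exists_bound_of_continuousOn hw.continuousOn
  exact MemLp.of_bound hw.aestronglyMeasurable C (Eventually.of_forall fun z => hC z (mem_univ z))

/-- Conformal change of variables on the sphere, with the Jacobian written as a power of a
bubble. -/
lemma integral_sphere_bub_rpow (hn : 3 ≤ n) (hx : ‖x‖ < 1) {g : Eu n → ℝ}
    (hg : ContinuousOn g (sphere 0 1)) :
    ∫ z : Sph n, bub x z ^ (tau n + 1) * g (mob x z) ∂(sphMeasure n)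
      = ∫ z : Sph n, g z ∂(sphMeasure n) := by
  rw [← integral_sphere_mob (by omega) hx hg]
  refine integral_congr_ae (Eventually.of_forall fun z => ?_)
  beta_reduce
  rw [conf_pow_pred_eq_bub_rpow hn hx (by simp)]

lemma integral_ball_bub_rpow {F : Type*} [NormedAddCommGroup F] [NormedSpace ℝ F] (hn : 3 ≤ n)
    (hx : ‖x‖ < 1) (g : Eu n → F) :
    ∫ z, bub x z ^ (2 * tau n) • g (mob x z) ∂(ballMeasure n) = ∫ z, g z ∂(ballMeasure n) := by
  rw [← integral_ball_mob hx g]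
  refine setIntegral_congr_fun measurableSet_ball fun z hz => ?_
  rw [conf_pow_eq_bub_rpow hn hx (mem_ball_zero_iff.1 hz).le]

lemma integral_bub_rpow_sphere (hn : 3 ≤ n) (hx : ‖x‖ < 1) :
    ∫ z : Sph n, bub x z ^ (tau n + 1) ∂(sphMeasure n) = sphArea n := by
  have h := integral_sphere_bub_rpow hn hx (g := fun _ => 1) continuousOn_const
  simpa [sphArea] using h

lemma energy_bubH (hn : 3 ≤ n) (hx : ‖x‖ < 1) : energy (bubH hx) = gam n * sphArea n := by
  have h1 : C1OnBall fun _ : Eu n => (1 : ℝ) := ⟨univ, isOpen_univ, subset_univ _, contDiffOn_const⟩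
  have h2 := energyOf_bub_mul_comp_mob hn hx h1
  simp only [mul_one] at h2
  rw [bubH, energy_ofSmooth]
  refine h2.trans ?_
  rw [energyOf]
  simp [sphArea]
  ring

/-- The bubbles are critical: pairing with a bubble is integration against its power `τ` on the
sphere. -/
lemma pairing_bubH (hn : 3 ≤ n) (hx : ‖x‖ < 1) (u : H1 n) : pairing (u : Triple n) (bubH hx) =
    gam n * ∫ z : Sph n, bub x z ^ tau n * trace u z ∂(sphMeasure n) := by
  have hw := memLp_sphere_of_continuous (continuous_bub_rpow hx (tau n)) 2
  refine H1.induction (P := fun T => pairing T (bubH hx) =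
    gam n * ∫ z : Sph n, bub x z ^ tau n * T.2.2 z ∂(sphMeasure n)) ?_ ?_ u
  · refine isClosed_eq (continuous_pairing_left _) ?_
    exact continuous_const.mul ((continuous_integral_mul hw).comp continuous_snd.snd)
  · intro φ hφ
    have hb := smoothOnBall_bub hx
    have h1 : inner ℝ (ofSmooth φ hφ : Triple n).2.1 (bubH hx : Triple n).2.1 =
        ∫ z : Sph n, φ z * (gam n * (bub x z ^ tau n - bub x z)) ∂(sphMeasure n) := by
      rw [← integral_fderiv_mul_bub hn hx hφ.c1OnBall, L2.inner_def]
      refine integral_congr_ae ?_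
      filter_upwards [(memLp_of_continuousOn hφ.continuousOn_gradient).coeFn_toLp,
        (memLp_of_continuousOn hb.continuousOn_gradient).coeFn_toLp] with z hz hz'
      have e1 : (ofSmooth φ hφ : Triple n).2.1 z = gradient φ z := hz
      have e2 : (bubH hx : Triple n).2.1 z = gradient (bub x) z := hz'
      rw [e1, e2, PiLp.inner_apply]
      refine Finset.sum_congr rfl fun i _ => ?_
      have e3 : ∀ f : Eu n → ℝ, gradient f z i = fderiv ℝ f z (EuclideanSpace.single i 1) :=
        fun f => by rw [← inner_single_one, gradient, InnerProductSpace.toDual_symm_apply]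
      rw [← e3, ← e3]
      simp [mul_comm]
    have h2 : inner ℝ (ofSmooth φ hφ : Triple n).2.2 (bubH hx : Triple n).2.2 =
        ∫ z : Sph n, φ z * bub x z ∂(sphMeasure n) := by
      rw [L2.inner_def]
      refine integral_congr_ae ?_
      filter_upwards [trace_ofSmooth hφ, trace_ofSmooth hb] with z hz hz'
      have e1 : (ofSmooth φ hφ : Triple n).2.2 z = φ z := hz
      have e2 : (bubH hx : Triple n).2.2 z = bub x z := hz'
      rw [e1, e2]
      simp [mul_comm]
    have h3 : ∫ z : Sph n, bub x z ^ tau n * (ofSmooth φ hφ : Triple n).2.2 z ∂(sphMeasure n) =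
        ∫ z : Sph n, bub x z ^ tau n * φ z ∂(sphMeasure n) := by
      refine integral_congr_ae ?_
      filter_upwards [trace_ofSmooth hφ] with z hz
      have e1 : (ofSmooth φ hφ : Triple n).2.2 z = φ z := hz
      rw [e1]
    have cφ := ContinuousOn.continuous_sphere (hφ.continuousOn.mono sphere_subset_closedBall)
    have cb := continuous_bub_sphere hx
    rw [pairing, h1, h2, h3, ← integral_const_mul, ← integral_const_mul, ← integral_add]
    · exact integral_congr_ae (Eventually.of_forall fun z => by beta_reduce; ring)
    · exact integrable_sphere_of_continuous
        (cφ.mul (continuous_const.mul ((continuous_bub_rpow hx _).sub cb)))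
    · exact integrable_sphere_of_continuous (continuous_const.mul (cφ.mul cb))

/-- The spectral gap of the linearized boundary problem at a bubble, obtained from the one at the
constant function by conformal invariance. -/
lemma exists_gap_bub (hn : 3 ≤ n) : ∃ C : ℝ, 0 ≤ C ∧ ∀ (x : Eu n), ‖x‖ < 1 → ∀ u : H1 n,
    (gam n + 2) * ∫ z : Sph n, bub x z ^ (tau n - 1) * trace u z ^ 2 ∂(sphMeasure n) ≤
      energy u + C * ((∫ z : Sph n, bub x z ^ tau n * trace u z ∂(sphMeasure n)) ^ 2
        + ∑ i, (∫ z : Sph n, bub x z ^ tau n * mob x z i * trace u z ∂(sphMeasure n)) ^ 2) := by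
  have hA := sphArea_pos (by omega : 0 < n)
  have hB := ballVol_pos (n := n)
  refine ⟨2 / sphArea n + 1 / ballVol n, by positivity, fun x hx u => ?_⟩
  have cw := continuous_bub_rpow hx
  refine H1.induction (P := fun T : Triple n =>
    (gam n + 2) * ∫ z : Sph n, bub x z ^ (tau n - 1) * T.2.2 z ^ 2 ∂(sphMeasure n) ≤
      pairing T T + (2 / sphArea n + 1 / ballVol n) *
        ((∫ z : Sph n, bub x z ^ tau n * T.2.2 z ∂(sphMeasure n)) ^ 2
        + ∑ i, (∫ z : Sph n, bub x z ^ tau n * mob x z i * T.2.2 z ∂(sphMeasure n)) ^ 2))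
    ?_ ?_ u |>.trans_eq (by rw [energy_eq_pairing]; rfl)
  · refine isClosed_le ?_ (.add ?_ (continuous_const.mul (.add ?_ (continuous_finsetSum _
      fun i _ => ?_))))
    · exact continuous_const.mul ((continuous_integral_mul_sq
        (memLp_sphere_of_continuous (cw _) _)).comp continuous_snd.snd)
    · exact continuous_pairing_self
    · exact ((continuous_integral_mul
        (memLp_sphere_of_continuous (cw _) _)).comp continuous_snd.snd).pow 2
    · exact ((continuous_integral_mul (memLp_sphere_of_continuous
        ((cw _).mul (continuous_mob_apply_sphere hx i)) _)).comp continuous_snd.snd).pow 2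
  · intro φ hφ
    have hφ1 := hφ.c1OnBall
    have htr := trace_ofSmooth hφ
    -- the inequality for `φ` at `bub x` is `steklov_gap` for the pull-back of `φ`
    set f : Eu n → ℝ := fun z => bub x z * φ (mob x z) with hf
    have hf1 : C1OnBall f := (smoothOnBall_bub hx).c1OnBall.mul (hφ1.comp_mob hx)
    have hE : energyOf f = energyOf φ := energyOf_bub_mul_comp_mob hn hx hφ1
    have hgap := steklov_gap (by omega : 0 < n) hf1
    have cφ := hφ.continuousOn.mono sphere_subset_closedBall
    have cb : ∀ s : ℝ, ContinuousOn (fun z => bub x z ^ s) (sphere 0 1) := fun s =>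
      ((continuousOn_bub hx).mono sphere_subset_closedBall).rpow_const fun z hz =>
        Or.inl (bub_pos hx (mem_sphere_zero_iff_norm.1 hz).le).ne'
    have hbmob : ∀ (z : Sph n) (s : ℝ), bub x (mob x z) ^ s = bub x z ^ (-s) := fun z s => by
      rw [bub_mob_self hx (by simp), Real.inv_rpow (bub_pos_sphere hx z).le,
        Real.rpow_neg (bub_pos_sphere hx z).le]
    have e1 : ∫ z : Sph n, bub x z ^ (tau n - 1) * trace (ofSmooth φ hφ) z ^ 2 ∂(sphMeasure n)
        = ∫ z : Sph n, f z ^ 2 ∂(sphMeasure n) := by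
      rw [integral_congr_ae (g := fun z : Sph n => bub x z ^ (tau n - 1) * φ z ^ 2)
        (by filter_upwards [htr] with z hz; rw [hz]),
        ← integral_sphere_bub_rpow hn hx
          (g := fun z => bub x z ^ (tau n - 1) * φ z ^ 2) ((cb _).mul (cφ.pow 2))]
      refine integral_congr_ae (Eventually.of_forall fun z => ?_)
      simp only [hf, hbmob]
      rw [← mul_assoc, ← Real.rpow_add (bub_pos_sphere hx z),
        show tau n + 1 + -(tau n - 1) = 2 by ring, Real.rpow_two]
      ring
    have e2 : ∫ z : Sph n, bub x z ^ tau n * trace (ofSmooth φ hφ) z ∂(sphMeasure n)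
        = ∫ z : Sph n, f z ∂(sphMeasure n) := by
      rw [integral_congr_ae (g := fun z : Sph n => bub x z ^ tau n * φ z)
        (by filter_upwards [htr] with z hz; rw [hz]),
        ← integral_sphere_bub_rpow hn hx
          (g := fun z => bub x z ^ tau n * φ z) ((cb _).mul cφ)]
      refine integral_congr_ae (Eventually.of_forall fun z => ?_)
      simp only [hf, hbmob]
      rw [← mul_assoc, ← Real.rpow_add (bub_pos_sphere hx z),
        show tau n + 1 + -tau n = 1 by ring, Real.rpow_one]
    have e3 : ∀ i, ∫ z : Sph n, bub x z ^ tau n * mob x z i * trace (ofSmooth φ hφ) z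
        ∂(sphMeasure n) = ∫ z : Sph n, (z : Eu n) i * f z ∂(sphMeasure n) := by
      intro i
      rw [integral_congr_ae (g := fun z : Sph n => bub x z ^ tau n * mob x z i * φ z)
        (by filter_upwards [htr] with z hz; rw [hz]),
        ← integral_sphere_bub_rpow hn hx
          (g := fun z => bub x z ^ tau n * mob x z i * φ z) (((cb _).mul
          ((continuousOn_mob_apply hx i).mono sphere_subset_closedBall)).mul cφ)]
      refine integral_congr_ae (Eventually.of_forall fun z => ?_)
      simp only [hf, hbmob]
      rw [mob_mob hx (by simp), ← mul_assoc, ← mul_assoc, ← Real.rpow_add (bub_pos_sphere hx z),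
        show tau n + 1 + -tau n = 1 by ring, Real.rpow_one]
      ring
    show (gam n + 2) * ∫ z : Sph n, bub x z ^ (tau n - 1) * trace (ofSmooth φ hφ) z ^ 2
      ∂(sphMeasure n) ≤ pairing (ofSmooth φ hφ : Triple n) (ofSmooth φ hφ : Triple n) + _ *
        ((∫ z : Sph n, bub x z ^ tau n * trace (ofSmooth φ hφ) z ∂(sphMeasure n)) ^ 2 +
        ∑ i, (∫ z : Sph n, bub x z ^ tau n * mob x z i * trace (ofSmooth φ hφ) z
          ∂(sphMeasure n)) ^ 2)
    rw [← energy_eq_pairing, energy_ofSmooth, ← hE, e1, e2]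
    simp only [e3]
    rw [energyOf, integral_const_mul]
    have s0 : 0 ≤ ∑ i, (∫ z : Sph n, (z : Eu n) i * f z ∂(sphMeasure n)) ^ 2 :=
      Finset.sum_nonneg fun _ _ => sq_nonneg _
    set S := ∑ i, (∫ z : Sph n, (z : Eu n) i * f z ∂(sphMeasure n)) ^ 2
    set I := ∫ z : Sph n, f z ∂(sphMeasure n)
    have h1 : (2 / sphArea n + 1 / ballVol n) * (I ^ 2 + S) =
        2 * (I ^ 2 / sphArea n) + S / ballVol n + (I ^ 2 / ballVol n + 2 * (S / sphArea n)) := by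
      ring
    have h2 : 0 ≤ I ^ 2 / ballVol n + 2 * (S / sphArea n) := by positivity
    linarith

end Bubbles

/-! ### Expansion of the functional near the bubbles -/

section Elementary

/-- A power above one is negligible against the identity near zero. -/
lemma exists_mul_rpow_le {s : ℝ} (hs : 1 < s) {C c : ℝ} (hC : 0 ≤ C) (hc : 0 < c) :
    ∃ e₀ : ℝ, 0 < e₀ ∧ ∀ e, 0 ≤ e → e ≤ e₀ → C * e ^ s ≤ c * e := by
  refine ⟨(c / (C + 1)) ^ (1 / (s - 1)), by positivity, fun e he h => ?_⟩
  rcases he.eq_or_lt with rfl | he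
  · rw [Real.zero_rpow (by linarith)]; simp
  have h1 : e ^ (s - 1) ≤ c / (C + 1) := by
    calc e ^ (s - 1) ≤ ((c / (C + 1)) ^ (1 / (s - 1))) ^ (s - 1) :=
          Real.rpow_le_rpow he.le h (by linarith)
      _ = c / (C + 1) := by
          rw [← Real.rpow_mul (by positivity), one_div_mul_cancel (by linarith), Real.rpow_one]
  rw [le_div_iff₀ (by linarith)] at h1
  have h2 : e ^ s = e ^ (s - 1) * e := by
    rw [← Real.rpow_add_one he.ne']; ring_nf
  have h3 : 0 ≤ e ^ (s - 1) := Real.rpow_nonneg he.le _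
  rw [h2, ← mul_assoc]
  exact mul_le_mul_of_nonneg_right (by linarith) he.le

lemma add_rpow_le {a b q : ℝ} (ha : 0 ≤ a) (hb : 0 ≤ b) (hq : 0 ≤ q) :
    (a + b) ^ q ≤ 2 ^ q * (a ^ q + b ^ q) := by
  have ha' := Real.rpow_nonneg ha q
  have hb' := Real.rpow_nonneg hb q
  have h2 : (0 : ℝ) ≤ 2 ^ q := by positivity
  rcases le_total a b with h | h
  · calc (a + b) ^ q ≤ (2 * b) ^ q := Real.rpow_le_rpow (by linarith) (by linarith) hq
      _ = 2 ^ q * b ^ q := Real.mul_rpow (by norm_num) hb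
      _ ≤ _ := mul_le_mul_of_nonneg_left (by linarith) h2
  · calc (a + b) ^ q ≤ (2 * a) ^ q := Real.rpow_le_rpow (by linarith) (by linarith) hq
      _ = 2 ^ q * a ^ q := Real.mul_rpow (by norm_num) ha
      _ ≤ _ := mul_le_mul_of_nonneg_left (by linarith) h2

lemma one_sub_rpow_le {e p : ℝ} (he : 0 ≤ e) (he1 : e ≤ 1) (hp : 0 ≤ p) :
    (1 - e) ^ p ≤ 1 - p * e + (p * e) ^ 2 := by
  have hx : 0 ≤ p * e := mul_nonneg hp he
  have h1 : (1 - e) ^ p ≤ Real.exp (-(p * e)) := by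
    calc (1 - e) ^ p ≤ Real.exp (-e) ^ p :=
          Real.rpow_le_rpow (by linarith) (by linarith [Real.add_one_le_exp (-e)]) hp
      _ = Real.exp (-(p * e)) := by rw [← Real.exp_mul]; ring_nf
  refine h1.trans ?_
  rw [Real.exp_neg, inv_le_iff_one_le_mul₀ (Real.exp_pos _)]
  have h2 := Real.add_one_le_exp (p * e)
  have h3 : 0 ≤ 1 - p * e + (p * e) ^ 2 := by nlinarith [sq_nonneg (p * e - 1)]
  have h4 : 0 ≤ (p * e) ^ 3 := by positivity
  nlinarith [mul_le_mul_of_nonneg_left h2 h3]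

/-- Second order expansion of a power, from above, up to a power. -/
lemma exists_one_add_rpow_le {q ε : ℝ} (hq : 2 < q) (hε : 0 < ε) : ∃ C : ℝ, 0 ≤ C ∧
    ∀ s : ℝ, -1 ≤ s →
      (1 + s) ^ q ≤ 1 + q * s + q * (q - 1) / 2 * (1 + ε) * s ^ 2 + C * |s| ^ q := by
  set δ : ℝ := (1 + ε) ^ (1 / (q - 2)) - 1 with hδ
  have hδ0 : 0 < δ := by
    have := Real.one_lt_rpow (x := 1 + ε) (z := 1 / (q - 2)) (by linarith)
      (one_div_pos.2 (by linarith))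
    linarith
  -- the second derivative of the difference is non-negative up to `δ`, and beyond `δ` the power
  -- `|s| ^ q` dominates
  set φ : ℝ → ℝ := fun s => 1 + q * s + q * (q - 1) / 2 * (1 + ε) * s ^ 2 - (1 + s) ^ q with hφ
  set φ' : ℝ → ℝ := fun s => q + q * (q - 1) * (1 + ε) * s - q * (1 + s) ^ (q - 1) with hφ'
  have d1 : ∀ s, HasDerivAt φ (φ' s) s := by
    intro s
    have h1 := ((hasDerivAt_id s).const_add 1).rpow_const (p := q) (Or.inr (by linarith))
    have h2 := (((hasDerivAt_id s).const_mul q).const_add 1).add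
      (((hasDerivAt_id s).pow 2).const_mul (q * (q - 1) / 2 * (1 + ε)))
    refine (h2.sub h1).congr_deriv ?_
    simp [hφ']
    ring
  have d2 : ∀ s, HasDerivAt φ' (q * (q - 1) * ((1 + ε) - (1 + s) ^ (q - 2))) s := by
    intro s
    have h1 := (((hasDerivAt_id s).const_add 1).rpow_const (p := q - 1)
      (Or.inr (by linarith))).const_mul q
    have h2 := ((hasDerivAt_id s).const_mul (q * (q - 1) * (1 + ε))).const_add q
    refine (h2.sub h1).congr_deriv ?_
    rw [show q - 1 - 1 = q - 2 by ring]
    simp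
    ring
  have hmono : MonotoneOn φ' (Icc (-1) δ) := by
    refine monotoneOn_of_deriv_nonneg (convex_Icc _ _)
      (fun s _ => (d2 s).continuousAt.continuousWithinAt)
      (fun s _ => (d2 s).differentiableAt.differentiableWithinAt) fun s hs => ?_
    rw [interior_Icc] at hs
    rw [(d2 s).deriv]
    have h1 : (1 + s) ^ (q - 2) ≤ 1 + ε := by
      calc (1 + s) ^ (q - 2) ≤ ((1 + ε) ^ (1 / (q - 2))) ^ (q - 2) :=
            Real.rpow_le_rpow (by linarith [hs.1]) (by linarith [hs.2]) (by linarith)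
        _ = 1 + ε := by
            rw [← Real.rpow_mul (by linarith), one_div_mul_cancel (by linarith), Real.rpow_one]
    exact mul_nonneg (mul_nonneg (by linarith) (by linarith)) (by linarith)
  have z1 : φ 0 = 0 := by simp [hφ]
  have z2 : φ' 0 = 0 := by simp [hφ']
  have h0 : (0 : ℝ) ∈ Icc (-1) δ := ⟨by norm_num, hδ0.le⟩
  have hφ0 : ∀ s ∈ Icc (-1) δ, 0 ≤ φ s := by
    intro s hs
    rcases le_total 0 s with h | h
    · have : MonotoneOn φ (Icc 0 δ) := by
        refine monotoneOn_of_deriv_nonneg (convex_Icc _ _)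
          (fun s _ => (d1 s).continuousAt.continuousWithinAt)
          (fun s _ => (d1 s).differentiableAt.differentiableWithinAt) fun r hr => ?_
        rw [interior_Icc] at hr
        rw [(d1 r).deriv, ← z2]
        exact hmono h0 ⟨by linarith [hr.1], hr.2.le⟩ hr.1.le
      rw [← z1]
      exact this ⟨le_rfl, hδ0.le⟩ ⟨h, hs.2⟩ h
    · have : AntitoneOn φ (Icc (-1) 0) := by
        refine antitoneOn_of_deriv_nonpos (convex_Icc _ _)
          (fun s _ => (d1 s).continuousAt.continuousWithinAt)
          (fun s _ => (d1 s).differentiableAt.differentiableWithinAt) fun r hr => ?_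
        rw [interior_Icc] at hr
        rw [(d1 r).deriv, ← z2]
        exact hmono ⟨hr.1.le, by linarith [hr.2]⟩ h0 hr.2.le
      rw [← z1]
      exact this ⟨hs.1, h⟩ ⟨by norm_num, le_rfl⟩ h
  refine ⟨(1 / δ + 1) ^ q, by positivity, fun s hs => ?_⟩
  have hA : 0 ≤ q * (q - 1) / 2 * (1 + ε) * s ^ 2 :=
    mul_nonneg (mul_nonneg (div_nonneg (mul_nonneg (by linarith) (by linarith)) (by norm_num))
      (by linarith)) (sq_nonneg _)
  rcases le_or_gt s δ with h | h
  · have h1 := hφ0 s ⟨hs, h⟩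
    have h2 : 0 ≤ (1 / δ + 1) ^ q * |s| ^ q := by positivity
    simp only [hφ] at h1
    linarith
  · have hs0 : 0 < s := hδ0.trans h
    have h1 : (1 + s) ^ q ≤ (1 / δ + 1) ^ q * |s| ^ q := by
      rw [abs_of_pos hs0, ← Real.mul_rpow (by positivity) hs0.le]
      refine Real.rpow_le_rpow (by linarith) ?_ (by linarith)
      have : 1 ≤ 1 / δ * s := by
        rw [one_div_mul_eq_div, le_div_iff₀ hδ0]; linarith
      linarith
    have h2 : 0 ≤ q * s := mul_nonneg (by linarith) hs0.le
    linarith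

lemma exists_add_rpow_le {q ε : ℝ} (hq : 2 < q) (hε : 0 < ε) : ∃ C : ℝ, 0 ≤ C ∧
    ∀ a v : ℝ, 0 < a → 0 ≤ a + v → (a + v) ^ q ≤ a ^ q + q * (a ^ (q - 1) * v)
      + q * (q - 1) / 2 * (1 + ε) * (a ^ (q - 2) * v ^ 2) + C * |v| ^ q := by
  obtain ⟨C, hC, h⟩ := exists_one_add_rpow_le hq hε
  refine ⟨C, hC, fun a v ha hav => ?_⟩
  have h1 := h (v / a) (by rw [le_div_iff₀ ha]; linarith)
  have haq : 0 < a ^ q := Real.rpow_pos_of_pos ha q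
  have h2 := mul_le_mul_of_nonneg_left h1 haq.le
  have e1 : a ^ q * (1 + v / a) ^ q = (a + v) ^ q := by
    rw [← Real.mul_rpow ha.le]
    · congr 1; field_simp
    · rw [show 1 + v / a = (a + v) / a by field_simp]; positivity
  have e2 : a ^ (q - 1) = a ^ q / a := Real.rpow_sub_one ha.ne' q
  have e3 : a ^ (q - 2) = a ^ q / a ^ 2 := by
    rw [Real.rpow_sub ha, Real.rpow_two]
  have e4 : a ^ q * |v / a| ^ q = |v| ^ q := by
    rw [← Real.mul_rpow ha.le (abs_nonneg _), abs_div, abs_of_pos ha, mul_div_cancel₀ _ ha.ne']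
  rw [e1] at h2
  rw [e2, e3, ← e4]
  refine h2.trans_eq ?_
  field_simp

end Elementary

section Remainder

variable {n : ℕ} {x : Eu n}

/-- The coefficient of the projection of `u` to the line of the bubble `bub x`. -/
def coef (hx : ‖x‖ < 1) (u : H1 n) : ℝ := pairing (u : Triple n) (bubH hx) / (gam n * sphArea n)

/-- The component of `u` orthogonal to the bubble `bub x`. -/
def remainder (hx : ‖x‖ < 1) (u : H1 n) : H1 n := u - coef hx u • bubH hx

lemma gam_mul_sphArea_pos (hn : 3 ≤ n) : 0 < gam n * sphArea n :=
  mul_pos (gam_pos hn) (sphArea_pos (by omega))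

lemma coef_mul (hn : 3 ≤ n) (hx : ‖x‖ < 1) (u : H1 n) :
    coef hx u * (gam n * sphArea n) = pairing (u : Triple n) (bubH hx) :=
  div_mul_cancel₀ _ (gam_mul_sphArea_pos hn).ne'

lemma coef_nonneg (hn : 3 ≤ n) (hx : ‖x‖ < 1) {u : H1 n} (hu : u ∈ constraintSet n) :
    0 ≤ coef hx u := by
  refine div_nonneg ?_ (gam_mul_sphArea_pos hn).le
  rw [pairing_bubH hn]
  refine mul_nonneg (gam_pos hn).le (integral_nonneg_of_ae ?_)
  filter_upwards [hu.2.2] with z hz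
  exact mul_nonneg (Real.rpow_nonneg (bub_pos_sphere hx z).le _) hz

lemma energy_remainder (hn : 3 ≤ n) (hx : ‖x‖ < 1) {u : H1 n} (hu : u ∈ constraintSet n) :
    energy (remainder hx u) = gam n * sphArea n * (1 - coef hx u ^ 2) := by
  rw [remainder, energy_sub_smul, ← coef_mul hn, energy_bubH hn, hu.1]
  ring

lemma coef_le_one (hn : 3 ≤ n) (hx : ‖x‖ < 1) {u : H1 n} (hu : u ∈ constraintSet n) :
    coef hx u ≤ 1 := by
  have h1 := energy_remainder hn hx hu
  have h2 := energy_nonneg hn (remainder hx u)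
  have h3 := gam_mul_sphArea_pos hn
  rw [h1] at h2
  have := nonneg_of_mul_nonneg_right h2 h3
  nlinarith

lemma trace_sub_smul_bubH (hx : ‖x‖ < 1) (u : H1 n) (t : ℝ) :
    trace (u - t • bubH hx) =ᵐ[sphMeasure n] fun z => trace u z - t * bub x z := by
  have h1 := Lp.coeFn_sub (u : Triple n).2.2 (t • (bubH hx : Triple n).2.2)
  have h2 := Lp.coeFn_smul t (bubH hx : Triple n).2.2
  filter_upwards [h1, h2, trace_ofSmooth (smoothOnBall_bub hx)] with z h1 h2 h3
  have e : (bubH hx : Triple n).2.2 z = bub x z := h3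
  have : trace (u - t • bubH hx) z = ((u : Triple n).2.2 - t • (bubH hx : Triple n).2.2) z := rfl
  rw [this, h1, Pi.sub_apply, h2, Pi.smul_apply, e]
  rfl

lemma funVal_sub_smul_bubH (hx : ‖x‖ < 1) (u : H1 n) (t : ℝ) :
    funVal (u - t • bubH hx) =ᵐ[ballMeasure n] fun z => funVal u z - t * bub x z := by
  have h1 := Lp.coeFn_sub (u : Triple n).1 (t • (bubH hx : Triple n).1)
  have h2 := Lp.coeFn_smul t (bubH hx : Triple n).1
  filter_upwards [h1, h2, funVal_ofSmooth (smoothOnBall_bub hx)] with z h1 h2 h3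
  have e : (bubH hx : Triple n).1 z = bub x z := h3
  have : funVal (u - t • bubH hx) z = ((u : Triple n).1 - t • (bubH hx : Triple n).1) z := rfl
  rw [this, h1, Pi.sub_apply, h2, Pi.smul_apply, e]
  rfl

lemma memLp_trace (u : H1 n) : MemLp (trace u) 2 (sphMeasure n) := Lp.memLp _

lemma integrable_mul_trace {w : Sph n → ℝ} (hw : Continuous w) (u : H1 n) :
    Integrable (fun z => w z * trace u z) (sphMeasure n) :=
  (memLp_sphere_of_continuous hw 2).integrable_mul (memLp_trace u)

lemma integrable_mul_trace_sq {w : Sph n → ℝ} (hw : Continuous w) (u : H1 n) :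
    Integrable (fun z => w z * trace u z ^ 2) (sphMeasure n) := by
  obtain ⟨C, hC⟩ := isCompact_univ.exists_bound_of_continuousOn hw.continuousOn
  exact (memLp_trace u).integrable_sq.bdd_mul hw.aestronglyMeasurable
    (Eventually.of_forall fun z => hC z (mem_univ z))

lemma integral_bub_mul_remainder (hn : 3 ≤ n) (hx : ‖x‖ < 1) (u : H1 n) :
    ∫ z : Sph n, bub x z ^ tau n * trace (remainder hx u) z ∂(sphMeasure n) = 0 := by
  have h1 := pairing_bubH hn hx (remainder hx u)
  have h2 : pairing (remainder hx u : Triple n) (bubH hx) = 0 := by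
    have : (remainder hx u : Triple n) = (u : Triple n) + (-coef hx u) • (bubH hx : Triple n) := by
      simp [remainder, sub_eq_add_neg]
    rw [this, pairing_add_left, pairing_smul_left, ← energy_eq_pairing, energy_bubH hn,
      ← coef_mul hn]
    ring
  rw [h2] at h1
  exact (mul_eq_zero.1 h1.symm).resolve_left (gam_pos hn).ne'

lemma integral_coord_sphere (hn : 0 < n) (v : Eu n) :
    ∫ z : Sph n, ⟪(z : Eu n), v⟫_ℝ ∂(sphMeasure n) = 0 := by
  have h := integral_fderiv_eq_integral_sphere hn (f := fun _ : Eu n => (1 : ℝ))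
    ⟨univ, isOpen_univ, subset_univ _, contDiffOn_const⟩ v
  simpa using h.symm

lemma integral_bub_mul_mob_remainder (hn : 3 ≤ n) (hx : ‖x‖ < 1) (u : H1 n) (i : Fin n) :
    ∫ z : Sph n, bub x z ^ tau n * mob x z i * trace (remainder hx u) z ∂(sphMeasure n)
      = ∫ z : Sph n, bub x z ^ tau n * mob x z i * trace u z ∂(sphMeasure n) := by
  have cw : Continuous fun z : Sph n => bub x z ^ tau n * mob x z i :=
    (continuous_bub_rpow hx (tau n)).mul (continuous_mob_apply_sphere hx i)
  have h0 : ∫ z : Sph n, bub x z ^ (tau n + 1) * mob x z i ∂(sphMeasure n) = 0 := by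
    rw [integral_sphere_bub_rpow hn hx (g := fun z => z i) (by fun_prop)]
    have := integral_coord_sphere (by omega : 0 < n) (EuclideanSpace.single i (1 : ℝ))
    simpa only [inner_single_one] using this
  have h1 : ∫ z : Sph n, bub x z ^ tau n * mob x z i * trace (remainder hx u) z ∂(sphMeasure n)
      = ∫ z : Sph n, (bub x z ^ tau n * mob x z i * trace u z
        - coef hx u * (bub x z ^ (tau n + 1) * mob x z i)) ∂(sphMeasure n) := by
    refine integral_congr_ae ?_
    filter_upwards [trace_sub_smul_bubH hx u (coef hx u)] with z hz
    rw [remainder, hz, Real.rpow_add_one (bub_pos_sphere hx z).ne']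
    ring
  rw [h1, integral_sub (integrable_mul_trace cw u), integral_const_mul, h0]
  · ring
  · exact (integrable_sphere_of_continuous
      ((continuous_bub_rpow hx _).mul (continuous_mob_apply_sphere hx i))).const_mul _

/-- The size of the components of `u` along the derivatives of the bubbles. -/
def drift (x : Eu n) (u : H1 n) : ℝ :=
  ∑ i, (∫ z : Sph n, bub x z ^ tau n * mob x z i * trace u z ∂(sphMeasure n)) ^ 2

end Remainder

section Expansion

variable {n : ℕ} {x : Eu n}

lemma integrable_trace_rpow (hn : 3 ≤ n) {u : H1 n} (hu : u ∈ constraintSet n) :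
    Integrable (fun z => trace u z ^ (tau n + 1)) (sphMeasure n) := by
  obtain ⟨C, -, h⟩ := exists_sobolev hn
  refine (h u).2.1.congr ?_
  filter_upwards [hu.2.2] with z hz
  rw [abs_of_nonneg hz]

/-- The expansion of the critical boundary integral near a bubble: the quadratic loss in the
coefficient of the bubble beats the quadratic gain from the remainder, because of the spectral
gap. -/
lemma exists_integral_rpow_le (hn : 3 ≤ n) : ∃ c C e₀ : ℝ, 0 < c ∧ 0 ≤ C ∧ 0 < e₀ ∧
    ∀ (x : Eu n) (hx : ‖x‖ < 1), ∀ u ∈ constraintSet n, energy (remainder hx u) ≤ e₀ →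
      1 / 2 ≤ coef hx u ∧
      ∫ z, trace u z ^ (tau n + 1) ∂(sphMeasure n) ≤
        sphArea n - c * energy (remainder hx u) + C * drift x u := by
  obtain ⟨C₁, hC₁, hgap⟩ := exists_gap_bub hn
  obtain ⟨C₂, hC₂, hsob⟩ := exists_sobolev hn
  have hγ := gam_pos hn
  have hτ := one_lt_tau hn
  have hA := sphArea_pos (by omega : 0 < n)
  have hE := gam_mul_sphArea_pos hn
  set E₁ := gam n * sphArea n with hE₁
  set q := tau n + 1 with hq
  have hε : 0 < 1 / (2 * (gam n + 1)) := by positivity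
  obtain ⟨C₃, hC₃, hpt⟩ := exists_add_rpow_le (by linarith : 2 < q) hε
  -- `A` is the coefficient of the quadratic gain from the remainder; the gap divides it by
  -- `gam n + 2`, which leaves less than the loss `q / (2 * gam n)` from the coefficient `t`
  set A := q * (q - 1) / 2 * (1 + 1 / (2 * (gam n + 1))) with hAdef
  have hA0 : 0 < A := by
    have : 0 < q - 1 := by linarith
    have : 0 < q := by linarith
    positivity
  set c₀ := q / (8 * gam n * (gam n + 2)) with hc₀
  have hc₀0 : 0 < c₀ := by
    have : 0 < q := by linarith
    positivity
  have hAgap : A / (gam n + 2) = q / (2 * gam n) - 2 * c₀ := by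
    have h1 : q - 1 = (gam n + 1) / gam n := by
      rw [hq, add_sub_cancel_right, eq_div_iff hγ.ne', tau_mul_gam hn]
    rw [hAdef, h1, hc₀]
    field_simp
    ring
  obtain ⟨e₁, he₁, hsm₁⟩ := exists_mul_rpow_le (s := 2) (by norm_num)
    (C := sphArea n * (q / 2 / E₁) ^ 2) (by positivity) (half_pos hc₀0)
  obtain ⟨e₂, he₂, hsm₂⟩ := exists_mul_rpow_le (s := q / 2) (by linarith)
    (C := C₃ * C₂) (by positivity) (half_pos hc₀0)
  refine ⟨c₀, A * C₁ / (gam n + 2), min (min e₁ e₂) (3 / 4 * E₁), hc₀0, by positivity,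
    by positivity, fun x hx u hu he => ?_⟩
  set t := coef hx u with ht
  set v := remainder hx u with hv
  set e := energy v with hedef
  have he0 : 0 ≤ e := energy_nonneg hn v
  have hee : e = E₁ * (1 - t ^ 2) := energy_remainder hn hx hu
  have ht0 : 0 ≤ t := coef_nonneg hn hx hu
  have ht1 : t ≤ 1 := coef_le_one hn hx hu
  have he1 : e ≤ e₁ := he.trans ((min_le_left _ _).trans (min_le_left _ _))
  have he2 : e ≤ e₂ := he.trans ((min_le_left _ _).trans (min_le_right _ _))
  have he3 : e ≤ 3 / 4 * E₁ := he.trans (min_le_right _ _)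
  have htsq : 1 - t ^ 2 = e / E₁ := by rw [hee]; field_simp
  have ht2 : 1 / 2 ≤ t := by
    have : 1 - t ^ 2 ≤ 3 / 4 := by rw [htsq, div_le_iff₀ hE]; exact he3
    nlinarith
  refine ⟨ht2, ?_⟩
  have htq : t ^ q ≤ 1 - q / 2 * (e / E₁) + (q / 2 * (e / E₁)) ^ 2 := by
    have h1 : t ^ q = (1 - e / E₁) ^ (q / 2) := by
      rw [← htsq, show 1 - (1 - t ^ 2) = t ^ (2 : ℝ) by rw [Real.rpow_two]; ring,
        ← Real.rpow_mul ht0]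
      congr 1; ring
    rw [h1]
    refine one_sub_rpow_le (by positivity) ?_ (by linarith)
    rw [← htsq]
    nlinarith
  have hb := bub_pos_sphere hx
  have hvtr : trace v =ᵐ[sphMeasure n] fun z => trace u z - t * bub x z :=
    trace_sub_smul_bubH hx u t
  -- the pointwise expansion
  have hpoint : ∀ᵐ z : Sph n ∂(sphMeasure n), trace u z ^ q ≤ t ^ q * bub x z ^ q
      + q * t ^ tau n * (bub x z ^ tau n * trace v z)
      + A * (bub x z ^ (tau n - 1) * trace v z ^ 2) + C₃ * |trace v z| ^ q := by
    filter_upwards [hvtr, hu.2.2] with z hz hz0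
    have ha : 0 < t * bub x z := mul_pos (by linarith) (hb z)
    have h1 := hpt (t * bub x z) (trace v z) ha (by rw [hz]; linarith)
    have e1 : t * bub x z + trace v z = trace u z := by rw [hz]; ring
    have e2 : q - 1 = tau n := by rw [hq]; ring
    have e3 : q - 2 = tau n - 1 := by rw [hq]; ring
    rw [e1, e2, e3, Real.mul_rpow ht0 (hb z).le, Real.mul_rpow ht0 (hb z).le,
      Real.mul_rpow ht0 (hb z).le] at h1
    have h2 : t ^ (tau n - 1) ≤ 1 := Real.rpow_le_one ht0 ht1 (by linarith)
    have h3 : A * (t ^ (tau n - 1) * bub x z ^ (tau n - 1) * trace v z ^ 2) ≤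
        A * (bub x z ^ (tau n - 1) * trace v z ^ 2) := by
      refine mul_le_mul_of_nonneg_left ?_ hA0.le
      have h4 : 0 ≤ bub x z ^ (tau n - 1) * trace v z ^ 2 :=
        mul_nonneg (Real.rpow_nonneg (hb z).le _) (sq_nonneg _)
      rw [mul_assoc]
      exact mul_le_of_le_one_left h4 h2
    refine h1.trans ?_
    rw [mul_assoc q, ← mul_assoc (t ^ tau n)]
    gcongr
  have i1 : Integrable (fun z : Sph n => t ^ q * bub x z ^ q) (sphMeasure n) :=
    (integrable_sphere_of_continuous (continuous_bub_rpow hx q)).const_mul _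
  have i2 : Integrable (fun z : Sph n => q * t ^ tau n * (bub x z ^ tau n * trace v z))
      (sphMeasure n) := (integrable_mul_trace (continuous_bub_rpow hx _) v).const_mul _
  have i3 : Integrable (fun z : Sph n => A * (bub x z ^ (tau n - 1) * trace v z ^ 2))
      (sphMeasure n) := (integrable_mul_trace_sq (continuous_bub_rpow hx _) v).const_mul _
  have i4 : Integrable (fun z : Sph n => C₃ * |trace v z| ^ q) (sphMeasure n) :=
    (hsob v).2.1.const_mul _
  have i12 : Integrable (fun z : Sph n => t ^ q * bub x z ^ q
      + q * t ^ tau n * (bub x z ^ tau n * trace v z)) (sphMeasure n) := i1.add i2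
  have i123 : Integrable (fun z : Sph n => t ^ q * bub x z ^ q
      + q * t ^ tau n * (bub x z ^ tau n * trace v z)
      + A * (bub x z ^ (tau n - 1) * trace v z ^ 2)) (sphMeasure n) := i12.add i3
  have hint := integral_mono_ae (integrable_trace_rpow hn hu) (i123.add i4) hpoint
  have hsum : ∫ z : Sph n, (t ^ q * bub x z ^ q + q * t ^ tau n * (bub x z ^ tau n * trace v z)
      + A * (bub x z ^ (tau n - 1) * trace v z ^ 2) + C₃ * |trace v z| ^ q) ∂(sphMeasure n)
      = t ^ q * sphArea n + A * (∫ z : Sph n, bub x z ^ (tau n - 1) * trace v z ^ 2 ∂(sphMeasure n))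
        + C₃ * ∫ z : Sph n, |trace v z| ^ q ∂(sphMeasure n) := by
    rw [integral_add i123 i4, integral_add i12 i3, integral_add i1 i2,
      integral_const_mul, integral_const_mul, integral_const_mul, integral_const_mul,
      integral_bub_rpow_sphere hn hx, integral_bub_mul_remainder hn hx u]
    ring
  have hg := hgap x hx v
  have hd : ∑ i, (∫ z : Sph n, bub x z ^ tau n * mob x z i * trace v z ∂(sphMeasure n)) ^ 2
      = drift x u := Finset.sum_congr rfl fun i _ => by
        rw [integral_bub_mul_mob_remainder hn hx u i]
  rw [integral_bub_mul_remainder hn hx u, hd] at hg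
  have hg' : A * ∫ z : Sph n, bub x z ^ (tau n - 1) * trace v z ^ 2 ∂(sphMeasure n) ≤
      (q / (2 * gam n) - 2 * c₀) * e + A * C₁ / (gam n + 2) * drift x u := by
    rw [← hAgap]
    have h1 : A / (gam n + 2) * ((gam n + 2) *
        ∫ z : Sph n, bub x z ^ (tau n - 1) * trace v z ^ 2 ∂(sphMeasure n)) ≤
        A / (gam n + 2) * (e + C₁ * (0 ^ 2 + drift x u)) :=
      mul_le_mul_of_nonneg_left hg (by positivity)
    have h2 : A / (gam n + 2) * ((gam n + 2) *
        ∫ z : Sph n, bub x z ^ (tau n - 1) * trace v z ^ 2 ∂(sphMeasure n)) =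
        A * ∫ z : Sph n, bub x z ^ (tau n - 1) * trace v z ^ 2 ∂(sphMeasure n) := by
      field_simp
    rw [h2] at h1
    refine h1.trans_eq ?_
    ring
  have hs := mul_le_mul_of_nonneg_left (hsob v).2.2 hC₃
  have hs1 := hsm₁ e he0 he1
  have hs2 := hsm₂ e he0 he2
  rw [Real.rpow_two] at hs1
  have htq' := mul_le_mul_of_nonneg_right htq hA.le
  have e5 : (1 - q / 2 * (e / E₁) + (q / 2 * (e / E₁)) ^ 2) * sphArea n =
      sphArea n - q / (2 * gam n) * e + sphArea n * (q / 2 / E₁) ^ 2 * e ^ 2 := by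
    rw [hE₁]
    field_simp
  rw [e5] at htq'
  have hint' := hint.trans_eq hsum
  rw [← mul_assoc] at hs
  have hs' : C₃ * ∫ z : Sph n, |trace v z| ^ q ∂(sphMeasure n) ≤ C₃ * C₂ * e ^ (q / 2) := hs
  linarith

lemma norm_sub_le_two (z : Sph n) (O : Sph n) : ‖(z : Eu n) - O‖ ≤ 2 := by
  calc ‖(z : Eu n) - O‖ ≤ ‖(z : Eu n)‖ + ‖(O : Eu n)‖ := norm_sub_le _ _
    _ = 2 := by simp; norm_num

lemma conf_ge (hx : ‖x‖ < 1) {z : Eu n} (hz : ‖z‖ ≤ 1) : (1 - ‖x‖ ^ 2) / 4 ≤ conf x z := by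
  rw [conf]
  refine div_le_div_of_nonneg_left (one_sub_norm_sq_pos hx).le (den_pos hx hz) (den_le.trans ?_)
  have : ‖x‖ * ‖z‖ ≤ 1 := by nlinarith [norm_nonneg x, norm_nonneg z]
  nlinarith [mul_nonneg (norm_nonneg x) (norm_nonneg z)]

/-- The involution `mob x` moves no point of the ball, except those near one point of the sphere,
much closer to `O` than `x` is. -/
lemma dist_mob_ge (hx : ‖x‖ < 1) {z : Eu n} (hz : ‖z‖ ≤ 1) (O : Sph n) :
    ‖x - O‖ / 2 * ‖z - mob x O‖ ≤ ‖mob x z - O‖ := by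
  have hO : ‖(O : Eu n)‖ = 1 := by simp
  have h1 := norm_mob_sub_mob_sq (den_pos hx hz).ne'
    (den_pos hx (norm_mob_eq hx hO).le).ne'
  have h2 : conf x O = (1 - ‖x‖ ^ 2) / ‖x - O‖ ^ 2 := by
    rw [conf, den_sphere hO, norm_sub_rev]
  rw [mob_mob hx hO.le, conf_mob_self hx hO.le, h2, inv_div] at h1
  refine abs_le_of_sq_le_sq' ?_ (norm_nonneg _) |>.2
  rw [h1, mul_pow]
  refine mul_le_mul_of_nonneg_right ?_ (sq_nonneg _)
  have h0 := one_sub_norm_sq_pos hx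
  calc (‖x - O‖ / 2) ^ 2 = (1 - ‖x‖ ^ 2) / 4 * (‖x - O‖ ^ 2 / (1 - ‖x‖ ^ 2)) := by
        field_simp; norm_num
    _ ≤ _ := mul_le_mul_of_nonneg_right (conf_ge hx hz) (by positivity)

/-- The mean of a power of the distance to a point of the sphere is bounded below uniformly in the
exponent; from Bernoulli's inequality for `(‖z - w‖ ^ 2) ^ (α / 2 + 1)` and `‖z - w‖ ≤ 2`. -/
lemma integral_norm_sub_rpow_ge (hn : 0 < n) {α : ℝ} (hα : 0 < α) {w : Eu n} (hw : ‖w‖ = 1) :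
    sphArea n / 4 ≤ ∫ z : Sph n, ‖(z : Eu n) - w‖ ^ α ∂(sphMeasure n) := by
  have h1 : ∀ z : Sph n, 1 / 4 * (1 + (α / 2 + 1) * (1 - 2 * ⟪(z : Eu n), w⟫_ℝ)) ≤
      ‖(z : Eu n) - w‖ ^ α := by
    intro z
    have hsq : ‖(z : Eu n) - w‖ ^ 2 = 2 - 2 * ⟪(z : Eu n), w⟫_ℝ := by
      rw [norm_sub_sq_real, hw]; simp; ring
    have hle : ‖(z : Eu n) - w‖ ≤ 2 := norm_sub_le_two z ⟨w, by simpa using hw⟩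
    have h2 := one_add_mul_self_le_rpow_one_add (s := ‖(z : Eu n) - w‖ ^ 2 - 1) (p := α / 2 + 1)
      (by linarith [sq_nonneg ‖(z : Eu n) - w‖]) (by linarith)
    rw [add_sub_cancel, ← Real.rpow_natCast, ← Real.rpow_mul (norm_nonneg _)] at h2
    have h3 : ‖(z : Eu n) - w‖ ^ (((2 : ℕ) : ℝ) * (α / 2 + 1)) ≤ 4 * ‖(z : Eu n) - w‖ ^ α := by
      rw [show ((2 : ℕ) : ℝ) * (α / 2 + 1) = α + 2 by push_cast; ring,
        Real.rpow_add_of_nonneg (norm_nonneg _) hα.le (by norm_num), Real.rpow_two, mul_comm]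
      refine mul_le_mul_of_nonneg_right ?_ (Real.rpow_nonneg (norm_nonneg _) _)
      nlinarith [norm_nonneg ((z : Eu n) - w)]
    rw [Real.rpow_natCast, hsq] at h2
    have h4 : 2 - 2 * ⟪(z : Eu n), w⟫_ℝ - 1 = 1 - 2 * ⟪(z : Eu n), w⟫_ℝ := by ring
    rw [h4] at h2
    linarith
  have c1 : Continuous fun z : Sph n => ‖(z : Eu n) - w‖ ^ α :=
    (by fun_prop : Continuous fun z : Sph n => ‖(z : Eu n) - w‖).rpow_const
      fun _ => Or.inr hα.le
  have c2 : Continuous fun z : Sph n => ⟪(z : Eu n), w⟫_ℝ := by fun_prop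
  have h2 := integral_mono (integrable_sphere_of_continuous (by fun_prop))
    (integrable_sphere_of_continuous c1) h1
  refine le_trans ?_ h2
  have h3 : ∫ z : Sph n, 1 / 4 * (1 + (α / 2 + 1) * (1 - 2 * ⟪(z : Eu n), w⟫_ℝ)) ∂(sphMeasure n)
      = 1 / 4 * (sphArea n * (1 + (α / 2 + 1))) := by
    have : ∀ z : Sph n, 1 / 4 * (1 + (α / 2 + 1) * (1 - 2 * ⟪(z : Eu n), w⟫_ℝ)) =
        1 / 4 * (1 + (α / 2 + 1)) - 1 / 2 * (α / 2 + 1) * ⟪(z : Eu n), w⟫_ℝ := fun z => by ring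
    simp only [this]
    rw [integral_sub (integrable_const _) ((integrable_sphere_of_continuous c2).const_mul _),
      integral_const_sphere, integral_const_mul, integral_coord_sphere hn]
    ring
  rw [h3]
  nlinarith [sphArea_pos hn]

/-- The loss caused by the weight `r ^ α` at a bubble that is concentrated away from `O` or not
sharply concentrated. -/
lemma rpow_dist_bub_ge (hn : 3 ≤ n) {α : ℝ} (hα : 0 < α) (hx : ‖x‖ < 1) (O : Sph n) :
    (1 / 2) ^ α * (sphArea n / 4) * ‖x - O‖ ^ α ≤
      ∫ z : Sph n, ‖(z : Eu n) - O‖ ^ α * bub x z ^ (tau n + 1) ∂(sphMeasure n) := by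
  have hmob : ContinuousOn (fun z => ‖mob x z - O‖ ^ α) (sphere 0 1) :=
    ((((continuousOn_mob hx).mono sphere_subset_closedBall).sub
      continuousOn_const).norm).rpow_const fun _ _ => Or.inr hα.le
  have h1 := integral_sphere_bub_rpow hn hx hmob
  have h2 : ∫ z : Sph n, ‖(z : Eu n) - O‖ ^ α * bub x z ^ (tau n + 1) ∂(sphMeasure n)
      = ∫ z : Sph n, ‖mob x z - O‖ ^ α ∂(sphMeasure n) := by
    rw [← h1]
    refine integral_congr_ae (Eventually.of_forall fun z => ?_)
    beta_reduce
    rw [mob_mob hx (by simp), mul_comm]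
  have hw : ‖mob x (O : Eu n)‖ = 1 := norm_mob_eq hx (by simp)
  have h3 := integral_norm_sub_rpow_ge (by omega : 0 < n) hα hw
  rw [h2]
  calc (1 / 2) ^ α * (sphArea n / 4) * ‖x - O‖ ^ α
      = (‖x - O‖ / 2) ^ α * (sphArea n / 4) := by
        rw [div_eq_mul_one_div ‖x - O‖ 2, Real.mul_rpow (norm_nonneg _) (by norm_num)]; ring
    _ ≤ (‖x - O‖ / 2) ^ α * ∫ z : Sph n, ‖(z : Eu n) - mob x O‖ ^ α ∂(sphMeasure n) :=
        mul_le_mul_of_nonneg_left h3 (by positivity)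
    _ = ∫ z : Sph n, (‖x - O‖ / 2) ^ α * ‖(z : Eu n) - mob x O‖ ^ α ∂(sphMeasure n) :=
        (integral_const_mul _ _).symm
    _ ≤ _ := by
        refine integral_mono (integrable_sphere_of_continuous ?_)
          (integrable_sphere_of_continuous (ContinuousOn.continuous_sphere hmob)) fun z => ?_
        · exact continuous_const.mul ((by fun_prop : Continuous fun z : Sph n =>
            ‖(z : Eu n) - mob x O‖).rpow_const fun _ => Or.inr hα.le)
        · beta_reduce
          rw [← Real.mul_rpow (by positivity) (norm_nonneg _)]
          exact Real.rpow_le_rpow (by positivity) (dist_mob_ge hx (by simp) O) hα.le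

lemma one_sub_norm_sq_le (hx : ‖x‖ < 1) (O : Sph n) : 1 - ‖x‖ ^ 2 ≤ 2 * ‖x - O‖ := by
  have h1 : ‖(O : Eu n)‖ - ‖x‖ ≤ ‖(O : Eu n) - x‖ := norm_sub_norm_le _ _
  rw [norm_sub_rev] at h1
  have h2 : ‖(O : Eu n)‖ = 1 := by simp
  nlinarith [norm_nonneg x]

/-- The mass of a bubble away from `O` is at most of order `‖x - O‖ ^ (n - 1)`. -/
lemma pow_dist_bub_le (hn : 3 ≤ n) (hx : ‖x‖ < 1) (O : Sph n) :
    ∫ z : Sph n, ‖(z : Eu n) - O‖ ^ (2 * (n - 1)) * bub x z ^ (tau n + 1) ∂(sphMeasure n) ≤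
      (2 * 8 ^ (n - 1) * 2 ^ (n - 1) * sphArea n) * ‖x - O‖ ^ (n - 1) := by
  have hD2 : ‖x - O‖ ≤ 2 := by
    calc ‖x - O‖ ≤ ‖x‖ + ‖(O : Eu n)‖ := norm_sub_le _ _
      _ ≤ 2 := by simp; linarith
  set D := ‖x - O‖ with hD
  have hD0 : 0 ≤ D := norm_nonneg _
  have hpt : ∀ z : Sph n, ‖(z : Eu n) - O‖ ^ (2 * (n - 1)) * bub x z ^ (tau n + 1) ≤
      8 ^ (n - 1) * 2 ^ (n - 1) * D ^ (n - 1) * (1 + bub x z ^ (tau n + 1)) := by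
    intro z
    have hz : ‖(z : Eu n)‖ = 1 := by simp
    rw [← conf_pow_pred_eq_bub_rpow hn hx hz.le, pow_mul]
    have hc := conf_pos hx hz.le
    have hden := den_pos hx hz.le
    have h1 : ‖(z : Eu n) - O‖ ^ 2 ≤ 2 * den x z + 2 * D ^ 2 := by
      rw [den_sphere hz]
      have : ‖(z : Eu n) - O‖ ≤ ‖(z : Eu n) - x‖ + D := norm_sub_le_norm_sub_add_norm_sub _ _ _
      nlinarith [norm_nonneg ((z : Eu n) - O), sq_nonneg (‖(z : Eu n) - x‖ - D)]
    have h2 : ‖(z : Eu n) - O‖ ^ 2 * conf x z ≤ 4 * D * (1 + conf x z) := by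
      calc ‖(z : Eu n) - O‖ ^ 2 * conf x z ≤ (2 * den x z + 2 * D ^ 2) * conf x z :=
            mul_le_mul_of_nonneg_right h1 hc.le
        _ = 2 * (1 - ‖x‖ ^ 2) + 2 * D ^ 2 * conf x z := by
            rw [conf]; field_simp
        _ ≤ 4 * D * (1 + conf x z) := by
            have h3 := one_sub_norm_sq_le hx O
            have h4 : D ^ 2 * conf x z ≤ 2 * D * conf x z :=
              mul_le_mul_of_nonneg_right (by nlinarith) hc.le
            rw [← hD] at h3
            linarith
    calc (‖(z : Eu n) - O‖ ^ 2) ^ (n - 1) * conf x z ^ (n - 1)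
        = (‖(z : Eu n) - O‖ ^ 2 * conf x z) ^ (n - 1) := (mul_pow _ _ _).symm
      _ ≤ (4 * D * (1 + conf x z)) ^ (n - 1) :=
          pow_le_pow_left₀ (by positivity) h2 _
      _ = 4 ^ (n - 1) * D ^ (n - 1) * (1 + conf x z) ^ (n - 1) := by rw [mul_pow, mul_pow]
      _ ≤ 4 ^ (n - 1) * D ^ (n - 1) * (2 ^ (n - 1) * (1 ^ (n - 1) + conf x z ^ (n - 1))) := by
          refine mul_le_mul_of_nonneg_left ?_ (by positivity)
          have := add_rpow_le (q := ((n - 1 : ℕ) : ℝ)) zero_le_one hc.le (by positivity)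
          simpa only [Real.rpow_natCast] using this
      _ ≤ 8 ^ (n - 1) * D ^ (n - 1) * (2 ^ (n - 1) * (1 ^ (n - 1) + conf x z ^ (n - 1))) := by
          gcongr; norm_num
      _ = _ := by rw [one_pow]; ring
  have hcont : Continuous fun z : Sph n => bub x z ^ (tau n + 1) := continuous_bub_rpow hx _
  have h := integral_mono (integrable_sphere_of_continuous (by fun_prop))
    (integrable_sphere_of_continuous (by fun_prop)) hpt
  refine h.trans_eq ?_
  rw [integral_const_mul, integral_add (integrable_const _) (integrable_sphere_of_continuous hcont),
    integral_bub_rpow_sphere hn hx, integral_const_sphere]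
  ring

end Expansion

section WeightedExpansion

variable {n : ℕ} {x : Eu n}

lemma integrable_continuous_mul {w f : Sph n → ℝ} (hw : Continuous w)
    (hf : Integrable f (sphMeasure n)) : Integrable (fun z => w z * f z) (sphMeasure n) := by
  obtain ⟨C, hC⟩ := isCompact_univ.exists_bound_of_continuousOn hw.continuousOn
  exact hf.bdd_mul hw.aestronglyMeasurable (Eventually.of_forall fun z => hC z (mem_univ z))

lemma continuous_norm_sub_rpow (O : Sph n) {s : ℝ} (hs : 0 ≤ s) :
    Continuous fun z : Sph n => ‖(z : Eu n) - O‖ ^ s :=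
  (by fun_prop : Continuous fun z : Sph n => ‖(z : Eu n) - O‖).rpow_const fun _ => Or.inr hs

/-- Comparison of a weighted critical integral of `u` with that of the bubble, from both sides. -/
lemma weighted_integral_compare (hn : 3 ≤ n) (hx : ‖x‖ < 1) {u : H1 n} (hu : u ∈ constraintSet n)
    {w : Sph n → ℝ} (hw : Continuous w) {B : ℝ} (hw0 : ∀ z, 0 ≤ w z) (hwB : ∀ z, w z ≤ B) :
    coef hx u ^ (tau n + 1) * ∫ z : Sph n, w z * bub x z ^ (tau n + 1) ∂(sphMeasure n) ≤
      2 ^ (tau n + 1) * ((∫ z, w z * trace u z ^ (tau n + 1) ∂(sphMeasure n))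
        + B * ∫ z, |trace (remainder hx u) z| ^ (tau n + 1) ∂(sphMeasure n)) ∧
    ∫ z, w z * trace u z ^ (tau n + 1) ∂(sphMeasure n) ≤
      2 ^ (tau n + 1) * ((∫ z : Sph n, w z * bub x z ^ (tau n + 1) ∂(sphMeasure n))
        + B * ∫ z, |trace (remainder hx u) z| ^ (tau n + 1) ∂(sphMeasure n)) := by
  have hq : 0 ≤ tau n + 1 := by linarith [one_lt_tau hn]
  set q := tau n + 1
  set t := coef hx u
  set v := remainder hx u
  have ht0 : 0 ≤ t := coef_nonneg hn hx hu
  have ht1 : t ≤ 1 := coef_le_one hn hx hu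
  obtain ⟨_, -, hsob⟩ := exists_sobolev hn
  have iv : Integrable (fun z => |trace v z| ^ q) (sphMeasure n) := (hsob v).2.1
  have iu := integrable_continuous_mul hw (integrable_trace_rpow hn hu)
  have ib := integrable_continuous_mul hw
    (integrable_sphere_of_continuous (continuous_bub_rpow hx q))
  have hvtr : trace v =ᵐ[sphMeasure n] fun z => trace u z - t * bub x z :=
    trace_sub_smul_bubH hx u t
  have h2 : (0 : ℝ) ≤ 2 ^ q := by positivity
  have hwv : ∀ z, w z * |trace v z| ^ q ≤ B * |trace v z| ^ q := fun z =>
    mul_le_mul_of_nonneg_right (hwB z) (Real.rpow_nonneg (abs_nonneg _) _)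
  constructor
  · rw [← integral_const_mul, ← integral_const_mul, ← integral_add iu (iv.const_mul B),
      ← integral_const_mul]
    refine integral_mono_ae (ib.const_mul _) ((iu.add (iv.const_mul B)).const_mul _) ?_
    filter_upwards [hvtr, hu.2.2] with z hz hz0
    have hb := bub_pos_sphere hx z
    have h3 : (t * bub x z) ^ q ≤ 2 ^ q * (trace u z ^ q + |trace v z| ^ q) := by
      refine le_trans ?_ (add_rpow_le hz0 (abs_nonneg _) hq)
      refine Real.rpow_le_rpow (by positivity) ?_ hq
      have := neg_abs_le (trace v z)
      rw [hz] at this ⊢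
      linarith
    rw [Real.mul_rpow ht0 hb.le] at h3
    have h4 := mul_le_mul_of_nonneg_left h3 (hw0 z)
    have h5 := mul_le_mul_of_nonneg_left (hwv z) h2
    calc t ^ q * (w z * bub x z ^ q) = w z * (t ^ q * bub x z ^ q) := by ring
      _ ≤ w z * (2 ^ q * (trace u z ^ q + |trace v z| ^ q)) := h4
      _ = 2 ^ q * (w z * trace u z ^ q) + 2 ^ q * (w z * |trace v z| ^ q) := by ring
      _ ≤ 2 ^ q * (w z * trace u z ^ q) + 2 ^ q * (B * |trace v z| ^ q) := by linarith
      _ = _ := by ring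
  · rw [← integral_const_mul, ← integral_add ib (iv.const_mul B), ← integral_const_mul]
    refine integral_mono_ae iu ((ib.add (iv.const_mul B)).const_mul _) ?_
    filter_upwards [hvtr, hu.2.2] with z hz hz0
    have hb := bub_pos_sphere hx z
    have h3 : trace u z ^ q ≤ 2 ^ q * (bub x z ^ q + |trace v z| ^ q) := by
      refine le_trans ?_ (add_rpow_le hb.le (abs_nonneg _) hq)
      refine Real.rpow_le_rpow hz0 ?_ hq
      have := le_abs_self (trace v z)
      have h4 : t * bub x z ≤ bub x z := mul_le_of_le_one_left hb.le ht1
      rw [hz] at this ⊢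
      linarith
    have h4 := mul_le_mul_of_nonneg_left h3 (hw0 z)
    have h5 := mul_le_mul_of_nonneg_left (hwv z) h2
    calc w z * trace u z ^ q ≤ w z * (2 ^ q * (bub x z ^ q + |trace v z| ^ q)) := h4
      _ = 2 ^ q * (w z * bub x z ^ q) + 2 ^ q * (w z * |trace v z| ^ q) := by ring
      _ ≤ 2 ^ q * (w z * bub x z ^ q) + 2 ^ q * (B * |trace v z| ^ q) := by linarith
      _ = _ := by ring

/-- Both the distance to the bubble and the distance of its concentration point to `O` lower the
weighted critical integral, up to the drift of `u`. -/
lemma exists_weighted_integral_le (hn : 3 ≤ n) (O : Sph n) {α H c₁ M : ℝ} (hα : 0 < α)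
    (hα' : α < n - 1) (hH : 0 < H) (hc₁ : 0 < c₁) (hM : 0 ≤ M) :
    ∃ c C e₀ D₀ : ℝ, 0 < c ∧ 0 ≤ C ∧ 0 < e₀ ∧ 0 < D₀ ∧
    ∀ (x : Eu n) (hx : ‖x‖ < 1), ∀ u ∈ constraintSet n, energy (remainder hx u) ≤ e₀ →
      ‖x - O‖ ≤ D₀ →
      ∫ z : Sph n, (H - c₁ * ‖(z : Eu n) - O‖ ^ α + M * ‖(z : Eu n) - O‖ ^ (2 * (n - 1)))
        * trace u z ^ (tau n + 1) ∂(sphMeasure n) ≤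
      H * sphArea n - c * (energy (remainder hx u) + ‖x - O‖ ^ α) + C * drift x u := by
  have hτ := one_lt_tau hn
  have hA := sphArea_pos (by omega : 0 < n)
  obtain ⟨c₂, C₂, e₂, hc₂, hC₂, he₂, hexp⟩ := exists_integral_rpow_le hn
  obtain ⟨C₃, hC₃, hsob⟩ := exists_sobolev hn
  set q := tau n + 1 with hq
  set m := 2 * (n - 1) with hm
  -- `K₁` and `K₂` multiply the errors `e ^ (q / 2)` and `D ^ (n - 1)`, and `k` the gain `D ^ α`
  set K₁ := (c₁ * 2 ^ α + M * (2 ^ q * 2 ^ m)) * C₃ with hK₁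
  set K₂ := M * 2 ^ q * (2 * 8 ^ (n - 1) * 2 ^ (n - 1) * sphArea n) with hK₂
  set k := c₁ * ((1 / 2) ^ q * ((1 / 2) ^ q * ((1 / 2) ^ α * (sphArea n / 4)))) with hk
  have hk0 : 0 < k := by positivity
  obtain ⟨e₃, he₃, hsm₁⟩ := exists_mul_rpow_le (s := q / 2) (by linarith) (C := K₁)
    (by positivity) (half_pos (mul_pos hH hc₂))
  obtain ⟨D₁, hD₁, hsm₂⟩ := exists_mul_rpow_le (s := (n - 1) / α)
    (by rw [one_lt_div hα]; exact hα') (C := K₂) (by positivity) (half_pos hk0)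
  refine ⟨min (H * c₂ / 2) (k / 2), H * C₂, min e₂ e₃, D₁ ^ (1 / α), ?_, by positivity,
    lt_min he₂ he₃, by positivity, fun x hx u hu he hD => ?_⟩
  · exact lt_min (half_pos (mul_pos hH hc₂)) (half_pos hk0)
  obtain ⟨ht, hF⟩ := hexp x hx u hu (he.trans (min_le_left _ _))
  set e := energy (remainder hx u)
  have he0 : 0 ≤ e := energy_nonneg hn _
  set D := ‖x - O‖ with hDdef
  have hD0 : 0 ≤ D := norm_nonneg _
  have hDα : D ^ α ≤ D₁ := by
    calc D ^ α ≤ (D₁ ^ (1 / α)) ^ α := Real.rpow_le_rpow hD0 hD hα.le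
      _ = D₁ := by rw [← Real.rpow_mul hD₁.le, one_div_mul_cancel hα.ne', Real.rpow_one]
  have hDn : (D ^ α) ^ (((n : ℝ) - 1) / α) = D ^ (n - 1) := by
    rw [← Real.rpow_mul hD0, mul_div_cancel₀ _ hα.ne', ← Real.rpow_natCast, Nat.cast_sub (by omega)]
    simp
  have hs1 := hsm₁ e he0 (he.trans (min_le_right _ _))
  have hs2 := hsm₂ (D ^ α) (Real.rpow_nonneg hD0 _) hDα
  rw [hDn] at hs2
  set V := ∫ z, |trace (remainder hx u) z| ^ q ∂(sphMeasure n)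
  have hV : V ≤ C₃ * e ^ (q / 2) := (hsob _).2.2
  have cα : Continuous fun z : Sph n => ‖(z : Eu n) - O‖ ^ α := continuous_norm_sub_rpow O hα.le
  have cm : Continuous fun z : Sph n => ‖(z : Eu n) - O‖ ^ m := by fun_prop
  have hlow := (weighted_integral_compare hn hx hu cα (B := 2 ^ α)
    (fun z => Real.rpow_nonneg (norm_nonneg _) _)
    (fun z => Real.rpow_le_rpow (norm_nonneg _) (norm_sub_le_two z O) hα.le)).1
  have hup := (weighted_integral_compare hn hx hu cm (B := 2 ^ m)
    (fun z => pow_nonneg (norm_nonneg _) _)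
    (fun z => pow_le_pow_left₀ (norm_nonneg _) (norm_sub_le_two z O) _)).2
  have hL1 := rpow_dist_bub_ge hn hα hx O
  have hL2 := pow_dist_bub_le hn hx O
  have iu := integrable_trace_rpow hn hu
  have iα := integrable_continuous_mul cα iu
  have im := integrable_continuous_mul cm iu
  set Iα := ∫ z : Sph n, ‖(z : Eu n) - O‖ ^ α * trace u z ^ q ∂(sphMeasure n) with hIα
  set Im := ∫ z : Sph n, ‖(z : Eu n) - O‖ ^ m * trace u z ^ q ∂(sphMeasure n) with hIm
  set F := ∫ z : Sph n, trace u z ^ q ∂(sphMeasure n) with hFdef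
  have iuα : Integrable (fun z : Sph n => H * trace u z ^ q
      - c₁ * (‖(z : Eu n) - O‖ ^ α * trace u z ^ q)) (sphMeasure n) :=
    (iu.const_mul _).sub (iα.const_mul _)
  have hsplit : ∫ z : Sph n, (H - c₁ * ‖(z : Eu n) - O‖ ^ α + M * ‖(z : Eu n) - O‖ ^ m)
      * trace u z ^ q ∂(sphMeasure n) = H * F - c₁ * Iα + M * Im := by
    rw [hIα, hIm, hFdef, ← integral_const_mul, ← integral_const_mul, ← integral_const_mul,
      ← integral_sub (iu.const_mul _) (iα.const_mul _), ← integral_add iuα (im.const_mul _)]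
    exact integral_congr_ae (Eventually.of_forall fun z => by beta_reduce; ring)
  rw [hsplit]
  -- the contributions of the constant `H`, of the loss and of the correction in the weight
  have b1 : H * F ≤ H * (sphArea n - c₂ * e + C₂ * drift x u) := mul_le_mul_of_nonneg_left hF hH.le
  have b2 : k * D ^ α ≤ c₁ * Iα + c₁ * 2 ^ α * V := by
    have h1 : (1 / 2 : ℝ) ^ q ≤ coef hx u ^ q :=
      Real.rpow_le_rpow (by norm_num) ht (by linarith)
    have h2 : (1 / 2 : ℝ) ^ q * ((1 / 2) ^ α * (sphArea n / 4) * D ^ α) ≤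
        2 ^ q * (Iα + 2 ^ α * V) :=
      (mul_le_mul h1 hL1 (by positivity) (by positivity)).trans hlow
    have h3 : (1 / 2 : ℝ) ^ q * 2 ^ q = 1 := by
      rw [← Real.mul_rpow (by norm_num) (by norm_num)]; norm_num
    calc k * D ^ α
        = c₁ * ((1 / 2) ^ q * ((1 / 2 : ℝ) ^ q * ((1 / 2) ^ α * (sphArea n / 4) * D ^ α))) := by
          rw [hk]; ring
      _ ≤ c₁ * ((1 / 2) ^ q * (2 ^ q * (Iα + 2 ^ α * V))) := by gcongr
      _ = c₁ * (((1 / 2) ^ q * 2 ^ q) * (Iα + 2 ^ α * V)) := by ring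
      _ = _ := by rw [h3]; ring
  have b3 : M * Im ≤ K₂ * D ^ (n - 1) + M * (2 ^ q * 2 ^ m) * V := by
    calc M * Im ≤ M * (2 ^ q * ((2 * 8 ^ (n - 1) * 2 ^ (n - 1) * sphArea n) * D ^ (n - 1)
          + 2 ^ m * V)) := by
          refine mul_le_mul_of_nonneg_left (hup.trans ?_) hM
          gcongr
      _ = _ := by rw [hK₂]; ring
  have b4 : (c₁ * 2 ^ α + M * (2 ^ q * 2 ^ m)) * V ≤ K₁ * e ^ (q / 2) := by
    rw [hK₁, mul_assoc]
    exact mul_le_mul_of_nonneg_left hV (by positivity)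
  have b5 : min (H * c₂ / 2) (k / 2) * (e + D ^ α) ≤ H * c₂ / 2 * e + k / 2 * D ^ α := by
    rw [mul_add]
    have := Real.rpow_nonneg hD0 α
    gcongr
    · exact min_le_left _ _
    · exact min_le_right _ _
  linarith

end WeightedExpansion

/-! ### Almost optimal bubbles -/

section AlmostOptimal

variable {n : ℕ} {x y : Eu n}

/-- First order expansion, from below, of the bubbles near the constant one. -/
lemma bub_rpow_tau_ge (hn : 3 ≤ n) {z : Eu n} (hz : ‖z‖ = 1) (hy : ‖y‖ ≤ 1 / 2) :
    1 + n * ⟪y, z⟫_ℝ - 6 * n * ‖y‖ ^ 2 ≤ bub y z ^ tau n := by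
  have hy1 : ‖y‖ < 1 := by linarith
  have hn3 : (3 : ℝ) ≤ n := by exact_mod_cast hn
  have hc := conf_pos hy1 hz.le
  have h1 : bub y z ^ tau n = conf y z ^ ((n : ℝ) / 2) := by
    rw [bub, ← Real.rpow_mul hc.le, mul_comm, tau_mul_gam hn, gam]
    congr 1; ring
  have h2 := one_add_mul_self_le_rpow_one_add (s := conf y z - 1) (p := (n : ℝ) / 2)
    (by linarith) (by linarith)
  rw [add_sub_cancel] at h2
  have hden : 1 / 4 ≤ den y z := by
    refine le_trans ?_ den_ge
    rw [hz]; nlinarith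
  have h3 : 2 * ⟪y, z⟫_ℝ - 12 * ‖y‖ ^ 2 ≤ conf y z - 1 := by
    have hd : den y z = 1 - 2 * ⟪y, z⟫_ℝ + ‖y‖ ^ 2 := by rw [den, hz]; ring
    have hi := real_inner_le_norm y z
    rw [hz, mul_one] at hi
    have hi' : ⟪y, z⟫_ℝ ≤ 1 / 2 := hi.trans hy
    rw [conf, le_sub_iff_add_le, le_div_iff₀ (by linarith), hd]
    rw [hd] at hden
    have hs := sq_nonneg ‖y‖
    have h5 : ‖y‖ ^ 2 * (1 / 4) ≤ ‖y‖ ^ 2 * (1 - 2 * ⟪y, z⟫_ℝ + ‖y‖ ^ 2) :=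
      mul_le_mul_of_nonneg_left hden hs
    nlinarith [sq_nonneg ⟪y, z⟫_ℝ, mul_le_mul_of_nonneg_left hi' hs]
  rw [h1]
  refine le_trans ?_ h2
  nlinarith

lemma bubbleDist_ge (O : Sph n) (u : H1 n) {m : ℝ}
    (h : ∀ (x : Eu n) (hx : ‖x‖ < 1) (t : ℝ), m ≤ normE (u - t • bubH hx)) : m ≤ bubbleDist u := by
  have : Nonempty (ℝ × Sph n × Ioc (0 : ℝ) 1) := ⟨0, O, 1, by norm_num, le_rfl⟩
  refine le_ciInf fun p => ?_
  rw [bubble_eq_bubH]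
  exact h _ _ _

lemma bubbleDist_le (O : Sph n) (u : H1 n) (hx : ‖x‖ < 1) (t : ℝ) :
    bubbleDist u ≤ normE (u - t • bubH hx) := by
  obtain ⟨e, lam, h⟩ := bubH_eq_bubble O hx
  rw [h]
  exact ciInf_le ⟨0, by rintro _ ⟨p, rfl⟩; exact normE_nonneg _⟩ (t, e, lam)

lemma bubbleDist_nonneg (u : H1 n) : 0 ≤ bubbleDist u := Real.iInf_nonneg fun _ => normE_nonneg _

/-- The distance to the bubbles is almost attained at a bubble along whose derivatives `u` has
almost no component: at an almost maximizer of the pairing with `u`, the pairing with the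
neighbouring bubbles, which are the images of the bubbles near the constant one, cannot be
larger. -/
lemma exists_almost_optimal_bubble (hn : 3 ≤ n) (O : Sph n) {u : H1 n} (hu : u ∈ constraintSet n)
    {κ : ℝ} (hκ : 0 < κ) : ∃ (x : Eu n) (hx : ‖x‖ < 1),
      normE (remainder hx u) ≤ bubbleDist u + κ ∧ drift x u ≤ κ := by
  have hE := gam_mul_sphArea_pos hn
  have hγ := gam_pos hn
  have hA := sphArea_pos (by omega : 0 < n)
  have hn0 : (0 : ℝ) < n := by
    have : 0 < n := by omega
    exact_mod_cast this
  set E₁ := gam n * sphArea n with hE₁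
  set P : Set ℝ := {g | ∃ (x : Eu n) (hx : ‖x‖ < 1), g = pairing (u : Triple n) (bubH hx)} with hP
  have hPos : ∀ (x : Eu n) (hx : ‖x‖ < 1), 0 ≤ pairing (u : Triple n) (bubH hx) := by
    intro x hx
    rw [← coef_mul hn]
    exact mul_nonneg (coef_nonneg hn hx hu) hE.le
  have hLe : ∀ (x : Eu n) (hx : ‖x‖ < 1), pairing (u : Triple n) (bubH hx) ≤ E₁ := by
    intro x hx
    rw [← coef_mul hn]
    exact mul_le_of_le_one_left hE.le (coef_le_one hn hx hu)
  have hPne : P.Nonempty := ⟨_, 0, by simp, rfl⟩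
  have hPbdd : BddAbove P := ⟨E₁, by rintro _ ⟨x, hx, rfl⟩; exact hLe x hx⟩
  set G := sSup P with hG
  have hGle : ∀ (x : Eu n) (hx : ‖x‖ < 1), pairing (u : Triple n) (bubH hx) ≤ G :=
    fun x hx => le_csSup hPbdd ⟨x, hx, rfl⟩
  have hGE : G ≤ E₁ := csSup_le hPne (by rintro _ ⟨x, hx, rfl⟩; exact hLe x hx)
  have hG0 : 0 ≤ G := (hPos 0 (by simp)).trans (hGle 0 _)
  -- the distance to the bubbles in terms of the supremum of the pairings
  have hdist : √(E₁ - G ^ 2 / E₁) ≤ bubbleDist u := by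
    refine bubbleDist_ge O u fun x hx t => Real.sqrt_le_sqrt ?_
    rw [energy_sub_smul, energy_bubH hn, hu.1]
    set g := pairing (u : Triple n) (bubH hx)
    have h1 : g ^ 2 / E₁ ≤ G ^ 2 / E₁ := by
      have := hPos x hx
      have := hGle x hx
      gcongr
    have h2 : E₁ - 2 * t * g + t ^ 2 * E₁ - (E₁ - g ^ 2 / E₁) = (t * E₁ - g) ^ 2 / E₁ := by
      field_simp; ring
    have h3 : 0 ≤ (t * E₁ - g) ^ 2 / E₁ := by positivity
    linarith
  -- `s` is the size of the step to the neighbouring bubbles; the pairing with `bub x` is maximal up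
  -- to an error of order `s ^ 2`, while a step along the drift gains a multiple of `s`
  obtain ⟨s, hs0, hs1, hs2, hs3⟩ : ∃ s : ℝ, 0 < s ∧ s ≤ 1 / 2 ∧ 2 * (n * s ^ 2 * E₁) ≤ κ ^ 2 ∧
      (7 * s * sphArea n) ^ 2 ≤ κ := by
    have h1 : Tendsto (fun s : ℝ => 2 * (n * s ^ 2 * E₁)) (𝓝[>] 0) (𝓝 0) := by
      have : Continuous fun s : ℝ => 2 * (n * s ^ 2 * E₁) := by fun_prop
      simpa using (this.tendsto 0).mono_left nhdsWithin_le_nhds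
    have h2 : Tendsto (fun s : ℝ => (7 * s * sphArea n) ^ 2) (𝓝[>] 0) (𝓝 0) := by
      have : Continuous fun s : ℝ => (7 * s * sphArea n) ^ 2 := by fun_prop
      simpa using (this.tendsto 0).mono_left nhdsWithin_le_nhds
    have h3 : ∀ᶠ s : ℝ in 𝓝[>] 0, s < 1 / 2 :=
      (eventually_lt_nhds (by norm_num)).filter_mono nhdsWithin_le_nhds
    obtain ⟨s, ⟨h1, h2⟩, h3, h4⟩ := (((h1.eventually_lt_const (pow_pos hκ 2)).and
      (h2.eventually_lt_const hκ)).and (h3.and self_mem_nhdsWithin)).exists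
    exact ⟨s, h4, h3.le, h1.le, h2.le⟩
  have hδ : 0 < n * s ^ 2 * E₁ := by positivity
  obtain ⟨_, ⟨x, hx, rfl⟩, hxG⟩ := exists_lt_of_lt_csSup hPne (sub_lt_self G hδ)
  set g := pairing (u : Triple n) (bubH hx) with hg
  refine ⟨x, hx, ?_, ?_⟩
  · have h1 : energy (remainder hx u) ≤ (bubbleDist u + κ) ^ 2 := by
      have e1 : energy (remainder hx u) = E₁ - g ^ 2 / E₁ := by
        have hc : g = coef hx u * E₁ := (coef_mul hn hx u).symm
        rw [energy_remainder hn hx hu, ← hE₁, hc]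
        field_simp
      have e2 : E₁ - G ^ 2 / E₁ ≤ bubbleDist u ^ 2 := by
        have h0 : 0 ≤ E₁ - G ^ 2 / E₁ := by
          rw [sub_nonneg, div_le_iff₀ hE]; nlinarith
        rw [← Real.sq_sqrt h0]
        exact pow_le_pow_left₀ (Real.sqrt_nonneg _) hdist 2
      have e3 : G ^ 2 / E₁ - g ^ 2 / E₁ ≤ 2 * (n * s ^ 2 * E₁) := by
        rw [← sub_div, div_le_iff₀ hE]
        have := hPos x hx
        have := hLe x hx
        have := hGle x hx
        calc G ^ 2 - g ^ 2 = (G - g) * (G + g) := by ring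
          _ ≤ (n * s ^ 2 * E₁) * (2 * E₁) := by
              refine mul_le_mul (by linarith) (by linarith) (by linarith) hδ.le
          _ = _ := by ring
      have := bubbleDist_nonneg u
      nlinarith
    exact Real.sqrt_le_iff.2 ⟨add_nonneg (bubbleDist_nonneg u) hκ.le, h1⟩
  · -- up to second order in `y`, the pairing with `bub (mob x y)` exceeds that with `bub x` by
    -- at least `gam n * n * ⟪y, V⟫`
    set V : Eu n := WithLp.toLp 2 fun i =>
      ∫ z : Sph n, bub x z ^ tau n * mob x z i * trace u z ∂(sphMeasure n) with hV
    have hdV : drift x u = ‖V‖ ^ 2 := (norm_sq_eq_sum V).symm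
    have cb := continuous_bub_rpow hx (tau n)
    have cmob := continuous_mob_apply_sphere hx
    have hVy : ∀ y : Eu n, ‖y‖ ≤ 1 / 2 → gam n * n * ⟪y, V⟫_ℝ ≤
        n * s ^ 2 * E₁ + 6 * n * ‖y‖ ^ 2 * E₁ := by
      intro y hy
      have hy1 : ‖y‖ < 1 := by linarith
      have hm := norm_mob_lt hx hy1
      have h1 := hGle _ hm
      rw [pairing_bubH hn] at h1
      have i1 : Integrable (fun z : Sph n => bub x z ^ tau n * trace u z) (sphMeasure n) :=
        integrable_mul_trace cb u
      have i2 : ∀ i, Integrable (fun z : Sph n => y i * (bub x z ^ tau n * mob x z i * trace u z))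
          (sphMeasure n) := fun i => (integrable_mul_trace (cb.mul (cmob i)) u).const_mul _
      have i3 : Integrable (fun z : Sph n =>
          ∑ i, y i * (bub x z ^ tau n * mob x z i * trace u z)) (sphMeasure n) :=
        integrable_finsetSum _ fun i _ => i2 i
      have h2 : ∫ z : Sph n, ((1 - 6 * n * ‖y‖ ^ 2) * (bub x z ^ tau n * trace u z)
            + n * ∑ i, y i * (bub x z ^ tau n * mob x z i * trace u z)) ∂(sphMeasure n) ≤
          ∫ z : Sph n, bub (mob x y) z ^ tau n * trace u z ∂(sphMeasure n) := by
        refine integral_mono_ae ((i1.const_mul _).add (i3.const_mul _))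
          (integrable_mul_trace (continuous_bub_rpow hm _) u) ?_
        filter_upwards [hu.2.2] with z hz
        have hz1 : ‖(z : Eu n)‖ = 1 := by simp
        have h3 := bub_rpow_tau_ge hn (norm_mob_eq hx hz1) hy
        have hb := bub_pos hx hz1.le
        have hb' := bub_pos hy1 (norm_mob_le hx hz1.le)
        rw [← bub_mul_bub_mob hx hy1 hz1.le, Real.mul_rpow hb.le hb'.le]
        have h4 : ∑ i, y i * (bub x z ^ tau n * mob x z i * trace u z) =
            bub x z ^ tau n * trace u z * ⟪y, mob x z⟫_ℝ := by
          rw [PiLp.inner_apply, Finset.mul_sum]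
          exact Finset.sum_congr rfl fun i _ => by simp; ring
        rw [h4]
        have h5 : 0 ≤ bub x z ^ tau n * trace u z :=
          mul_nonneg (Real.rpow_nonneg hb.le _) hz
        nlinarith [mul_le_mul_of_nonneg_left h3 h5]
      rw [integral_add (i1.const_mul _) (i3.const_mul _), integral_const_mul, integral_const_mul,
        integral_finsetSum _ fun i _ => i2 i] at h2
      have h3 : ∑ i, ∫ z : Sph n, y i * (bub x z ^ tau n * mob x z i * trace u z) ∂(sphMeasure n)
          = ⟪y, V⟫_ℝ := by
        rw [PiLp.inner_apply]
        exact Finset.sum_congr rfl fun i _ => by rw [integral_const_mul]; simp [hV, mul_comm]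
      rw [h3] at h2
      have h4 : gam n * ∫ z : Sph n, bub x z ^ tau n * trace u z ∂(sphMeasure n) = g := by
        rw [hg, pairing_bubH hn]
      have h5 := mul_le_mul_of_nonneg_left h2 hγ.le
      have h6 := hLe x hx
      have h7 : 6 * n * ‖y‖ ^ 2 * g ≤ 6 * n * ‖y‖ ^ 2 * E₁ :=
        mul_le_mul_of_nonneg_left h6 (by positivity)
      have h8 : gam n * ((1 - 6 * n * ‖y‖ ^ 2) *
          (∫ z : Sph n, bub x z ^ tau n * trace u z ∂(sphMeasure n)) + n * ⟪y, V⟫_ℝ) =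
          g - 6 * n * ‖y‖ ^ 2 * g + gam n * n * ⟪y, V⟫_ℝ := by
        rw [← h4]; ring
      rw [h8] at h5
      linarith
    rw [hdV]
    refine le_trans (pow_le_pow_left₀ (norm_nonneg _) ?_ 2) hs3
    rcases eq_or_ne V 0 with h0 | h0
    · rw [h0, norm_zero]; positivity
    · have hVn : 0 < ‖V‖ := norm_pos_iff.2 h0
      have hyn : ‖(s / ‖V‖) • V‖ = s := by
        rw [norm_smul, Real.norm_of_nonneg (by positivity), div_mul_cancel₀ _ hVn.ne']
      have h1 := hVy ((s / ‖V‖) • V) (by rw [hyn]; exact hs1)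
      rw [hyn, inner_smul_left, real_inner_self_eq_norm_sq] at h1
      have h2 : (starRingEnd ℝ) (s / ‖V‖) * ‖V‖ ^ 2 = s * ‖V‖ := by
        simp; field_simp
      rw [h2] at h1
      have h3 : gam n * n * s * ‖V‖ ≤ gam n * n * s * (7 * s * sphArea n) := by
        calc gam n * n * s * ‖V‖ = gam n * n * (s * ‖V‖) := by ring
          _ ≤ n * s ^ 2 * E₁ + 6 * n * s ^ 2 * E₁ := h1
          _ = _ := by rw [hE₁]; ring
      exact le_of_mul_le_mul_left h3 (by positivity)

end AlmostOptimal

/-! ### The centre of mass -/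

section MassCenter

variable {n : ℕ} {x : Eu n}

lemma rpow_sub_rpow_le {a b s : ℝ} (ha : 0 ≤ a) (hb : 0 ≤ b) (hs : 1 ≤ s) :
    a ^ s - b ^ s ≤ s * (|a - b| * a ^ (s - 1)) := by
  rcases ha.eq_or_lt with rfl | ha'
  · rw [Real.zero_rpow (by linarith)]
    have h1 := Real.rpow_nonneg hb s
    have h2 : 0 ≤ s * (|0 - b| * 0 ^ (s - 1)) := by positivity
    linarith
  · have h1 := one_add_mul_self_le_rpow_one_add (s := b / a - 1) (p := s)
      (by linarith [div_nonneg hb ha]) hs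
    rw [add_sub_cancel, Real.div_rpow hb ha, le_div_iff₀ (Real.rpow_pos_of_pos ha' s)] at h1
    have h2 : a ^ s = a ^ (s - 1) * a := by
      rw [← Real.rpow_add_one ha'.ne']; ring_nf
    have h3 : (1 + s * (b / a - 1)) * a ^ s = a ^ s - s * ((a - b) * a ^ (s - 1)) := by
      rw [h2]; field_simp; ring
    rw [h3] at h1
    have h4 : s * ((a - b) * a ^ (s - 1)) ≤ s * (|a - b| * a ^ (s - 1)) := by
      have := Real.rpow_nonneg ha (s - 1)
      gcongr
      exact le_abs_self _
    linarith

lemma mul_rpow_sub_one_le {c a s : ℝ} (hc : 0 ≤ c) (ha : 0 ≤ a) (hs : 1 < s) :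
    c * a ^ (s - 1) ≤ c ^ s + a ^ s := by
  have hpow : ∀ y : ℝ, 0 ≤ y → y * y ^ (s - 1) = y ^ s := by
    intro y hy
    rcases hy.eq_or_lt with rfl | hy
    · rw [Real.zero_rpow (by linarith)]; simp; rw [Real.zero_rpow (by linarith)]
    · rw [mul_comm, ← Real.rpow_add_one hy.ne']; ring_nf
  have h1 := Real.rpow_nonneg hc s
  have h2 := Real.rpow_nonneg ha s
  rcases le_total c a with h | h
  · have : c * a ^ (s - 1) ≤ a * a ^ (s - 1) :=
      mul_le_mul_of_nonneg_right h (Real.rpow_nonneg ha _)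
    rw [hpow a ha] at this
    linarith
  · have : c * a ^ (s - 1) ≤ c * c ^ (s - 1) :=
      mul_le_mul_of_nonneg_left (Real.rpow_le_rpow ha h (by linarith)) hc
    rw [hpow c hc] at this
    linarith

lemma abs_rpow_sub_rpow_le {a b s η : ℝ} (ha : 0 ≤ a) (hb : 0 ≤ b) (hs : 1 < s) (hη : 0 < η) :
    |a ^ s - b ^ s| ≤ s * η * (2 * (η ^ (-s) * |a - b| ^ s) + a ^ s + b ^ s) := by
  have key : ∀ y : ℝ, 0 ≤ y → |a - b| * y ^ (s - 1) ≤ η * (η ^ (-s) * |a - b| ^ s + y ^ s) := by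
    intro y hy
    have h1 := mul_rpow_sub_one_le (div_nonneg (abs_nonneg (a - b)) hη.le) hy hs
    rw [Real.div_rpow (abs_nonneg _) hη.le, div_eq_mul_inv (_ ^ s), ← Real.rpow_neg hη.le] at h1
    have h2 := mul_le_mul_of_nonneg_left h1 hη.le
    rw [mul_comm (η ^ (-s))]
    refine le_trans (le_of_eq ?_) h2
    field_simp
  have h1 := rpow_sub_rpow_le ha hb hs.le
  have h2 := rpow_sub_rpow_le hb ha hs.le
  rw [abs_sub_comm] at h2
  have h3 := mul_le_mul_of_nonneg_left (key a ha) (by linarith : 0 ≤ s)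
  have h4 := mul_le_mul_of_nonneg_left (key b hb) (by linarith : 0 ≤ s)
  have h5 : 0 ≤ s * η * (η ^ (-s) * |a - b| ^ s) := by positivity
  have h6 : 0 ≤ s * η * a ^ s := by positivity
  have h7 : 0 ≤ s * η * b ^ s := by positivity
  rw [abs_le]
  constructor <;> linarith

/-- The centre of mass of the bubble `bub x`, as the mean of the involution. -/
def bubCenter (x : Eu n) : Eu n := (ballVol n)⁻¹ • ∫ z, mob x z ∂(ballMeasure n)

lemma integrable_mob (hx : ‖x‖ < 1) : Integrable (mob x) (ballMeasure n) :=
  integrable_ball_of_continuousOn (continuousOn_mob hx)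

lemma ballVol_smul_bubCenter (hn : 3 ≤ n) (hx : ‖x‖ < 1) :
    ballVol n • bubCenter x = ∫ z, bub x z ^ (2 * tau n) • z ∂(ballMeasure n) := by
  rw [bubCenter, smul_smul, mul_inv_cancel₀ ballVol_pos.ne', one_smul,
    ← integral_ball_bub_rpow hn hx]
  refine setIntegral_congr_fun measurableSet_ball fun z hz => ?_
  beta_reduce
  rw [mob_mob hx (mem_ball_zero_iff.1 hz).le]

lemma integral_bub_rpow_ball (hn : 3 ≤ n) (hx : ‖x‖ < 1) :
    ∫ z, bub x z ^ (2 * tau n) ∂(ballMeasure n) = ballVol n := by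
  have h := integral_ball_bub_rpow hn hx fun _ => (1 : ℝ)
  simpa [ballVol] using h

lemma integral_const_ball {F : Type*} [NormedAddCommGroup F] [NormedSpace ℝ F] [CompleteSpace F]
    (v : F) : ∫ _, v ∂(ballMeasure n) = ballVol n • v := by
  rw [integral_const]; rfl

lemma norm_bubCenter_sub_le (hx : ‖x‖ < 1) (O : Eu n) :
    ‖bubCenter x - O‖ ≤ (ballVol n)⁻¹ * ∫ z, ‖mob x z - O‖ ∂(ballMeasure n) := by
  have h : bubCenter x - O = (ballVol n)⁻¹ • ∫ z, (mob x z - O) ∂(ballMeasure n) := by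
    rw [integral_sub (integrable_mob hx) (integrable_const _), integral_const_ball, smul_sub,
      smul_smul, inv_mul_cancel₀ ballVol_pos.ne', one_smul, bubCenter]
  rw [h, norm_smul, Real.norm_of_nonneg (inv_nonneg.2 ballVol_pos.le)]
  exact mul_le_mul_of_nonneg_left (norm_integral_le_integral_norm _) (inv_nonneg.2 ballVol_pos.le)

lemma norm_bubCenter_le (hx : ‖x‖ < 1) : ‖bubCenter x‖ ≤ 1 := by
  have h := norm_bubCenter_sub_le hx 0
  simp only [sub_zero] at h
  refine h.trans ?_
  rw [inv_mul_le_iff₀ ballVol_pos, mul_one]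
  calc ∫ z, ‖mob x z‖ ∂(ballMeasure n) ≤ ∫ _, (1 : ℝ) ∂(ballMeasure n) := by
        refine integral_mono_ae (integrable_mob hx).norm (integrable_const _) ?_
        filter_upwards [ae_restrict_mem measurableSet_ball] with z hz
        exact norm_mob_le hx (mem_ball_zero_iff.1 hz).le
    _ = ballVol n := by rw [integral_const_ball]; simp

/-- Near a bubble the centre of mass is close to that of the bubble. -/
lemma exists_norm_massCenter_sub_le (hn : 3 ≤ n) : ∃ C η₀ : ℝ, 0 ≤ C ∧ 0 < η₀ ∧
    ∀ w ∈ constraintSet n, ∀ (x : Eu n) (hx : ‖x‖ < 1) (t η : ℝ), 0 ≤ t → 0 < η → η ≤ η₀ →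
      normE (w - t • bubH hx) ≤ η → ‖massCenter w - bubCenter x‖ ≤ C * η := by
  have hτ := one_lt_tau hn
  have hE := gam_mul_sphArea_pos hn
  have hB := ballVol_pos (n := n)
  obtain ⟨C₁, hC₁, hsob⟩ := exists_sobolev hn
  set E₁ := gam n * sphArea n with hE₁
  set s := 2 * tau n with hs
  have hs1 : 1 < s := by linarith
  set C₂ := s * (2 * C₁ + C₁ * E₁ ^ tau n + 2 ^ s * ballVol n) with hC₂
  have hC₂0 : 0 ≤ C₂ := by positivity
  set m₀ := (1 / 2) ^ s * ballVol n / 2 with hm₀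
  have hm₀0 : 0 < m₀ := by positivity
  refine ⟨2 * C₂ / m₀, min (√E₁ / 2) (m₀ / (C₂ + 1)), by positivity, by positivity,
    fun w hw x hx t η ht hη hη₀ hwη => ?_⟩
  have hη1 : η ≤ √E₁ / 2 := hη₀.trans (min_le_left _ _)
  have hη2 : C₂ * η ≤ m₀ := by
    have h1 := hη₀.trans (min_le_right _ _)
    rw [le_div_iff₀ (by linarith)] at h1
    linarith
  have hsq : 0 < √E₁ := Real.sqrt_pos.2 hE
  -- the coefficient is bounded above and below
  have hnw : normE w = √E₁ := by rw [normE, hw.1]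
  have hnb : normE (t • bubH hx) = t * √E₁ := by
    rw [normE_smul, abs_of_nonneg ht, normE, energy_bubH hn]
  have ht1 : 1 / 2 ≤ t := by
    have h1 := normE_add_le hn (w - t • bubH hx) (t • bubH hx)
    rw [sub_add_cancel, hnw, hnb] at h1
    by_contra h
    push Not at h
    nlinarith
  have ht2 : t ≤ 2 := by
    have h1 := normE_add_le hn (-(w - t • bubH hx)) w
    rw [neg_sub, sub_add_cancel, ← neg_sub, normE_neg, hnw, hnb] at h1
    by_contra h
    push Not at h
    nlinarith
  set v := w - t • bubH hx with hv
  have hvtr : funVal v =ᵐ[ballMeasure n] fun z => funVal w z - t * bub x z :=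
    funVal_sub_smul_bubH hx w t
  -- integrability of the powers
  have iv : Integrable (fun z => |funVal v z| ^ s) (ballMeasure n) := (hsob v).1.1
  have iw : Integrable (fun z => funVal w z ^ s) (ballMeasure n) := by
    refine (hsob w).1.1.congr ?_
    filter_upwards [hw.2.1] with z hz
    rw [abs_of_nonneg hz]
  have ib : Integrable (fun z => (t * bub x z) ^ s) (ballMeasure n) :=
    integrable_ball_of_continuousOn ((continuousOn_const.mul (continuousOn_bub hx)).rpow_const
      fun _ _ => Or.inr (by linarith))
  have ibs : ∫ z, (t * bub x z) ^ s ∂(ballMeasure n) = t ^ s * ballVol n := by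
    rw [← integral_bub_rpow_ball hn hx, ← integral_const_mul]
    refine setIntegral_congr_fun measurableSet_ball fun z hz => ?_
    exact Real.mul_rpow ht (bub_pos hx (mem_ball_zero_iff.1 hz).le).le
  have hEv : energy v ≤ η ^ 2 := by
    rw [← sq_normE hn]
    exact pow_le_pow_left₀ (normE_nonneg _) hwη 2
  have hV : ∫ z, |funVal v z| ^ s ∂(ballMeasure n) ≤ C₁ * η ^ s := by
    refine (hsob v).1.2.trans (mul_le_mul_of_nonneg_left ?_ hC₁)
    calc energy v ^ tau n ≤ (η ^ 2) ^ tau n :=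
          Real.rpow_le_rpow (energy_nonneg hn _) hEv (by linarith)
      _ = η ^ s := by rw [← Real.rpow_natCast, ← Real.rpow_mul hη.le, hs]; norm_num
  have hW : ∫ z, funVal w z ^ s ∂(ballMeasure n) ≤ C₁ * E₁ ^ tau n := by
    have h1 := (hsob w).1.2
    rw [hw.1] at h1
    refine le_trans (le_of_eq (integral_congr_ae ?_)) h1
    filter_upwards [hw.2.1] with z hz
    rw [abs_of_nonneg hz]
  -- the powers are close in `L¹`
  have hdiff : ∫ z, |funVal w z ^ s - (t * bub x z) ^ s| ∂(ballMeasure n) ≤ C₂ * η := by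
    have i1 : Integrable (fun z => 2 * (η ^ (-s) * |funVal v z| ^ s)) (ballMeasure n) :=
      (iv.const_mul _).const_mul _
    have i2 : Integrable (fun z => 2 * (η ^ (-s) * |funVal v z| ^ s) + funVal w z ^ s)
        (ballMeasure n) := i1.add iw
    calc ∫ z, |funVal w z ^ s - (t * bub x z) ^ s| ∂(ballMeasure n)
        ≤ ∫ z, s * η * (2 * (η ^ (-s) * |funVal v z| ^ s) + funVal w z ^ s + (t * bub x z) ^ s)
            ∂(ballMeasure n) := by
          refine integral_mono_ae (iw.sub ib).abs ((i2.add ib).const_mul _) ?_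
          filter_upwards [hvtr, hw.2.1, ae_restrict_mem measurableSet_ball] with z hz hz0 hzB
          have hb := bub_pos hx (mem_ball_zero_iff.1 hzB).le
          have := abs_rpow_sub_rpow_le hz0 (mul_nonneg ht hb.le) hs1 hη
          rw [← hz] at this
          exact this
      _ = s * η * (2 * (η ^ (-s) * ∫ z, |funVal v z| ^ s ∂(ballMeasure n))
            + (∫ z, funVal w z ^ s ∂(ballMeasure n)) + t ^ s * ballVol n) := by
          rw [integral_const_mul, integral_add i2 ib, integral_add i1 iw, integral_const_mul,
            integral_const_mul, ibs]
      _ ≤ s * η * (2 * (η ^ (-s) * (C₁ * η ^ s)) + C₁ * E₁ ^ tau n + 2 ^ s * ballVol n) := by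
          gcongr
      _ = C₂ * η := by
          have h1 : η ^ (-s) * (C₁ * η ^ s) = C₁ := by
            rw [Real.rpow_neg hη.le]
            field_simp
          rw [h1, hC₂]; ring
  set m := ∫ z, funVal w z ^ s ∂(ballMeasure n) with hm
  have hmdiff : |m - t ^ s * ballVol n| ≤ C₂ * η := by
    rw [hm, ← ibs, ← integral_sub iw ib]
    exact (abs_integral_le_integral_abs).trans hdiff
  have hm0 : m₀ ≤ m := by
    have h1 : (1 / 2 : ℝ) ^ s ≤ t ^ s := Real.rpow_le_rpow (by norm_num) ht1 (by linarith)
    have h2 := (abs_le.1 hmdiff).1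
    have h3 : (1 / 2 : ℝ) ^ s * ballVol n ≤ t ^ s * ballVol n :=
      mul_le_mul_of_nonneg_right h1 hB.le
    have h4 : (1 / 2 : ℝ) ^ s * ballVol n = 2 * m₀ := by rw [hm₀]; ring
    linarith
  have hmpos : 0 < m := hm₀0.trans_le hm0
  -- the first moments are close
  have iwz : Integrable (fun z => funVal w z ^ s • z) (ballMeasure n) := by
    refine Integrable.mono' iw (iw.aestronglyMeasurable.smul aestronglyMeasurable_id) ?_
    filter_upwards [hw.2.1, ae_restrict_mem measurableSet_ball] with z hz hzB
    rw [norm_smul, Real.norm_of_nonneg (Real.rpow_nonneg hz _)]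
    exact mul_le_of_le_one_right (Real.rpow_nonneg hz _) (mem_ball_zero_iff.1 hzB).le
  have ibz : Integrable (fun z => (t * bub x z) ^ s • z) (ballMeasure n) :=
    integrable_ball_of_continuousOn (((continuousOn_const.mul
      (continuousOn_bub hx)).rpow_const fun _ _ => Or.inr (by linarith)).smul continuousOn_id)
  have ibsz : ∫ z, (t * bub x z) ^ s • z ∂(ballMeasure n) = (t ^ s * ballVol n) • bubCenter x := by
    rw [mul_smul, ballVol_smul_bubCenter hn hx, ← integral_smul]
    refine setIntegral_congr_fun measurableSet_ball fun z hz => ?_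
    beta_reduce
    rw [Real.mul_rpow ht (bub_pos hx (mem_ball_zero_iff.1 hz).le).le, mul_smul]
  have hzdiff : ‖(∫ z, funVal w z ^ s • z ∂(ballMeasure n)) - (t ^ s * ballVol n) • bubCenter x‖
      ≤ C₂ * η := by
    rw [← ibsz, ← integral_sub iwz ibz]
    refine (norm_integral_le_integral_norm _).trans (le_trans ?_ hdiff)
    refine integral_mono_ae (iwz.sub ibz).norm (iw.sub ib).abs ?_
    filter_upwards [ae_restrict_mem measurableSet_ball] with z hzB
    rw [← sub_smul, norm_smul, Real.norm_eq_abs]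
    exact mul_le_of_le_one_right (abs_nonneg _) (mem_ball_zero_iff.1 hzB).le
  have hfin : massCenter w - bubCenter x = m⁻¹ • (((∫ z, funVal w z ^ s • z ∂(ballMeasure n))
      - (t ^ s * ballVol n) • bubCenter x) - (m - t ^ s * ballVol n) • bubCenter x) := by
    rw [sub_smul, sub_sub_sub_cancel_right, smul_sub, smul_smul, inv_mul_cancel₀ hmpos.ne',
      one_smul]
    rfl
  rw [hfin, norm_smul, Real.norm_of_nonneg (inv_nonneg.2 hmpos.le), inv_mul_le_iff₀ hmpos]
  calc _ ≤ C₂ * η + C₂ * η * 1 := by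
        refine (norm_sub_le _ _).trans (add_le_add hzdiff ?_)
        rw [norm_smul]
        exact mul_le_mul hmdiff (norm_bubCenter_le hx) (norm_nonneg _) (by positivity)
    _ = m₀ * (2 * C₂ / m₀ * η) := by field_simp; ring
    _ ≤ m * (2 * C₂ / m₀ * η) := by gcongr

/-- If the centre of mass of a bubble is close to `O`, then so is its index. -/
lemma norm_sub_sq_le_bubCenter (hx : ‖x‖ < 1) (O : Sph n) :
    ‖x - O‖ ^ 2 ≤ 8 * ‖bubCenter x - O‖ := by
  have hO : ‖(O : Eu n)‖ = 1 := by simp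
  have hB := ballVol_pos (n := n)
  have hw := norm_mob_eq hx hO
  set w := mob x (O : Eu n) with hwdef
  -- the square of `dist_mob_ge`; the linear term on the left has mean zero
  have h1 : ∀ z ∈ ball (0 : Eu n) 1, ‖x - O‖ ^ 2 / 8 * (1 - 2 * ⟪z, w⟫_ℝ) ≤
      ⟪(O : Eu n) - mob x z, (O : Eu n)⟫_ℝ := by
    intro z hz
    have hz1 : ‖z‖ ≤ 1 := (mem_ball_zero_iff.1 hz).le
    have h2 := dist_mob_ge hx hz1 O
    have h3 := pow_le_pow_left₀ (by positivity) h2 2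
    rw [mul_pow, ← hwdef, norm_sub_sq_real, norm_sub_sq_real (mob x z), hw, hO] at h3
    have h4 := norm_mob_le hx hz1
    rw [inner_sub_left, real_inner_self_eq_norm_sq, hO]
    nlinarith [sq_nonneg ‖x - O‖, mul_nonneg (sq_nonneg ‖x - O‖) (sq_nonneg ‖z‖),
      norm_nonneg (mob x z)]
  have i1 : Integrable (fun z => ‖x - O‖ ^ 2 / 8 * (1 - 2 * ⟪z, w⟫_ℝ)) (ballMeasure n) :=
    integrable_ball_of_continuousOn (by fun_prop)
  have i2 : Integrable (fun z => ⟪(O : Eu n) - mob x z, (O : Eu n)⟫_ℝ) (ballMeasure n) :=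
    integrable_ball_of_continuousOn
      ((continuousOn_const.sub (continuousOn_mob hx)).inner continuousOn_const)
  have h2 := setIntegral_mono_on i1 i2 measurableSet_ball h1
  have h3 : ∫ z, ⟪z, w⟫_ℝ ∂(ballMeasure n) = 0 := by
    have h4 : ∫ z, ⟪z, w⟫_ℝ ∂(ballMeasure n) = ∫ z, ⟪-z, w⟫_ℝ ∂(ballMeasure n) := by
      have := (Measure.measurePreserving_neg (volume : Measure (Eu n))).setIntegral_preimage_emb
        (MeasurableEquiv.neg (Eu n)).measurableEmbedding (fun z => ⟪z, w⟫_ℝ) (ball (0 : Eu n) 1)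
      rw [← this]
      congr 2
      ext z; simp
    simp only [inner_neg_left, integral_neg] at h4
    linarith
  have h4 : ∫ z, ‖x - O‖ ^ 2 / 8 * (1 - 2 * ⟪z, w⟫_ℝ) ∂(ballMeasure n) =
      ‖x - O‖ ^ 2 / 8 * ballVol n := by
    rw [integral_const_mul, integral_sub (integrable_const _)
      (integrable_ball_of_continuousOn (by fun_prop)), integral_const_mul, h3, integral_const_ball]
    simp
  have h5 : ∫ z, ⟪(O : Eu n) - mob x z, (O : Eu n)⟫_ℝ ∂(ballMeasure n) ≤
      ballVol n * ‖bubCenter x - O‖ := by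
    have h6 : ∫ z, ⟪(O : Eu n) - mob x z, (O : Eu n)⟫_ℝ ∂(ballMeasure n) =
        ⟪∫ z, ((O : Eu n) - mob x z) ∂(ballMeasure n), (O : Eu n)⟫_ℝ := by
      have i3 : Integrable (fun z => (O : Eu n) - mob x z) (ballMeasure n) :=
        (integrable_const _).sub (integrable_mob hx)
      rw [real_inner_comm, ← integral_inner i3]
      exact integral_congr_ae (Eventually.of_forall fun z => real_inner_comm _ _)
    have h7 : ∫ z, ((O : Eu n) - mob x z) ∂(ballMeasure n) =
        ballVol n • ((O : Eu n) - bubCenter x) := by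
      rw [integral_sub (integrable_const _) (integrable_mob hx), integral_const_ball, smul_sub,
        bubCenter, smul_smul, mul_inv_cancel₀ hB.ne', one_smul]
    rw [h6, h7]
    refine (real_inner_le_norm _ _).trans (le_of_eq ?_)
    rw [hO, mul_one, norm_smul, Real.norm_of_nonneg hB.le, norm_sub_rev]
  have h6 : ‖x - O‖ ^ 2 / 8 * ballVol n ≤ ballVol n * ‖bubCenter x - O‖ := by
    rw [← h4]; exact h2.trans h5
  nlinarith

/-- If the index of a bubble is close to `O`, then so is its centre of mass. -/
lemma exists_norm_bubCenter_sub_le (O : Sph n) {ε : ℝ} (hε : 0 < ε) : ∃ D₀ : ℝ, 0 < D₀ ∧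
    ∀ x : Eu n, ‖x‖ < 1 → ‖x - O‖ ≤ D₀ → ‖bubCenter x - O‖ ≤ ε := by
  have hB := ballVol_pos (n := n)
  have hO : ‖(O : Eu n)‖ = 1 := by simp
  -- `φ D z` bounds `‖mob x z - O‖` when `‖x - O‖ ≤ D`, and it tends to zero with `D`
  set φ : ℝ → Eu n → ℝ := fun D z => min 2 (2 * D / (1 - ‖z‖)) with hφ
  have hmeas : ∀ D, AEStronglyMeasurable (φ D) (ballMeasure n) := fun D => by
    refine Measurable.aestronglyMeasurable ?_
    fun_prop
  have hφb : ∀ D : ℝ, 0 ≤ D → ∀ z ∈ ball (0 : Eu n) 1, ‖φ D z‖ ≤ 2 := by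
    intro D hD z hz
    have hz1 : 0 < 1 - ‖z‖ := sub_pos.2 (mem_ball_zero_iff.1 hz)
    rw [Real.norm_of_nonneg (le_min (by norm_num) (by positivity))]
    exact min_le_left _ _
  have hlim : Tendsto (fun D => ∫ z, φ D z ∂(ballMeasure n)) (𝓝[>] 0) (𝓝 0) := by
    suffices h : Tendsto (fun D => ∫ z, φ D z ∂(ballMeasure n)) (𝓝[>] 0)
        (𝓝 (∫ _, (0 : ℝ) ∂(ballMeasure n))) by rwa [integral_zero] at h
    refine tendsto_integral_filter_of_dominated_convergence (fun _ => 2)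
      (Eventually.of_forall hmeas) ?_ (integrable_const _) ?_
    · filter_upwards [self_mem_nhdsWithin] with D hD
      filter_upwards [ae_restrict_mem measurableSet_ball] with z hz
      exact hφb D (le_of_lt hD) z hz
    · refine Eventually.of_forall fun z => ?_
      have : Continuous fun D : ℝ => φ D z := by simp only [hφ]; fun_prop
      have h0 := (this.tendsto 0).mono_left (nhdsWithin_le_nhds (s := Ioi 0))
      simpa [hφ] using h0
  obtain ⟨D₀, h1, h2⟩ := ((hlim.eventually_lt_const (mul_pos hB hε)).and
    self_mem_nhdsWithin).exists
  have hD₀ : 0 < D₀ := h2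
  refine ⟨D₀, hD₀, fun x hx hD => ?_⟩
  refine (norm_bubCenter_sub_le hx O).trans ?_
  rw [inv_mul_le_iff₀ hB]
  refine le_trans ?_ h1.le
  refine integral_mono_ae ((integrable_mob hx).sub (integrable_const _)).norm
    (Integrable.of_bound (hmeas D₀) 2 ?_) ?_
  · filter_upwards [ae_restrict_mem measurableSet_ball] with z hz
    exact hφb D₀ hD₀.le z hz
  · filter_upwards [ae_restrict_mem measurableSet_ball] with z hz
    have hz1 : ‖z‖ < 1 := mem_ball_zero_iff.1 hz
    have hpos : 0 < 1 - ‖z‖ := sub_pos.2 hz1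
    refine le_min ?_ ?_
    · calc ‖mob x z - O‖ ≤ ‖mob x z‖ + ‖(O : Eu n)‖ := norm_sub_le _ _
        _ ≤ 2 := by rw [hO]; linarith [norm_mob_le hx hz1.le]
    · have hden := den_pos hx hz1.le
      have h3 := norm_mob_sub_mob_sq hden.ne' (den_pos hx (norm_mob_eq hx hO).le).ne'
      have h4 : conf x O = (1 - ‖x‖ ^ 2) / ‖x - O‖ ^ 2 := by
        rw [conf, den_sphere hO, norm_sub_rev]
      rw [mob_mob hx hO.le, conf_mob_self hx hO.le, h4, inv_div] at h3
      have h5 : ‖z - mob x O‖ ≤ 2 := by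
        calc ‖z - mob x O‖ ≤ ‖z‖ + ‖mob x (O : Eu n)‖ := norm_sub_le _ _
          _ ≤ 2 := by rw [norm_mob_eq hx hO]; linarith
      have h6 : (1 - ‖z‖) ^ 2 ≤ den x z := by
        refine le_trans ?_ den_ge
        have : ‖x‖ * ‖z‖ ≤ ‖z‖ := mul_le_of_le_one_left (norm_nonneg _) hx.le
        exact pow_le_pow_left₀ hpos.le (by linarith) 2
      refine abs_le_of_sq_le_sq' ?_ (by positivity) |>.2
      have h7 : conf x z * (‖x - O‖ ^ 2 / (1 - ‖x‖ ^ 2)) = ‖x - O‖ ^ 2 / den x z := by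
        have := (one_sub_norm_sq_pos hx).ne'
        rw [conf]; field_simp
      rw [h3, h7, div_pow, mul_pow, div_mul_eq_mul_div, mul_comm (2 ^ 2 : ℝ)]
      gcongr

end MassCenter

/-! ### The boundary of the neighbourhood of the bubbles -/

section Boundary

variable {n : ℕ}

lemma norm_sub_sq_eq_geo (O z : Sph n) : ‖(z : Eu n) - O‖ ^ 2 = 2 - 2 * Real.cos (geo O z) := by
  have h : Real.cos (geo O z) = ⟪(O : Eu n), (z : Eu n)⟫_ℝ := by
    rw [geo, InnerProductGeometry.cos_angle]; simp
  rw [h, norm_sub_rev, norm_sub_sq_real]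
  simp; ring

lemma norm_sub_le_geo (O z : Sph n) : ‖(z : Eu n) - O‖ ≤ geo O z := by
  have h0 : 0 ≤ geo O z := InnerProductGeometry.angle_nonneg _ _
  refine abs_le_of_sq_le_sq' ?_ h0 |>.2
  rw [norm_sub_sq_eq_geo]
  have := Real.one_sub_sq_div_two_le_cos (x := geo O z)
  linarith

lemma exists_geo_eq (hn : 2 ≤ n) (O : Sph n) {s : ℝ} (hs : s ∈ Icc 0 Real.pi) :
    ∃ z : Sph n, geo O z = s := by
  have hO : ‖(O : Eu n)‖ = 1 := by simp
  have hO0 : (O : Eu n) ≠ 0 := norm_ne_zero_iff.1 (by rw [hO]; norm_num)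
  have hrank : 1 < Module.rank ℝ (Eu n) := by
    rw [← Module.finrank_eq_rank, finrank_euclideanSpace_fin]
    exact_mod_cast (by omega : 1 < n)
  have hconn := isPreconnected_sphere hrank (0 : Eu n) 1
  have hcont : ContinuousOn (fun z : Eu n => InnerProductGeometry.angle (O : Eu n) z)
      (sphere 0 1) := by
    intro z hz
    have hz0 : z ≠ 0 := norm_ne_zero_iff.1 (by rw [mem_sphere_zero_iff_norm.1 hz]; norm_num)
    have h1 : ContinuousAt (fun y : Eu n × Eu n => InnerProductGeometry.angle y.1 y.2) (O, z) :=
      InnerProductGeometry.continuousAt_angle hO0 hz0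
    have h2 : ContinuousAt (fun z : Eu n => ((O : Eu n), z)) z := by fun_prop
    exact (ContinuousAt.comp (g := fun y : Eu n × Eu n => InnerProductGeometry.angle y.1 y.2)
      h1 h2).continuousWithinAt
  have h3 := hconn.intermediate_value (a := (O : Eu n)) (b := -(O : Eu n)) O.2 (by simp) hcont
  rw [InnerProductGeometry.angle_self hO0, InnerProductGeometry.angle_self_neg_of_nonzero hO0] at h3
  obtain ⟨z, hz, rfl⟩ := h3 hs
  exact ⟨⟨z, hz⟩, rfl⟩

/-- The error term is small compared with `s ^ α`: its derivative is small compared with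
`s ^ (α - 1)`, and it tends to zero because `h` is continuous at `O`. -/
lemma eventually_error_le (hn : 2 ≤ n) {α : ℝ} (hα : 0 < α) {h : Sph n → ℝ} (hc : Continuous h)
    (O : Sph n) {a ε : ℝ} {k : ℝ → ℝ} (ha : 0 < a) (hε : 0 < ε)
    (hk : ∀ z, geo O z < ε → h z = h O - a * geo O z ^ α + k (geo O z))
    (hd : DifferentiableOn ℝ k (Ioo 0 ε))
    (ho : deriv k =o[𝓝[>] (0 : ℝ)] fun s => s ^ (α - 1)) :
    ∃ r : ℝ, 0 < r ∧ r ≤ ε ∧ r ≤ Real.pi ∧ ∀ s ∈ Ioo 0 r, k s ≤ a / 2 * s ^ α := by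
  -- every small `s` is the distance of some point from `O`, so `k s` is determined by `h`
  have hlim : Tendsto k (𝓝[>] 0) (𝓝 0) := by
    rw [Metric.tendsto_nhdsWithin_nhds]
    intro η hη
    obtain ⟨δ, hδ, hδh⟩ := Metric.continuousAt_iff.1 hc.continuousAt (η / 2) (half_pos hη)
    have h1 : Tendsto (fun s : ℝ => a * s ^ α) (𝓝 0) (𝓝 0) := by
      have : Continuous fun s : ℝ => a * s ^ α := continuous_const.mul
        (Real.continuous_rpow_const hα.le)
      simpa [Real.zero_rpow hα.ne'] using this.tendsto 0
    obtain ⟨δ', hδ', hδa⟩ := Metric.tendsto_nhds_nhds.1 h1 (η / 2) (half_pos hη)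
    refine ⟨min (min δ δ') (min ε Real.pi), by positivity, fun {s} hs hsd => ?_⟩
    have hs0 : 0 < s := hs
    rw [Real.dist_eq, sub_zero, abs_of_pos hs0, lt_min_iff, lt_min_iff, lt_min_iff] at hsd
    obtain ⟨⟨s1, s2⟩, s3, s4⟩ := hsd
    obtain ⟨z, hz⟩ := exists_geo_eq hn O ⟨hs0.le, s4.le⟩
    have h2 := hk z (by rw [hz]; exact s3)
    rw [hz] at h2
    have h3 : dist (h z) (h O) < η / 2 := by
      refine hδh ?_
      rw [Subtype.dist_eq, dist_eq_norm]
      exact ((norm_sub_le_geo O z).trans_eq hz).trans_lt s1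
    have h4 := @hδa s (by rw [Real.dist_eq, sub_zero, abs_of_pos hs0]; exact s2)
    rw [Real.dist_eq] at h3 h4 ⊢
    have h5 : k s - 0 = (h z - h O) + (a * s ^ α - 0) := by rw [h2]; ring
    rw [h5]
    exact (abs_add_le _ _).trans_lt (by linarith)
  have hsmall := ho.bound (mul_pos (half_pos ha) hα)
  rw [eventually_nhdsWithin_iff, Metric.eventually_nhds_iff] at hsmall
  obtain ⟨δ, hδ, hδk⟩ := hsmall
  refine ⟨min δ (min ε Real.pi), by positivity, (min_le_right _ _).trans (min_le_left _ _),
    (min_le_right _ _).trans (min_le_right _ _), fun s hs => ?_⟩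
  set r := min δ (min ε Real.pi)
  have hr1 : r ≤ δ := min_le_left _ _
  have hr2 : r ≤ ε := (min_le_right _ _).trans (min_le_left _ _)
  have hder : ∀ y ∈ Ioo 0 r, HasDerivAt (fun s => k s - a / 2 * s ^ α)
      (deriv k y - a / 2 * (α * y ^ (α - 1))) y := by
    intro y hy
    have h1 : HasDerivAt k (deriv k y) y := (hd.differentiableAt
      (Ioo_mem_nhds hy.1 (hy.2.trans_le hr2))).hasDerivAt
    exact h1.sub ((Real.hasDerivAt_rpow_const (Or.inl hy.1.ne')).const_mul _)
  have hanti : AntitoneOn (fun s => k s - a / 2 * s ^ α) (Ioo 0 r) := by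
    refine antitoneOn_of_deriv_nonpos (convex_Ioo _ _)
      (fun y hy => (hder y hy).continuousAt.continuousWithinAt) ?_ ?_
    · rw [interior_Ioo]
      exact fun y hy => (hder y hy).differentiableAt.differentiableWithinAt
    · rw [interior_Ioo]
      intro y hy
      rw [(hder y hy).deriv]
      have h1 := hδk (y := y) (by
        rw [Real.dist_eq, sub_zero, abs_of_pos hy.1]; exact hy.2.trans_le hr1) hy.1
      rw [Real.norm_eq_abs, Real.norm_of_nonneg (Real.rpow_nonneg hy.1.le _)] at h1
      have := le_abs_self (deriv k y)
      linarith
  have hlim' : Tendsto (fun s => k s - a / 2 * s ^ α) (𝓝[>] 0) (𝓝 0) := by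
    have h1 : Tendsto (fun s : ℝ => a / 2 * s ^ α) (𝓝[>] 0) (𝓝 0) := by
      have : Continuous fun s : ℝ => a / 2 * s ^ α := continuous_const.mul
        (Real.continuous_rpow_const hα.le)
      simpa [Real.zero_rpow hα.ne'] using (this.tendsto 0).mono_left nhdsWithin_le_nhds
    simpa using hlim.sub h1
  have hev : ∀ᶠ y in 𝓝[>] (0 : ℝ), k s - a / 2 * s ^ α ≤ k y - a / 2 * y ^ α := by
    filter_upwards [Ioo_mem_nhdsGT hs.1] with y hy
    exact hanti ⟨hy.1, hy.2.trans hs.2⟩ hs hy.2.le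
  have := ge_of_tendsto hlim' hev
  linarith

/-- An explicit function above `h` that has the same value and a flat local maximum at `O`. It is
non-negative, whereas `h` may be negative far from `O`; the last term is large there, and near `O`
it is negligible at concentrated bubbles. -/
lemma FlatMaximum.exists_majorant (hn : 3 ≤ n) {α : ℝ} (hα : 0 < α) {h : Sph n → ℝ} {O : Sph n}
    (hh : FlatMaximum h O α) : ∃ c M : ℝ, 0 < c ∧ 0 ≤ M ∧ ∀ z : Sph n,
      h z ≤ h O - c * ‖(z : Eu n) - O‖ ^ α + M * ‖(z : Eu n) - O‖ ^ (2 * (n - 1)) ∧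
      0 ≤ h O - c * ‖(z : Eu n) - O‖ ^ α + M * ‖(z : Eu n) - O‖ ^ (2 * (n - 1)) := by
  obtain ⟨a, ε, k, ha, hε, hk, hd, ho⟩ := hh.flat
  obtain ⟨r, hr0, hrε, hrπ, hr⟩ := eventually_error_le (by omega) hα hh.continuous O ha hε hk hd ho
  obtain ⟨B, hB⟩ := isCompact_univ.exists_bound_of_continuousOn hh.continuous.continuousOn
  have hO := hh.pos
  have hB0 : 0 ≤ B := (norm_nonneg _).trans (hB O (mem_univ _))
  have hcos : Real.cos r < 1 := by
    rw [← Real.cos_zero]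
    exact Real.cos_lt_cos_of_nonneg_of_le_pi le_rfl hrπ hr0
  -- closer than `r₁` the expansion of `h` applies, closer than `r₂` the majorant is positive
  set r₁ := √(2 - 2 * Real.cos r) with hr₁
  set r₂ := (h O / (a / 2)) ^ (1 / α) with hr₂
  have hr₁0 : 0 < r₁ := Real.sqrt_pos.2 (by linarith)
  have hr₂0 : 0 < r₂ := by positivity
  set r₃ := min r₁ r₂ with hr₃
  have hr₃0 : 0 < r₃ := lt_min hr₁0 hr₂0
  refine ⟨a / 2, (B + a / 2 * 2 ^ α) / r₃ ^ (2 * (n - 1)), half_pos ha, by positivity,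
    fun z => ?_⟩
  set ρ := ‖(z : Eu n) - O‖ with hρ
  have hρ0 : 0 ≤ ρ := norm_nonneg _
  set M := (B + a / 2 * 2 ^ α) / r₃ ^ (2 * (n - 1)) with hM
  have hM0 : 0 ≤ M := by positivity
  rcases lt_or_ge ρ r₃ with hlt | hge
  · have h0 : 0 ≤ M * ρ ^ (2 * (n - 1)) := by positivity
    have h1 : h z ≤ h O - a / 2 * ρ ^ α := by
      rcases (InnerProductGeometry.angle_nonneg (O : Eu n) (z : Eu n)).eq_or_lt with hg | hg
      · have h2 : ρ ≤ 0 := (norm_sub_le_geo O z).trans_eq hg.symm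
        have h3 : z = O := Subtype.ext (sub_eq_zero.1 (norm_le_zero_iff.1 h2))
        have h4 : ρ = 0 := le_antisymm h2 hρ0
        rw [h3, h4, Real.zero_rpow hα.ne']; simp
      · have hgr : geo O z < r := by
          by_contra hcon
          push Not at hcon
          have h2 : Real.cos (geo O z) ≤ Real.cos r :=
            Real.cos_le_cos_of_nonneg_of_le_pi hr0.le (InnerProductGeometry.angle_le_pi _ _) hcon
          have h3 : r₁ ≤ ρ := by
            refine Real.sqrt_le_iff.2 ⟨hρ0, ?_⟩
            rw [hρ, norm_sub_sq_eq_geo]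
            linarith
          exact absurd (hlt.trans_le (min_le_left _ _)) (not_lt.2 h3)
        have h2 := hk z (hgr.trans_le hrε)
        have h3 := hr (geo O z) ⟨hg, hgr⟩
        have h4 : ρ ^ α ≤ geo O z ^ α := Real.rpow_le_rpow hρ0 (norm_sub_le_geo O z) hα.le
        have h5 := mul_le_mul_of_nonneg_left h4 (half_pos ha).le
        linarith
    have h2 : a / 2 * ρ ^ α ≤ h O := by
      have h3 : ρ ^ α ≤ r₂ ^ α :=
        Real.rpow_le_rpow hρ0 (hlt.le.trans (min_le_right _ _)) hα.le
      rw [hr₂, ← Real.rpow_mul (by positivity), one_div_mul_cancel hα.ne', Real.rpow_one,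
        le_div_iff₀ (half_pos ha)] at h3
      linarith
    constructor <;> linarith
  · have h1 : ρ ^ α ≤ 2 ^ α := Real.rpow_le_rpow hρ0 (norm_sub_le_two z O) hα.le
    have h2 : r₃ ^ (2 * (n - 1)) ≤ ρ ^ (2 * (n - 1)) := pow_le_pow_left₀ hr₃0.le hge _
    have h3 : B + a / 2 * 2 ^ α ≤ M * ρ ^ (2 * (n - 1)) := by
      calc B + a / 2 * 2 ^ α = M * r₃ ^ (2 * (n - 1)) := by rw [hM]; field_simp
        _ ≤ _ := mul_le_mul_of_nonneg_left h2 hM0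
    have h4 := mul_le_mul_of_nonneg_left h1 (half_pos ha).le
    have h5 := (le_abs_self _).trans (hB z (mem_univ z))
    constructor <;> linarith

lemma bubbleDist_le_add (hn : 3 ≤ n) (O : Sph n) (u w : H1 n) :
    bubbleDist u ≤ bubbleDist w + normE (u - w) := by
  rw [← sub_le_iff_le_add]
  refine bubbleDist_ge O w fun x hx t => ?_
  rw [sub_le_iff_le_add]
  have h1 := bubbleDist_le O u hx t
  have h2 := normE_sub_le hn u w (t • bubH hx)
  linarith

lemma normE_sub_comm (u w : H1 n) : normE (u - w) = normE (w - u) := by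
  rw [← normE_neg, neg_sub]

/-- The estimate at the critical exponent: on the boundary of the neighbourhood the weighted
critical integral stays a definite amount below its value at a bubble concentrated at `O`. A
function there is either not close to the bubbles, or close to a bubble that is not concentrated
near `O`, for otherwise all functions near it would lie in the neighbourhood. -/
lemma exists_weighted_integral_le_on_boundary (hn : 3 ≤ n) (O : Sph n) {α H c₁ M : ℝ}
    (hα : 0 < α) (hα' : α < n - 1) (hH : 0 < H) (hc₁ : 0 < c₁) (hM : 0 ≤ M) :
    ∃ ρ₁ : ℝ, 0 < ρ₁ ∧ ∀ ρ₀ : ℝ, 0 < ρ₀ → ρ₀ ≤ ρ₁ → ∃ δ : ℝ, 0 < δ ∧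
      ∀ u ∈ boundaryIn (bubbleNhd O ρ₀), ∫ z : Sph n,
        (H - c₁ * ‖(z : Eu n) - O‖ ^ α + M * ‖(z : Eu n) - O‖ ^ (2 * (n - 1)))
          * trace u z ^ (tau n + 1) ∂(sphMeasure n) ≤ H * sphArea n - δ := by
  obtain ⟨c, C, e₀, D₀, hc, hC, he₀, hD₀, hmain⟩ :=
    exists_weighted_integral_le hn O hα hα' hH hc₁ hM
  obtain ⟨C', η₀, hC', hη₀, hmass⟩ := exists_norm_massCenter_sub_le hn
  refine ⟨min (√e₀ / 2) (min (η₀ / 3) (D₀ ^ 2 / (8 * (1 + 3 * C')))), by positivity,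
    fun ρ₀ hρ₀ hρ₁ => ?_⟩
  have hρe : (2 * ρ₀) ^ 2 ≤ e₀ := by
    have h1 : 2 * ρ₀ ≤ √e₀ := by
      have := hρ₁.trans (min_le_left _ _)
      linarith
    rw [← Real.sq_sqrt he₀.le]
    exact pow_le_pow_left₀ (by positivity) h1 2
  have hρη : 3 * ρ₀ ≤ η₀ := by
    have := hρ₁.trans ((min_le_right _ _).trans (min_le_left _ _))
    linarith
  have hρD : 8 * ((1 + 3 * C') * ρ₀) ≤ D₀ ^ 2 := by
    have := hρ₁.trans ((min_le_right _ _).trans (min_le_right _ _))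
    rw [le_div_iff₀ (by positivity)] at this
    linarith
  obtain ⟨D₁, hD₁, hcenter⟩ := exists_norm_bubCenter_sub_le O (half_pos hρ₀)
  set δ' := min (ρ₀ / 4) (min (ρ₀ / (4 * (C' + 1))) (η₀ / 2)) with hδ'
  have hδ'0 : 0 < δ' := by positivity
  have hδ1 : δ' ≤ ρ₀ / 4 := min_le_left _ _
  have hδ2 : C' * (2 * δ') ≤ ρ₀ / 2 := by
    have h1 : δ' ≤ ρ₀ / (4 * (C' + 1)) := (min_le_right _ _).trans (min_le_left _ _)
    rw [le_div_iff₀ (by positivity)] at h1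
    nlinarith
  have hδ3 : 2 * δ' ≤ η₀ := by
    have h1 : δ' ≤ η₀ / 2 := (min_le_right _ _).trans (min_le_right _ _)
    linarith
  set δ₁ := min (δ' ^ 2) (D₁ ^ α) with hδ₁
  have hδ₁0 : 0 < δ₁ := by positivity
  refine ⟨c * δ₁ / 2, by positivity, fun u hu => ?_⟩
  obtain ⟨huS, hub⟩ := hu
  -- so small that the drift costs at most half of the gain `c * δ₁`
  set κ := min ρ₀ (c * δ₁ / (2 * (C + 1))) with hκ
  have hκ0 : 0 < κ := by positivity
  have hκ1 : κ ≤ ρ₀ := min_le_left _ _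
  have hκ2 : C * κ ≤ c * δ₁ / 2 := by
    have h1 : κ ≤ c * δ₁ / (2 * (C + 1)) := min_le_right _ _
    rw [le_div_iff₀ (by positivity)] at h1
    nlinarith
  have hdist : bubbleDist u ≤ ρ₀ := by
    refine le_of_forall_pos_le_add fun ε hε => ?_
    obtain ⟨⟨w, ⟨⟨-, -, hw⟩, -⟩, hwu⟩, -⟩ := hub ε hε
    have := bubbleDist_le_add hn O u w
    linarith
  obtain ⟨x, hx, hrem, hdrift⟩ := exists_almost_optimal_bubble hn O huS hκ0
  set t := coef hx u with ht
  have ht0 : 0 ≤ t := coef_nonneg hn hx huS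
  have hrem2 : normE (u - t • bubH hx) ≤ 2 * ρ₀ := by
    have : normE (u - t • bubH hx) ≤ bubbleDist u + κ := hrem
    linarith
  have he : energy (remainder hx u) ≤ e₀ := by
    rw [← sq_normE hn]
    exact (pow_le_pow_left₀ (normE_nonneg _) hrem2 2).trans hρe
  -- the bubble is concentrated near `O`, because a nearby function has its centre of mass there
  have hD : ‖x - O‖ ≤ D₀ := by
    obtain ⟨⟨w, ⟨⟨hwS, hwO, -⟩, -⟩, hwu⟩, -⟩ := hub ρ₀ hρ₀
    have h1 : normE (w - t • bubH hx) ≤ 3 * ρ₀ := by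
      have := normE_sub_le hn w u (t • bubH hx)
      rw [normE_sub_comm w u] at this
      linarith
    have h2 := hmass w hwS x hx t (3 * ρ₀) ht0 (by positivity) hρη h1
    have h3 : ‖bubCenter x - O‖ ≤ ‖bubCenter x - massCenter w‖ + ‖massCenter w - O‖ :=
      norm_sub_le_norm_sub_add_norm_sub _ _ _
    rw [norm_sub_rev (bubCenter x) (massCenter w)] at h3
    have h4 := norm_sub_sq_le_bubCenter hx O
    refine abs_le_of_sq_le_sq' ?_ hD₀.le |>.2
    refine h4.trans (le_trans ?_ hρD)
    linarith
  -- otherwise all functions in the constraint set near `u` would belong to the neighbourhood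
  have hfar : δ₁ ≤ energy (remainder hx u) + ‖x - O‖ ^ α := by
    by_contra hcon
    push Not at hcon
    have hDα : 0 ≤ ‖x - O‖ ^ α := Real.rpow_nonneg (norm_nonneg _) _
    have hen := energy_nonneg hn (remainder hx u)
    have h1 : normE (u - t • bubH hx) ≤ δ' := by
      refine abs_le_of_sq_le_sq' ?_ hδ'0.le |>.2
      have h2 : energy (remainder hx u) ≤ δ' ^ 2 := by
        have : δ₁ ≤ δ' ^ 2 := min_le_left _ _
        linarith
      rwa [← sq_normE hn] at h2
    have h2 : ‖x - O‖ ≤ D₁ := by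
      have h3 : ‖x - O‖ ^ α ≤ D₁ ^ α := by
        have : δ₁ ≤ D₁ ^ α := min_le_right _ _
        linarith
      exact (Real.rpow_le_rpow_iff (norm_nonneg _) hD₁.le hα).1 h3
    obtain ⟨-, w, ⟨hwS, hwN⟩, hwu⟩ := hub δ' hδ'0
    have h3 : normE (w - t • bubH hx) ≤ 2 * δ' := by
      have := normE_sub_le hn w u (t • bubH hx)
      rw [normE_sub_comm w u] at this
      linarith
    refine hwN ⟨hwS, ?_, ?_⟩
    · have h4 := hmass w hwS x hx t (2 * δ') ht0 (by positivity) hδ3 h3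
      have h5 := hcenter x hx h2
      have h6 : ‖massCenter w - O‖ ≤ ‖massCenter w - bubCenter x‖ + ‖bubCenter x - O‖ :=
        norm_sub_le_norm_sub_add_norm_sub _ _ _
      linarith
    · have := bubbleDist_le O w hx t
      linarith
  have hfin := hmain x hx u huS he hD
  have h1 := mul_le_mul_of_nonneg_left hfar hc.le
  have h2 := mul_le_mul_of_nonneg_left hdrift hC
  linarith

lemma rpow_le_interpolation {y p q : ℝ} (hy : 0 ≤ y) (hp : 0 ≤ p) (hpq : p ≤ q) (hq : 0 < q) :
    y ^ p ≤ p / q * y ^ q + (1 - p / q) := by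
  have h1 : p / q ≤ 1 := (div_le_one hq).2 hpq
  have h := Real.geom_mean_le_arith_mean2_weighted (div_nonneg hp hq.le) (sub_nonneg.2 h1)
    (Real.rpow_nonneg hy q) zero_le_one (add_sub_cancel _ _)
  rw [← Real.rpow_mul hy, mul_div_cancel₀ _ hq.ne', Real.one_rpow, mul_one, mul_one] at h
  exact h

/-- Passage from the critical exponent to the exponents slightly below it. -/
lemma exists_J_le_of_critical (hn : 3 ≤ n) {h g : Sph n → ℝ} (hc : Continuous h)
    (hg : Continuous g) (hhg : ∀ z, h z ≤ g z) (hg0 : ∀ z, 0 ≤ g z) {A δ : ℝ} (hA : 0 ≤ A)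
    (hδ : 0 < δ) : ∃ p₀ δ₀ : ℝ, 1 < p₀ ∧ p₀ < tau n ∧ 0 < δ₀ ∧ ∀ p : ℝ, p₀ ≤ p → p ≤ tau n →
      ∀ u ∈ constraintSet n,
        ∫ z, g z * trace u z ^ (tau n + 1) ∂(sphMeasure n) ≤ A - δ →
        Integrable (fun z => h z * trace u z ^ (p + 1)) (sphMeasure n) ∧ J h p u ≤ A - δ₀ := by
  have hτ := one_lt_tau hn
  set Γ := ∫ z, g z ∂(sphMeasure n) with hΓ
  have hΓ0 : 0 ≤ Γ := integral_nonneg hg0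
  refine ⟨max ((1 + tau n) / 2) (tau n - δ / (2 * (Γ + δ))), δ / 2, ?_, ?_, half_pos hδ,
    fun p hp₀ hp u hu hcrit => ?_⟩
  · exact lt_max_of_lt_left (by linarith)
  · exact max_lt (by linarith) (by have : 0 < δ / (2 * (Γ + δ)) := by positivity
                                   linarith)
  have hp1 : 1 < p := lt_of_lt_of_le (lt_max_of_lt_left (by linarith)) hp₀
  have hp2 : tau n - p ≤ δ / (2 * (Γ + δ)) := by
    have := (le_max_right _ _).trans hp₀
    linarith
  set θ := (p + 1) / (tau n + 1) with hθ
  have hθ1 : θ ≤ 1 := (div_le_one (by linarith)).2 (by linarith)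
  have hθ2 : (1 - θ) * (Γ + δ) ≤ δ / 2 := by
    have h1 : 1 - θ ≤ tau n - p := by
      rw [hθ, one_sub_div (by linarith), div_le_iff₀ (by linarith)]
      nlinarith
    have h2 : 1 - θ ≤ δ / (2 * (Γ + δ)) := h1.trans hp2
    rw [le_div_iff₀ (by positivity)] at h2
    linarith
  have hpt : ∀ᵐ z ∂(sphMeasure n), trace u z ^ (p + 1) ≤
      θ * trace u z ^ (tau n + 1) + (1 - θ) := by
    filter_upwards [hu.2.2] with z hz
    exact rpow_le_interpolation hz (by linarith) (by linarith) (by linarith)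
  have iq := integrable_trace_rpow hn hu
  have ip : Integrable (fun z => trace u z ^ (p + 1)) (sphMeasure n) := by
    refine Integrable.mono' ((iq.const_mul θ).add (integrable_const (1 - θ))) ?_ ?_
    · exact (Real.continuous_rpow_const (by linarith)).comp_aestronglyMeasurable (memLp_trace u).1
    · filter_upwards [hpt, hu.2.2] with z hz hz0
      rw [Real.norm_of_nonneg (Real.rpow_nonneg hz0 _)]
      exact hz
  refine ⟨integrable_continuous_mul hc ip, ?_⟩
  have igq := integrable_continuous_mul hg iq
  have h1 : J h p u ≤ ∫ z, (θ * (g z * trace u z ^ (tau n + 1)) + (1 - θ) * g z)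
      ∂(sphMeasure n) := by
    refine integral_mono_ae (integrable_continuous_mul hc ip)
      ((igq.const_mul θ).add ((integrable_sphere_of_continuous hg).const_mul _)) ?_
    filter_upwards [hpt, hu.2.2] with z hz hz0
    have h2 := mul_le_mul_of_nonneg_right (hhg z) (Real.rpow_nonneg hz0 (p + 1))
    have h3 := mul_le_mul_of_nonneg_left hz (hg0 z)
    calc h z * trace u z ^ (p + 1) ≤ g z * (θ * trace u z ^ (tau n + 1) + (1 - θ)) := h2.trans h3
      _ = _ := by ring
  rw [integral_add (igq.const_mul θ) ((integrable_sphere_of_continuous hg).const_mul _),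
    integral_const_mul, integral_const_mul, ← hΓ] at h1
  have hθ0 : 0 ≤ θ := div_nonneg (by linarith) (by linarith)
  have h2 := mul_le_mul_of_nonneg_left hcrit hθ0
  have h3 : 0 ≤ (1 - θ) * A := mul_nonneg (by linarith) hA
  nlinarith

end Boundary

end BallBubble

end

theorem proposition3p5 (n : ℕ) (hn : 3 ≤ n) (α : ℝ) (hα₁ : (n : ℝ) - 3 < α)
    (hα₂ : α < (n : ℝ) - 1) (h : BallBubble.Sph n → ℝ) (O : BallBubble.Sph n)
    (hh : BallBubble.FlatMaximum h O α) :
    ∃ ρ₁ : ℝ, 0 < ρ₁ ∧ ∀ ρ₀ : ℝ, 0 < ρ₀ → ρ₀ ≤ ρ₁ →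
      ∃ p₀ δ₀ : ℝ, 1 < p₀ ∧ p₀ < BallBubble.tau n ∧ 0 < δ₀ ∧
        ∀ p : ℝ, p₀ ≤ p → p ≤ BallBubble.tau n →
          ∀ u ∈ BallBubble.boundaryIn (BallBubble.bubbleNhd O ρ₀),
            MeasureTheory.Integrable (fun z => h z * BallBubble.trace u z ^ (p + 1))
                (BallBubble.sphMeasure n) ∧
              BallBubble.J h p u ≤ h O * BallBubble.sphArea n - δ₀ := by
  have hn' : (3 : ℝ) ≤ n := by exact_mod_cast hn
  have hα : 0 < α := by linarith
  obtain ⟨c, M, hc, hM, hmaj⟩ := hh.exists_majorant hn hα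
  obtain ⟨ρ₁, hρ₁, H⟩ :=
    BallBubble.exists_weighted_integral_le_on_boundary hn O hα hα₂ hh.pos hc hM
  refine ⟨ρ₁, hρ₁, fun ρ₀ h0 h1 => ?_⟩
  obtain ⟨δ, hδ, hcrit⟩ := H ρ₀ h0 h1
  have hcont : Continuous fun z : BallBubble.Sph n =>
      h O - c * ‖(z : BallBubble.Eu n) - O‖ ^ α
        + M * ‖(z : BallBubble.Eu n) - O‖ ^ (2 * (n - 1)) :=
    (continuous_const.sub (continuous_const.mul
      ((continuous_subtype_val.sub continuous_const).norm.rpow_const fun _ => Or.inr hα.le))).add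
      (continuous_const.mul ((continuous_subtype_val.sub continuous_const).norm.pow _))
  obtain ⟨p₀, δ₀, hp₁, hp₂, hδ₀, hJ⟩ := BallBubble.exists_J_le_of_critical hn hh.continuous hcont
    (fun z => (hmaj z).1) (fun z => (hmaj z).2)
    (mul_nonneg hh.pos.le MeasureTheory.measureReal_nonneg) hδ
  exact ⟨p₀, δ₀, hp₁, hp₂, hδ₀, fun p hp hp' u hu => hJ p hp hp' u hu.1 (hcrit u hu)⟩
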